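/- Fix a vocabulary with a countably infinite set $\mathcal D$ of constant symbols and countably many predicate symbols with arities, and no function symbols. A *program* is a finite set of rules $a \leftarrow b_1,\dots,b_m, \mathbf{not}\, c_1,\dots,\mathbf{not}\, c_n$ whose atoms are built from constants and variables; it is *stratified* if predicates can be given levels in $\mathbb N$ such that in every rule the predicates of the $b_i$ have level at most, and those of the $c_j$ have level strictly below, the level of the head predicate. Programs are interpreted by the stable-model semantics over the Herbrand base (all ground atoms): $M$ is a stable model of $P$ if it is the least model of the Gelfond–Lifschitz reduct of the grounding of $P$ over $\mathcal D$ with respect to $M$. First-order sentences are evaluated in a set $M$ of ground atoms as in the structure with universe $\mathcal D$ in which each constant denotes itself. An *abductive theory* $\langle P,\mathcal A,\mathcal C\rangle$ consists of a program $P$, a finite set $\mathcal A$ of *abducible* predicates, and a finite set $\mathcal C$ of first-order sentences (*integrity constraints*), such that every rule of $P$ with an abducible predicate in the head is a ground fact. *Abducibles* are ground atoms with a predicate in $\mathcal A$. An *observation* is a finite set $O$ of ground atoms with predicates not in $\mathcal A$. An *explanation* for $O$ is a pair $(E,F)$ of disjoint finite sets of abducibles with $F\subseteq P$ such that $O$ agrees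 with $(P\cup E)\setminus F$ and $\mathcal C$. Here "$O$ agrees with $Q$ and $\mathcal C$" has, throughout, one fixed meaning among the following four: (A) $Q$ has a stable model and all its stable models satisfy $\mathcal C$ and $O$; (B) all stable models of $Q$ satisfy $O$ and some stable model of $Q$ satisfies $\mathcal C$; (C) some stable model of $Q$ satisfies $\mathcal C$ and every stable model of $Q$ that satisfies $\mathcal C$ satisfies $O$; (D) some stable model of $Q$ satisfies both $\mathcal C$ and $O$. For a constant $c$, an *occurrence* of $c$ in $E$ is an argument position, of an atom in $E$, that holds $c$. A nonempty set $C$ of occurrences of one constant $c$ in $E$ determines the replacement function $f_{E,C}$, where $f_{E,C}(x)$ is obtained from $E$ by putting $x$ at all positions in $C$. Two replacement functions are independent if they concern different constants or their sets of occurrences are disjoint. The *degree of arbitrariness* of an explanation $(E,F)$ is the maximum number of pairwise independent replacement functions $f_{E,C}$ such that $(f_{E,C}(\xi),F)$ is an explanation for $O$, where $\xi$ is a constant that occurs neither in $E$, nor in $O$, nor in the theory (the choice of $\xi$ is immaterial). The explanation is *constrained* if its degree of arbitrariness is $0$. **Theorem.** Let $\mathcal A$ be a finite set of abducible predicates, $R$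 a (fixed) stratified program with no abducible predicates in the heads of its rules, and $\mathcal C$ a (fixed) finite set of integrity constraints. Inputs below are finite sets of ground atoms, written as lists of atoms, with symbols numbered and the numbers written in binary (the numbering of the constants being a bijection onto $\mathbb N$). 1. The following problem is in coNP: given a set $B$ of abducibles, an observation $O$, and a pair $(E,F)$ of sets of abducibles, decide whether $(E,F)$ is a constrained explanation for $O$ with respect to $\langle R\cup B,\mathcal A,\mathcal C\rangle$. 2. The following problem is in $\Sigma_2^P$: given a set $B$ of abducibles and an observation $O$, decide whether a constrained explanation for $O$ with respect to $\langle R\cup B,\mathcal A,\mathcal C\rangle$ exists. -/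

import Mathlib

namespace Abduction

/-! ### Vocabularies, atoms, programs -/

/-- A vocabulary of constant symbols and relation symbols with arities (no function symbols). -/
structure Vocabulary where
  /-- constant symbols -/
  Const : Type
  /-- predicate symbols -/
  Pred : Type
  /-- the arity of a predicate symbol -/
  arity : Pred → ℕ

variable {V : Vocabulary}

/-- Terms: variables (named by natural numbers) and constants. -/
inductive Term (V : Vocabulary) where
  | var (i : ℕ) : Term V
  | const (c : V.Const) : Term V

/-- Atoms `p(x₁, …, xₙ)`, where `n` is the arity of `p` and the arguments come from `X`. -/
structure Atom (V : Vocabulary) (X : Type) where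
  /-- the predicate symbol -/
  pred : V.Pred
  /-- the arguments -/
  args : Fin (V.arity pred) → X

/-- Ground atoms; the set of all of them is the Herbrand base. -/
abbrev GroundAtom (V : Vocabulary) : Type := Atom V V.Const

/-- Application of a function to all arguments of an atom. -/
def Atom.map {X Y : Type} (g : X → Y) (a : Atom V X) : Atom V Y := ⟨a.pred, fun k => g (a.args k)⟩

/-- The value of a term under an assignment of constants to the variables. -/
def Term.subst (θ : ℕ → V.Const) : Term V → V.Const
  | .var i => θ i
  | .const c => c

/-- The set of constants (at most one) of a term. -/
def Term.consts : Term V → Set V.Const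
  | .var _ => ∅
  | .const c => {c}

/-- The set of constants of an atom. -/
def Atom.consts (a : Atom V (Term V)) : Set V.Const := {c | ∃ k, c ∈ (a.args k).consts}

/-- Rules `head ← pos₁, …, posₘ, not neg₁, …, not negₙ`. -/
structure Rule (V : Vocabulary) where
  /-- the head -/
  head : Atom V (Term V)
  /-- the non-negated body atoms -/
  pos : List (Atom V (Term V))
  /-- the body atoms under `not` -/
  neg : List (Atom V (Term V))

/-- A ground atom, seen as a rule with empty body. -/
def GroundAtom.fact (a : GroundAtom V) : Rule V := ⟨Atom.map Term.const a, [], []⟩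

/-- The set of facts given by a set of ground atoms. -/
def facts (S : Set (GroundAtom V)) : Set (Rule V) := GroundAtom.fact '' S

/-- The set of constants of a rule. -/
def Rule.consts (r : Rule V) : Set V.Const :=
  r.head.consts ∪ {c | ∃ a ∈ r.pos ++ r.neg, c ∈ a.consts}

/-- A program is stratified if the predicates can be assigned levels so that, in every rule, no
predicate of the body has a level above that of the head, and those under `not` have a lower one. -/
def Stratified (P : Set (Rule V)) : Prop :=
  ∃ level : V.Pred → ℕ, ∀ r ∈ P,
    (∀ a ∈ r.pos, level a.pred ≤ level r.head.pred) ∧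
    (∀ a ∈ r.neg, level a.pred < level r.head.pred)

/-! ### Stable models -/

/-- `I` is a model of the reduct of (the grounding of) `P` with respect to `M`: the ground instances
of rules with a negated atom in `M` are deleted, and the negated atoms of the others are dropped. -/
def IsReductModel (P : Set (Rule V)) (M I : Set (GroundAtom V)) : Prop :=
  ∀ r ∈ P, ∀ θ : ℕ → V.Const,
    (∀ a ∈ r.neg, a.map (Term.subst θ) ∉ M) →
    (∀ a ∈ r.pos, a.map (Term.subst θ) ∈ I) → r.head.map (Term.subst θ) ∈ I

/-- `M` is a stable model of `P`: it is the least model of the reduct of `P` with respect to `M`. -/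
def IsStableModel (P : Set (Rule V)) (M : Set (GroundAtom V)) : Prop :=
  IsLeast {I | IsReductModel P M I} M

/-! ### Integrity constraints -/

/-- The first-order language of a vocabulary. -/
def Vocabulary.lang (V : Vocabulary) : FirstOrder.Language where
  Functions
    | 0 => V.Const
    | _ + 1 => Empty
  Relations n := {p : V.Pred // V.arity p = n}

/-- The Herbrand structure of a set `M` of ground atoms: the universe is the set of all constants,
and each constant denotes itself. -/
@[reducible]
def herbrand (M : Set (GroundAtom V)) : V.lang.Structure V.Const where
  funMap {n} :=
    match n with
    | 0 => fun c _ => c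
    | _ + 1 => fun f _ => Empty.elim f
  RelMap p xs := (⟨p.1, fun i => xs (Fin.cast p.2 i)⟩ : GroundAtom V) ∈ M

/-- `M ⊨ φ` for every sentence `φ` in `C`. -/
def Satisfies (M : Set (GroundAtom V)) (C : Set V.lang.Sentence) : Prop :=
  ∀ φ ∈ C, @FirstOrder.Language.Sentence.Realize V.lang V.Const (herbrand M) φ

/-- The constants of a term of the first-order language. -/
def foTermConsts {α : Type} : V.lang.Term α → Set V.Const
  | .var _ => ∅
  | .func (l := 0) c _ => {c}
  | .func (l := _ + 1) f _ => Empty.elim f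

/-- The constants of a first-order formula. -/
def foConsts {α : Type} : {n : ℕ} → V.lang.BoundedFormula α n → Set V.Const
  | _, .falsum => ∅
  | _, .equal t s => foTermConsts t ∪ foTermConsts s
  | _, .rel _ ts => {c | ∃ i, c ∈ foTermConsts (ts i)}
  | _, .imp φ ψ => foConsts φ ∪ foConsts ψ
  | _, .all φ => foConsts φ

/-! ### Abductive theories and explanations -/

/-- Abductive theories: a finite program, a finite set of abducible predicates and a finite set of
integrity constraints, where rules with an abducible predicate in the head are ground facts. -/
structure AbductiveTheory (V : Vocabulary) where
  /-- the program -/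
  prog : Set (Rule V)
  /-- the abducible predicates -/
  abd : Set V.Pred
  /-- the integrity constraints -/
  constraints : Set V.lang.Sentence
  prog_finite : prog.Finite
  abd_finite : abd.Finite
  constraints_finite : constraints.Finite
  abd_fact : ∀ r ∈ prog, r.head.pred ∈ abd → ∃ a : GroundAtom V, r = GroundAtom.fact a

/-- The ground atoms whose predicate is in `Q`. -/
def groundAtoms (Q : Set V.Pred) : Set (GroundAtom V) := {a | a.pred ∈ Q}

/-- Observations (with respect to the set `A` of abducible predicates): finite sets of ground atoms
based on non-abducible predicates. -/
def IsObservation (A : Set V.Pred) (O : Set (GroundAtom V)) : Prop :=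
  O.Finite ∧ O ⊆ groundAtoms Aᶜ

/-- A program is consistent if it has a stable model. -/
def Consistent (P : Set (Rule V)) : Prop := ∃ M, IsStableModel P M

/-- Skeptical entailment: `P` is consistent and all its stable models have the property `Q`. -/
def Entails (P : Set (Rule V)) (Q : Set (GroundAtom V) → Prop) : Prop :=
  Consistent P ∧ ∀ M, IsStableModel P M → Q M

/-- The four kinds of agreement. -/
inductive AgreementKind where
  | typeA
  | typeB
  | typeC
  | typeD

/-- The observation `O` agrees with the program `P` and the integrity constraints `C`. -/
def Agrees (P : Set (Rule V)) (C : Set V.lang.Sentence) (O : Set (GroundAtom V)) :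
    AgreementKind → Prop
  | .typeA => Consistent P ∧ Entails P (fun M => Satisfies M C) ∧ Entails P (fun M => O ⊆ M)
  | .typeB => Entails P (fun M => O ⊆ M) ∧ ∃ M, IsStableModel P M ∧ Satisfies M C
  | .typeC => (∃ M, IsStableModel P M ∧ Satisfies M C) ∧
      ∀ M, IsStableModel P M → Satisfies M C → O ⊆ M
  | .typeD => ∃ M, IsStableModel P M ∧ Satisfies M C ∧ O ⊆ M

/-- `(E, F)` is an explanation (of type `τ`) of `O` with respect to `T`. -/
def IsExplanation (τ : AgreementKind) (T : AbductiveTheory V) (O E F : Set (GroundAtom V)) : Prop :=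
  E.Finite ∧ F.Finite ∧ E ⊆ groundAtoms T.abd ∧ F ⊆ groundAtoms T.abd ∧ Disjoint E F ∧
    facts F ⊆ T.prog ∧ Agrees ((T.prog ∪ facts E) \ facts F) T.constraints O τ

/-! ### Arbitrariness -/

/-- An argument position of a ground atom. -/
structure Occurrence (V : Vocabulary) where
  /-- the atom -/
  atom : GroundAtom V
  /-- the position -/
  pos : Fin (V.arity atom.pred)

/-- Replacement functions for `E` and a constant `c`, determined by a nonempty set of occurrences
of `c` in `E`. -/
structure Replacement (E : Set (GroundAtom V)) where
  /-- the constant -/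
  c : V.Const
  /-- the occurrences to be replaced -/
  occs : Set (Occurrence V)
  nonempty : occs.Nonempty
  mem : ∀ o ∈ occs, o.atom ∈ E
  eq : ∀ o ∈ occs, o.atom.args o.pos = c

open Classical in
/-- The value of a replacement function at `x`: the chosen occurrences are replaced by `x`. -/
noncomputable def Replacement.apply {E : Set (GroundAtom V)} (f : Replacement E) (x : V.Const) :
    Set (GroundAtom V) :=
  (fun a => ⟨a.pred, fun k => if ⟨a, k⟩ ∈ f.occs then x else a.args k⟩) '' E

/-- Independence of replacement functions. -/
def Replacement.Independent {E : Set (GroundAtom V)} (f g : Replacement E) : Prop :=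
  f.c ≠ g.c ∨ Disjoint f.occs g.occs

/-- The constants occurring in a set of ground atoms. -/
def constsOf (S : Set (GroundAtom V)) : Set V.Const := {c | ∃ a ∈ S, ∃ k, a.args k = c}

/-- The constants occurring in (the program or the constraints of) an abductive theory. -/
def AbductiveTheory.consts (T : AbductiveTheory V) : Set V.Const :=
  {c | ∃ r ∈ T.prog, c ∈ r.consts} ∪ {c | ∃ φ ∈ T.constraints, c ∈ foConsts φ}

/-- The constant `ξ` occurs neither in `E`, nor in `O`, nor in `T`. -/
def IsFresh (T : AbductiveTheory V) (O E : Set (GroundAtom V)) (ξ : V.Const) : Prop :=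
  ξ ∉ constsOf E ∧ ξ ∉ constsOf O ∧ ξ ∉ T.consts

/-- The degree of arbitrariness of `(E, F)`, computed with the constant `ξ`: the maximum number of
pairwise independent replacement functions whose value at `ξ` gives an explanation. -/
noncomputable def degree (τ : AgreementKind) (T : AbductiveTheory V) (O E F : Set (GroundAtom V))
    (ξ : V.Const) : ℕ∞ :=
  sSup {n | ∃ S : Finset (Replacement E),
    (S : Set (Replacement E)).Pairwise Replacement.Independent ∧
    (∀ f ∈ S, IsExplanation τ T O (f.apply ξ) F) ∧ n = S.card}

/-- `(E, F)` is a constrained explanation: an explanation with degree of arbitrariness `0`. -/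
def IsConstrainedExplanation (τ : AgreementKind) (T : AbductiveTheory V)
    (O E F : Set (GroundAtom V)) : Prop :=
  IsExplanation τ T O E F ∧ ∀ ξ, IsFresh T O E ξ → degree τ T O E F ξ = 0

/-! ### Complexity classes of languages -/

open Classical in
/-- The language `L` is decided by a deterministic (multi-stack) Turing machine in polynomial
time. -/
noncomputable def InP {Γ : Type} (L : Set (List Γ)) : Prop :=
  Nonempty (Turing.TM2ComputableInPolyTime (id : List Γ → List Γ) Computability.encodeBool
    (fun w => decide (w ∈ L)))

/-- The pair of a word over `Γ` and a word over `Δ`, as one word over the disjoint union of the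
alphabets. -/
def pairWord {Γ Δ : Type} (x : List Γ) (y : List Δ) : List (Γ ⊕ Δ) :=
  x.map Sum.inl ++ y.map Sum.inr

/-- `x ∈ L` iff there is a certificate `y`, of length polynomial in that of `x`, such that the pair
`(x, y)` is in `K`. -/
def IsPolyProjection {Γ Δ : Type} (L : Set (List Γ)) (K : Set (List (Γ ⊕ Δ))) : Prop :=
  ∃ p : Polynomial ℕ, ∀ x : List Γ,
    x ∈ L ↔ ∃ y : List Δ, y.length ≤ p.eval x.length ∧ pairWord x y ∈ K

/-- The class NP: polynomially long certificates, verified in polynomial time. -/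
def InNP {Γ : Type} (L : Set (List Γ)) : Prop :=
  ∃ (Δ : Type) (_ : Fintype Δ) (K : Set (List (Γ ⊕ Δ))), InP K ∧ IsPolyProjection L K

/-- The class coNP: complements of the languages in NP. -/
def InCoNP {Γ : Type} (L : Set (List Γ)) : Prop := InNP Lᶜ

/-- The class `Σ₂ᴾ`: polynomially long certificates, verified in coNP. -/
def InSigma2P {Γ : Type} (L : Set (List Γ)) : Prop :=
  ∃ (Δ : Type) (_ : Fintype Δ) (K : Set (List (Γ ⊕ Δ))), InCoNP K ∧ IsPolyProjection L K

/-! ### The decision problems -/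

/-- The input alphabet: binary digits, and marks that begin a set, an atom and an argument. -/
inductive Sym where
  | bit (b : Bool) : Sym
  | set : Sym
  | atom : Sym
  | arg : Sym

/-- Symbols are written as the binary expansions of their numbers. -/
def encodeSymbol {X : Type} [Encodable X] (x : X) : List Sym :=
  (Computability.encodeNat (Encodable.encode x)).map Sym.bit

/-- The word for a ground atom: the predicate, followed by the arguments. -/
def encodeAtom [Encodable V.Pred] [Encodable V.Const] (a : GroundAtom V) : List Sym :=
  Sym.atom :: encodeSymbol a.pred ++
    (List.ofFn a.args).flatMap (fun c => Sym.arg :: encodeSymbol c)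

/-- The word for a finite set of ground atoms, listed in any order. -/
def encodeSet [Encodable V.Pred] [Encodable V.Const] (l : List (GroundAtom V)) : List Sym :=
  Sym.set :: l.flatMap encodeAtom

/-- `w` is an encoding of the sequence `S` of finite sets of ground atoms. -/
def Encodes [Encodable V.Pred] [Encodable V.Const] (w : List Sym)
    (S : List (Set (GroundAtom V))) : Prop :=
  ∃ ls : List (List (GroundAtom V)), S = ls.map (fun l => {a | a ∈ l}) ∧ w = ls.flatMap encodeSet

/-- `T` is the abductive theory `⟨R ∪ B, A, C⟩`, where `B` is a set of abducibles. -/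
def IsTheory (T : AbductiveTheory V) (A : Set V.Pred) (R : Set (Rule V)) (C : Set V.lang.Sentence)
    (B : Set (GroundAtom V)) : Prop :=
  B ⊆ groundAtoms A ∧ T.prog = R ∪ facts B ∧ T.abd = A ∧ T.constraints = C

/-- The problem: given `B`, `O` and `(E, F)`, decide whether `(E, F)` is a constrained explanation
for `O` with respect to `⟨R ∪ B, A, C⟩`. -/
def ConstrainedCheck [Encodable V.Pred] [Encodable V.Const] (τ : AgreementKind)
    (A : Set V.Pred) (R : Set (Rule V)) (C : Set V.lang.Sentence) : Set (List Sym) :=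
  {w | ∃ B O E F : Set (GroundAtom V), Encodes w [B, O, E, F] ∧ IsObservation A O ∧
    ∃ T : AbductiveTheory V, IsTheory T A R C B ∧ IsConstrainedExplanation τ T O E F}

/-- The problem: given `B` and `O`, decide whether there is a constrained explanation for `O` with
respect to `⟨R ∪ B, A, C⟩`. -/
def ConstrainedExistence [Encodable V.Pred] [Encodable V.Const] (τ : AgreementKind)
    (A : Set V.Pred) (R : Set (Rule V)) (C : Set V.lang.Sentence) : Set (List Sym) :=
  {w | ∃ B O : Set (GroundAtom V), Encodes w [B, O] ∧ IsObservation A O ∧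
    ∃ T : AbductiveTheory V, IsTheory T A R C B ∧ ∃ E F, IsConstrainedExplanation τ T O E F}

end Abduction

/-!
Since the rules of `R` are stratified and the abducibles are mere facts, every program that occurs
has exactly one stable model (`exists_stableOn`, `stableOn_unique`). Hence the four kinds of
agreement coincide (`agrees_iff`), and `(E, F)` is constrained iff it is an explanation and no
single replacement function, applied to a fresh constant, gives another one
(`isConstrainedExplanation_iff`). All notions are invariant under renamings of constants that fix
the input, the program and the constraints (`Explains.comap`). In particular, it does not matter
which fresh constant is taken.

*Restriction to finitely many constants.* The stable model is invariant under the renamings that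
fix the constants of the program and of the facts. Therefore, over a finite set `D` that contains
those constants and sufficiently many others, the part of the model over `D` is the stable model of
the grounding over `D` (`StableOn.restrict`), and the constraints may be evaluated with quantifiers
over `D` (`trueOn_restrict`). As `R` is fixed, this part of the model has polynomial size.

*The verification problem.* A certificate for a negative instance lists such a set `D`, a candidate
`E'`, and the stable model for `(B ∪ E') \ F` over `D` in the order of a derivation, where either
`E' = E` and the model violates the constraints or the observation, or `E'` results from `E` by a
replacement function and the model violates neither (`Refutes`). No model is needed if the input is
no encoding (`WellFormed`) or its sets violate a condition that does not involve stable models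
(`InputOk`). The order of the derivation makes
minimality a local condition: each atom is justified by atoms that are listed before it
(`ListsModel`). A candidate obtained by a replacement function is recognized without listing the
occurrences, because replacing `ξ` by `c` maps it bijectively to `E` (`IsReplaced`).

*Polynomial time.* Each condition on certificates is expressed by a fixed first-order formula over
the word that encodes the input and the certificate, with quantifiers over positions and with tests
of the letter at a sum of positions: the constants in a word are represented by positions of their
occurrences, and a constant is compared to another digit by digit (`CDef`). A formula is evaluated
by nested loops over the positions, with counters kept in unary on stacks. `inP_of_FO` gives the
machine, which is written as a structured program and compiled to a multi-stack machine
(`StackProg.Prog`), together with the polynomial bound on its running time.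

*The existence problem.* If `E` contained a constant that is neither in the input nor in the program
or the constraints, then all its occurrences could be replaced by a fresh constant
(`constsOf_subset_usedConsts`). Hence a constrained explanation has polynomial size, and it serves
as the certificate for the existence problem, to be checked by the verification problem in `coNP`.
-/

/-! ### Structured programs for multi-stack machines -/

namespace StackProg

open Turing

/-- Structured programs over stacks `k : K` with alphabets `Γ k` and with registers in `σ`. -/
inductive Prog (K : Type) (Γ : K → Type) (σ : Type) where
  | push (k : K) (f : σ → Γ k) : Prog K Γ σ
  | pop (k : K) (f : σ → Option (Γ k) → σ) : Prog K Γ σ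
  | load (f : σ → σ) : Prog K Γ σ
  | seq (p q : Prog K Γ σ) : Prog K Γ σ
  | ite (b : σ → Bool) (p q : Prog K Γ σ) : Prog K Γ σ
  | loop (b : σ → Bool) (p : Prog K Γ σ) : Prog K Γ σ

variable {K : Type} {Γ : K → Type} {σ : Type}

namespace Prog

/-- Big-step semantics: `p` leads from the first to the second state in exactly `n` steps of the
machine that `p` is compiled to. -/
inductive Exec [DecidableEq K] :
    Prog K Γ σ → σ × (∀ k, List (Γ k)) → σ × (∀ k, List (Γ k)) → ℕ → Prop where
  | push (k f s S) : Exec (.push k f) (s, S) (s, Function.update S k (f s :: S k)) 1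
  | pop (k f s S) :
      Exec (.pop k f) (s, S) (f s (S k).head?, Function.update S k (S k).tail) 1
  | load (f s S) : Exec (.load f) (s, S) (f s, S) 1
  | seq {p q c c' c'' n m} : Exec p c c' n → Exec q c' c'' m → Exec (.seq p q) c c'' (n + m)
  | ite_true {b p q c c' n} : b c.1 = true → Exec p c c' n → Exec (.ite b p q) c c' (n + 1)
  | ite_false {b p q c c' n} : b c.1 = false → Exec q c c' n → Exec (.ite b p q) c c' (n + 1)
  | loop_false {b p c} : b c.1 = false → Exec (.loop b p) c c 1
  | loop_true {b p c c' c'' n m} : b c.1 = true → Exec p c c' n → Exec (.loop b p) c' c'' m →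
      Exec (.loop b p) c c'' (n + m + 1)

/-- The control points of a program. -/
def Lab : Prog K Γ σ → Type
  | push _ _ => Unit
  | pop _ _ => Unit
  | load _ => Unit
  | seq p q => Lab p ⊕ Lab q
  | ite _ p q => Option (Lab p ⊕ Lab q)
  | loop _ p => Option (Lab p)

/-- The control point at which a program starts. -/
def entry : (p : Prog K Γ σ) → Lab p
  | push _ _ => ()
  | pop _ _ => ()
  | load _ => ()
  | seq p _ => Sum.inl (entry p)
  | ite _ _ _ => none
  | loop _ _ => none

theorem finite_lab (p : Prog K Γ σ) : Finite (Lab p) := by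
  induction p with
  | push => exact inferInstanceAs (Finite Unit)
  | pop => exact inferInstanceAs (Finite Unit)
  | load => exact inferInstanceAs (Finite Unit)
  | seq p q hp hq => exact inferInstanceAs (Finite (Lab p ⊕ Lab q))
  | ite b p q hp hq => exact inferInstanceAs (Finite (Option (Lab p ⊕ Lab q)))
  | loop b p hp => exact inferInstanceAs (Finite (Option (Lab p)))

/-- The machine code of a program: its control points are embedded into the labels `Λ` by `emb`,
and control passes to `exit` at the end. -/
def code {Λ : Type} : (p : Prog K Γ σ) → (exit : Λ) → (emb : Lab p → Λ) → Lab p → TM2.Stmt Γ Λ σ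
  | push k f, exit, _ => fun _ => .push k f (.goto fun _ => exit)
  | pop k f, exit, _ => fun _ => .pop k f (.goto fun _ => exit)
  | load f, exit, _ => fun _ => .load f (.goto fun _ => exit)
  | seq p q, exit, emb => fun l =>
      match l with
      | Sum.inl l => code p (emb (Sum.inr (entry q))) (fun l => emb (Sum.inl l)) l
      | Sum.inr l => code q exit (fun l => emb (Sum.inr l)) l
  | ite b p q, exit, emb => fun l =>
      match l with
      | none => .branch b (.goto fun _ => emb (some (Sum.inl (entry p))))
          (.goto fun _ => emb (some (Sum.inr (entry q))))
      | some (Sum.inl l) => code p exit (fun l => emb (some (Sum.inl l))) l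
      | some (Sum.inr l) => code q exit (fun l => emb (some (Sum.inr l))) l
  | loop b p, exit, emb => fun l =>
      match l with
      | none => .branch b (.goto fun _ => emb (some (entry p))) (.goto fun _ => exit)
      | some l => code p (emb none) (fun l => emb (some l)) l

variable [DecidableEq K]

/-- The compiled program simulates the big-step semantics step for step. -/
theorem Exec.steps {p : Prog K Γ σ} {c c' : σ × (∀ k, List (Γ k))} {n : ℕ} (h : Exec p c c' n)
    {Λ : Type} (m : Λ → TM2.Stmt Γ Λ σ) (exit : Λ) (emb : Lab p → Λ)
    (hm : ∀ l, m (emb l) = code p exit emb l) :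
    (flip bind (TM2.step m))^[n] (some ⟨some (emb (entry p)), c.1, c.2⟩) =
      some ⟨some exit, c'.1, c'.2⟩ := by
  have one : ∀ (l : Λ) (s : σ) (S : ∀ k, List (Γ k)),
      flip bind (TM2.step m) (some (⟨some l, s, S⟩ : TM2.Cfg Γ Λ σ)) =
        some (TM2.stepAux (m l) s S) := fun l s S => rfl
  induction h generalizing exit with
  | push k f s S => simp only [Function.iterate_one, one, hm]; rfl
  | pop k f s S => simp only [Function.iterate_one, one, hm]; rfl
  | load f s S => simp only [Function.iterate_one, one, hm]; rfl
  | @seq p q c c' c'' n k _ _ ih1 ih2 =>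
    rw [Nat.add_comm, Function.iterate_add_apply]
    have h1 := ih1 (emb (Sum.inr (entry q))) (fun l => emb (Sum.inl l)) (fun l => hm (Sum.inl l))
    have h2 := ih2 exit (fun l => emb (Sum.inr l)) (fun l => hm (Sum.inr l))
    exact (congrArg _ h1).trans h2
  | @ite_true b p q c c' n hb _ ih =>
    have h1 := ih exit (fun l => emb (some (Sum.inl l))) (fun l => hm (some (Sum.inl l)))
    rw [Function.iterate_succ_apply, one, hm]
    simp only [entry, code, TM2.stepAux, hb, cond_true]
    exact h1
  | @ite_false b p q c c' n hb _ ih =>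
    have h1 := ih exit (fun l => emb (some (Sum.inr l))) (fun l => hm (some (Sum.inr l)))
    rw [Function.iterate_succ_apply, one, hm]
    simp only [entry, code, TM2.stepAux, hb, cond_false]
    exact h1
  | @loop_false b p c hb =>
    rw [Function.iterate_one, one, hm]
    simp only [entry, code, TM2.stepAux, hb, cond_false]
  | @loop_true b p c c' c'' n k hb _ _ ih1 ih2 =>
    have h1 := ih1 (emb none) (fun l => emb (some l)) (fun l => hm (some l))
    have h2 := ih2 exit emb hm
    rw [Function.iterate_succ_apply, one, hm, Nat.add_comm n k, Function.iterate_add_apply]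
    simp only [entry, code, TM2.stepAux, hb, cond_true]
    exact (congrArg _ h1).trans h2

end Prog

end StackProg

/-! ### First-order formulas over words, and machines that evaluate them -/

namespace WordLogic

open Turing StackProg

/-- The environment `v` with a new variable `0` of value `i`; the others are shifted. -/
def push (i : ℕ) (v : ℕ → ℕ) : ℕ → ℕ
  | 0 => i
  | k + 1 => v k

/-- First-order formulas (de Bruijn style) over words with letters in `Γ`. Variables range over
the positions `0, …, n` of a word of length `n`. In `letter p c l`, the test `p` is applied to the
letter (`none` beyond the end) at the position which is the sum of `c` and, for every `(i, b)` in
`l`, the value of the variable `i`, or its difference from `n` if `b` is `false`. -/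
inductive Fml (Γ : Type) where
  | letter (p : Option Γ → Bool) (c : ℕ) (l : List (ℕ × Bool)) : Fml Γ
  | not (φ : Fml Γ) : Fml Γ
  | and (φ ψ : Fml Γ) : Fml Γ
  | ex (φ : Fml Γ) : Fml Γ

variable {Γ : Type}

/-- The value of a variable or of its complement in a word of length `n`. -/
def val (n : ℕ) (v : ℕ → ℕ) (x : ℕ × Bool) : ℕ := if x.2 then v x.1 else n - v x.1

namespace Fml

/-- The truth value of a formula. -/
def Eval (w : List Γ) : Fml Γ → (ℕ → ℕ) → Prop
  | letter p c l, v => p w[c + (l.map (val w.length v)).sum]? = true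
  | not φ, v => ¬ Eval w φ v
  | and φ ψ, v => Eval w φ v ∧ Eval w ψ v
  | ex φ, v => ∃ i ≤ w.length, Eval w φ (push i v)

/-- All free variables of the formula are smaller than `d`. -/
def Scoped : Fml Γ → ℕ → Prop
  | letter _ _ l, d => ∀ x ∈ l, x.1 < d
  | not φ, d => Scoped φ d
  | and φ ψ, d => Scoped φ d ∧ Scoped ψ d
  | ex φ, d => Scoped φ (d + 1)

/-- The quantifier depth. -/
def depth : Fml Γ → ℕ
  | letter _ _ _ => 0
  | not φ => depth φ
  | and φ ψ => max (depth φ) (depth ψ)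
  | ex φ => depth φ + 1

theorem Scoped.mono {φ : Fml Γ} {d e : ℕ} (h : φ.Scoped d) (hde : d ≤ e) : φ.Scoped e := by
  induction φ generalizing d e with
  | letter p c l => exact fun x hx => (h x hx).trans_le hde
  | not φ ih => exact ih h hde
  | and φ ψ ih1 ih2 => exact ⟨ih1 h.1 hde, ih2 h.2 hde⟩
  | ex φ ih => exact ih (d := d + 1) (e := e + 1) h (Nat.succ_le_succ hde)

theorem exists_scoped (φ : Fml Γ) : ∃ d, φ.Scoped d := by
  induction φ with
  | letter p c l =>
    refine ⟨(l.map (fun x => x.1 + 1)).sum, fun x hx => ?_⟩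
    exact List.single_le_sum (by simp) _ (List.mem_map_of_mem (f := fun x => x.1 + 1) hx)
  | not φ ih => exact ih
  | and φ ψ ih1 ih2 =>
    obtain ⟨d, hd⟩ := ih1
    obtain ⟨e, he⟩ := ih2
    exact ⟨max d e, hd.mono (le_max_left _ _), he.mono (le_max_right _ _)⟩
  | ex φ ih =>
    obtain ⟨d, hd⟩ := ih
    exact ⟨d, hd.mono (Nat.le_succ d)⟩

/-- Renaming of variables. -/
def rename : (ℕ → ℕ) → Fml Γ → Fml Γ
  | f, letter p c l => letter p c (l.map fun x => (f x.1, x.2))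
  | f, not φ => not (rename f φ)
  | f, and φ ψ => and (rename f φ) (rename f ψ)
  | f, ex φ => ex (rename (push 0 fun k => f k + 1) φ)

theorem eval_rename (w : List Γ) (φ : Fml Γ) (f v : ℕ → ℕ) :
    (rename f φ).Eval w v ↔ φ.Eval w (fun k => v (f k)) := by
  induction φ generalizing f v with
  | letter p c l => simp only [rename, Eval, List.map_map]; rfl
  | not φ ih => simp only [rename, Eval, ih]
  | and φ ψ ih1 ih2 => simp only [rename, Eval, ih1, ih2]
  | ex φ ih =>
    simp only [rename, Eval, ih]
    refine exists_congr fun i => and_congr_right fun _ => ?_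
    have : (fun k => push i v (push 0 (fun k => f k + 1) k)) = push i fun k => v (f k) := by
      funext k; cases k <;> rfl
    rw [this]

/-- Translation along a map of letters. -/
def comap {Δ : Type} (g : Γ → Δ) : Fml Δ → Fml Γ
  | letter p c l => letter (fun o => p (o.map g)) c l
  | not φ => not (comap g φ)
  | and φ ψ => and (comap g φ) (comap g ψ)
  | ex φ => ex (comap g φ)

theorem eval_comap {Δ : Type} (g : Γ → Δ) (w : List Γ) (φ : Fml Δ) (v : ℕ → ℕ) :
    (comap g φ).Eval w v ↔ φ.Eval (w.map g) v := by
  induction φ generalizing v with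
  | letter p c l => simp [comap, Eval]
  | not φ ih => simp only [comap, Eval, ih]
  | and φ ψ ih1 ih2 => simp only [comap, Eval, ih1, ih2]
  | ex φ ih => simp only [comap, Eval, ih, List.length_map]

end Fml

/-! ### The evaluating machine -/

/-- The stacks of the evaluating machine: the input, a copy of a part of it, the output, and, in
unary, counters for the values of variables and their complements, and a copy of a counter. -/
inductive Stk (N : ℕ) where
  | inp : Stk N
  | tmp : Stk N
  | out : Stk N
  | cnt (i : Fin N) (b : Bool) : Stk N
  | scr : Stk N
  deriving DecidableEq, Fintype

/-- The stack alphabets. -/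
abbrev Alph (Γ : Type) (N : ℕ) : Stk N → Type
  | .inp => Γ
  | .tmp => Γ
  | .out => Bool
  | .cnt _ _ => Unit
  | .scr => Unit

/-- The registers: the truth value computed last, whether the last counter popped was nonzero, and
the letter popped last. -/
abbrev Reg (Γ : Type) : Type := Bool × Bool × Option Γ

/-- The contents of the stacks, with the counters as numbers. -/
structure Mem (Γ : Type) (N : ℕ) where
  inp : List Γ
  tmp : List Γ
  cnt : Fin N → Bool → ℕ
  scr : ℕ

variable {N : ℕ}

/-- The stacks that represent a memory state; the output stack is empty. -/
def Mem.stk (m : Mem Γ N) : ∀ k, List (Alph Γ N k)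
  | .inp => m.inp
  | .tmp => m.tmp
  | .out => []
  | .cnt i b => List.replicate (m.cnt i b) ()
  | .scr => List.replicate m.scr ()

/-- The memory with the counter `(i, b)` set to `x`. -/
def Mem.set (m : Mem Γ N) (i : Fin N) (b : Bool) (x : ℕ) : Mem Γ N :=
  { m with cnt := Function.update m.cnt i (Function.update (m.cnt i) b x) }

/-- Execution of a program on memory states in at most `t` steps. -/
def Run (p : Prog (Stk N) (Alph Γ N) (Reg Γ)) (s : Reg Γ) (m : Mem Γ N) (s' : Reg Γ)
    (m' : Mem Γ N) (t : ℕ) : Prop :=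
  ∃ n ≤ t, p.Exec (s, m.stk) (s', m'.stk) n

/-- Pop a letter. -/
def popInp : Prog (Stk N) (Alph Γ N) (Reg Γ) := .pop .inp fun s o => (s.1, s.2.1, o)
/-- Push the letter popped last. -/
def pushInp [Inhabited Γ] : Prog (Stk N) (Alph Γ N) (Reg Γ) := .push .inp fun s => s.2.2.getD default
/-- Pop a letter from the copy. -/
def popTmp : Prog (Stk N) (Alph Γ N) (Reg Γ) := .pop .tmp fun s o => (s.1, s.2.1, o)
/-- Push the letter popped last to the copy. -/
def pushTmp [Inhabited Γ] : Prog (Stk N) (Alph Γ N) (Reg Γ) := .push .tmp fun s => s.2.2.getD default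
/-- Decrease a counter. -/
def popCnt (i : Fin N) (b : Bool) : Prog (Stk N) (Alph Γ N) (Reg Γ) :=
  .pop (.cnt i b) fun s o => (s.1, o.isSome, s.2.2)
/-- Increase a counter. -/
def pushCnt (i : Fin N) (b : Bool) : Prog (Stk N) (Alph Γ N) (Reg Γ) := .push (.cnt i b) fun _ => ()
/-- Decrease the copied counter. -/
def popScr : Prog (Stk N) (Alph Γ N) (Reg Γ) := .pop .scr fun s o => (s.1, o.isSome, s.2.2)
/-- Increase the copied counter. -/
def pushScr : Prog (Stk N) (Alph Γ N) (Reg Γ) := .push .scr fun _ => ()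

theorem run_popInp (s : Reg Γ) (m : Mem Γ N) :
    Run popInp s m (s.1, s.2.1, m.inp.head?) { m with inp := m.inp.tail } 1 := by
  have h := Prog.Exec.pop (Stk.inp : Stk N) (fun (s : Reg Γ) o => (s.1, s.2.1, o)) s m.stk
  have e : Function.update m.stk Stk.inp (m.stk Stk.inp).tail =
      Mem.stk { m with inp := m.inp.tail } := by
    funext k; cases k <;> simp [Mem.stk, Function.update]
  rw [e] at h; exact ⟨1, le_rfl, h⟩

theorem run_popTmp (s : Reg Γ) (m : Mem Γ N) :
    Run popTmp s m (s.1, s.2.1, m.tmp.head?) { m with tmp := m.tmp.tail } 1 := by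
  have h := Prog.Exec.pop (Stk.tmp : Stk N) (fun (s : Reg Γ) o => (s.1, s.2.1, o)) s m.stk
  have e : Function.update m.stk Stk.tmp (m.stk Stk.tmp).tail =
      Mem.stk { m with tmp := m.tmp.tail } := by
    funext k; cases k <;> simp [Mem.stk, Function.update]
  rw [e] at h; exact ⟨1, le_rfl, h⟩

theorem run_pushInp [Inhabited Γ] (b c : Bool) (a : Γ) (m : Mem Γ N) :
    Run pushInp (b, c, some a) m (b, c, some a) { m with inp := a :: m.inp } 1 := by
  have h := Prog.Exec.push (Γ := Alph Γ N) (Stk.inp : Stk N) (fun s : Reg Γ => s.2.2.getD default)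
    (b, c, some a) m.stk
  have e : Function.update m.stk Stk.inp (a :: m.stk Stk.inp) =
      Mem.stk { m with inp := a :: m.inp } := by
    funext k; cases k <;> simp [Mem.stk, Function.update]
  refine ⟨1, le_rfl, ?_⟩
  rw [← e]; exact h

theorem run_pushTmp [Inhabited Γ] (b c : Bool) (a : Γ) (m : Mem Γ N) :
    Run pushTmp (b, c, some a) m (b, c, some a) { m with tmp := a :: m.tmp } 1 := by
  have h := Prog.Exec.push (Γ := Alph Γ N) (Stk.tmp : Stk N) (fun s : Reg Γ => s.2.2.getD default)
    (b, c, some a) m.stk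
  have e : Function.update m.stk Stk.tmp (a :: m.stk Stk.tmp) =
      Mem.stk { m with tmp := a :: m.tmp } := by
    funext k; cases k <;> simp [Mem.stk, Function.update]
  refine ⟨1, le_rfl, ?_⟩
  rw [← e]; exact h

theorem stk_set (m : Mem Γ N) (i : Fin N) (b : Bool) (x : ℕ) :
    Function.update m.stk (Stk.cnt i b) (List.replicate x ()) = (m.set i b x).stk := by
  funext k
  cases k with
  | cnt j c =>
    by_cases h : j = i
    · subst h
      by_cases h' : c = b
      · subst h'; simp [Mem.stk, Mem.set]
      · simp [Mem.stk, Mem.set, h']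
    · simp [Mem.stk, Mem.set, h]
  | _ => simp [Mem.stk, Mem.set, Function.update]

theorem run_popCnt (i : Fin N) (b : Bool) (s : Reg Γ) (m : Mem Γ N) :
    Run (popCnt i b) s m (s.1, decide (0 < m.cnt i b), s.2.2) (m.set i b (m.cnt i b - 1)) 1 := by
  have h := Prog.Exec.pop (Stk.cnt i b) (fun (s : Reg Γ) o => (s.1, o.isSome, s.2.2)) s m.stk
  have e : (m.stk (Stk.cnt i b)).tail = List.replicate (m.cnt i b - 1) () := by simp [Mem.stk]
  have e' : (m.stk (Stk.cnt i b)).head?.isSome = decide (0 < m.cnt i b) := by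
    simp [Mem.stk, List.head?_replicate]; cases m.cnt i b <;> simp
  rw [e, stk_set, e'] at h; exact ⟨1, le_rfl, h⟩

theorem run_pushCnt (i : Fin N) (b : Bool) (s : Reg Γ) (m : Mem Γ N) :
    Run (pushCnt i b) s m s (m.set i b (m.cnt i b + 1)) 1 := by
  have h := Prog.Exec.push (Γ := Alph Γ N) (Stk.cnt i b) (fun _ : Reg Γ => ()) s m.stk
  have e : () :: m.stk (Stk.cnt i b) = List.replicate (m.cnt i b + 1) () := by
    simp [Mem.stk, List.replicate_succ]
  rw [e, stk_set] at h; exact ⟨1, le_rfl, h⟩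

theorem run_popScr (s : Reg Γ) (m : Mem Γ N) :
    Run popScr s m (s.1, decide (0 < m.scr), s.2.2) { m with scr := m.scr - 1 } 1 := by
  have h := Prog.Exec.pop (Stk.scr : Stk N) (fun (s : Reg Γ) o => (s.1, o.isSome, s.2.2)) s m.stk
  have e : Function.update m.stk Stk.scr (m.stk Stk.scr).tail =
      Mem.stk { m with scr := m.scr - 1 } := by
    funext k; cases k <;> simp [Mem.stk, Function.update]
  have e' : (m.stk Stk.scr).head?.isSome = decide (0 < m.scr) := by
    simp [Mem.stk, List.head?_replicate]; cases m.scr <;> simp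
  rw [e, e'] at h; exact ⟨1, le_rfl, h⟩

theorem run_pushScr (s : Reg Γ) (m : Mem Γ N) :
    Run pushScr s m s { m with scr := m.scr + 1 } 1 := by
  have h := Prog.Exec.push (Γ := Alph Γ N) (Stk.scr : Stk N) (fun _ : Reg Γ => ()) s m.stk
  have e : Function.update m.stk Stk.scr (() :: m.stk Stk.scr) =
      Mem.stk { m with scr := m.scr + 1 } := by
    funext k; cases k <;> simp [Mem.stk, Function.update, List.replicate_succ]
  rw [e] at h; exact ⟨1, le_rfl, h⟩

end WordLogic

namespace WordLogic

open Turing StackProg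

variable {Γ : Type} {N : ℕ}

theorem Run.mono {p : Prog (Stk N) (Alph Γ N) (Reg Γ)} {s s' : Reg Γ} {m m' : Mem Γ N} {t t' : ℕ}
    (h : Run p s m s' m' t) (ht : t ≤ t') : Run p s m s' m' t' := by
  obtain ⟨n, hn, h⟩ := h
  exact ⟨n, hn.trans ht, h⟩

theorem Run.seq {p q : Prog (Stk N) (Alph Γ N) (Reg Γ)} {s s' s'' : Reg Γ} {m m' m'' : Mem Γ N}
    {t t' : ℕ} (h : Run p s m s' m' t) (h' : Run q s' m' s'' m'' t') :
    Run (.seq p q) s m s'' m'' (t + t') := by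
  obtain ⟨n, hn, h⟩ := h
  obtain ⟨n', hn', h'⟩ := h'
  exact ⟨n + n', by omega, h.seq h'⟩

theorem Run.load (f : Reg Γ → Reg Γ) (s : Reg Γ) (m : Mem Γ N) : Run (.load f) s m (f s) m 1 :=
  ⟨1, le_rfl, Prog.Exec.load f s m.stk⟩

theorem Run.ite_true {b : Reg Γ → Bool} {p q : Prog (Stk N) (Alph Γ N) (Reg Γ)} {s s' : Reg Γ}
    {m m' : Mem Γ N} {t : ℕ} (hb : b s = true) (h : Run p s m s' m' t) :
    Run (.ite b p q) s m s' m' (t + 1) := by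
  obtain ⟨n, hn, h⟩ := h
  exact ⟨n + 1, by omega, h.ite_true hb⟩

theorem Run.ite_false {b : Reg Γ → Bool} {p q : Prog (Stk N) (Alph Γ N) (Reg Γ)} {s s' : Reg Γ}
    {m m' : Mem Γ N} {t : ℕ} (hb : b s = false) (h : Run q s m s' m' t) :
    Run (.ite b p q) s m s' m' (t + 1) := by
  obtain ⟨n, hn, h⟩ := h
  exact ⟨n + 1, by omega, h.ite_false hb⟩

theorem Run.loop_false {b : Reg Γ → Bool} {p : Prog (Stk N) (Alph Γ N) (Reg Γ)} {s : Reg Γ}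
    {m : Mem Γ N} (hb : b s = false) : Run (.loop b p) s m s m 1 :=
  ⟨1, le_rfl, Prog.Exec.loop_false hb⟩

theorem Run.loop_true {b : Reg Γ → Bool} {p : Prog (Stk N) (Alph Γ N) (Reg Γ)} {s s' s'' : Reg Γ}
    {m m' m'' : Mem Γ N} {t t' : ℕ} (hb : b s = true) (h : Run p s m s' m' t)
    (h' : Run (.loop b p) s' m' s'' m'' t') : Run (.loop b p) s m s'' m'' (t + t' + 1) := by
  obtain ⟨n, hn, h⟩ := h
  obtain ⟨n', hn', h'⟩ := h'
  exact ⟨n + n' + 1, by omega, h.loop_true hb h'⟩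

@[simp] theorem Mem.set_inp (m : Mem Γ N) (i : Fin N) (b : Bool) (x : ℕ) :
    (m.set i b x).inp = m.inp := rfl
@[simp] theorem Mem.set_tmp (m : Mem Γ N) (i : Fin N) (b : Bool) (x : ℕ) :
    (m.set i b x).tmp = m.tmp := rfl
@[simp] theorem Mem.set_scr (m : Mem Γ N) (i : Fin N) (b : Bool) (x : ℕ) :
    (m.set i b x).scr = m.scr := rfl
@[simp] theorem Mem.set_cnt_self (m : Mem Γ N) (i : Fin N) (b : Bool) (x : ℕ) :
    (m.set i b x).cnt i b = x := by simp [Mem.set]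
theorem Mem.set_cnt_other (m : Mem Γ N) (i : Fin N) {b c : Bool} (h : c ≠ b) (x : ℕ) :
    (m.set i b x).cnt i c = m.cnt i c := by simp [Mem.set, h]
theorem Mem.set_cnt_ne (m : Mem Γ N) {i j : Fin N} (h : j ≠ i) (b c : Bool) (x : ℕ) :
    (m.set i b x).cnt j c = m.cnt j c := by simp [Mem.set, h]
@[simp] theorem Mem.set_set (m : Mem Γ N) (i : Fin N) (b : Bool) (x y : ℕ) :
    (m.set i b x).set i b y = m.set i b y := by simp [Mem.set]
@[simp] theorem Mem.set_self (m : Mem Γ N) (i : Fin N) (b : Bool) :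
    m.set i b (m.cnt i b) = m := by simp [Mem.set]
theorem Mem.set_comm (m : Mem Γ N) (i : Fin N) {b c : Bool} (h : b ≠ c) (x y : ℕ) :
    (m.set i b x).set i c y = (m.set i c y).set i b x := by
  simp only [Mem.set, Function.update_self, Function.update_idem, Mem.mk.injEq, true_and, and_true]
  rw [Function.update_comm h]

/-- Whether the letter popped last exists. -/
def hasCur (s : Reg Γ) : Bool := s.2.2.isSome
/-- Whether the counter popped last was nonzero. -/
def hasGot (s : Reg Γ) : Bool := s.2.1

/-- Move the copied part of the input back. -/
def moveBack [Inhabited Γ] : Prog (Stk N) (Alph Γ N) (Reg Γ) :=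
  .seq popTmp (.loop hasCur (.seq pushInp popTmp))

theorem run_moveBack [Inhabited Γ] (s : Reg Γ) (m : Mem Γ N) :
    Run moveBack s m (s.1, s.2.1, none) { m with inp := m.tmp.reverse ++ m.inp, tmp := [] }
      (3 * m.tmp.length + 2) := by
  have key : ∀ (l r : List Γ), Run (.loop hasCur (.seq pushInp popTmp))
      (s.1, s.2.1, l.head?) { m with inp := r, tmp := l.tail } (s.1, s.2.1, none)
      { m with inp := l.reverse ++ r, tmp := [] } (3 * l.length + 1) := by
    intro l
    induction l with
    | nil => intro r; exact Run.loop_false rfl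
    | cons a l ih =>
      intro r
      have h1 := run_pushInp s.1 s.2.1 a ({ m with inp := r, tmp := l } : Mem Γ N)
      have h2 := run_popTmp (s.1, s.2.1, some a) ({ m with inp := a :: r, tmp := l } : Mem Γ N)
      have h3 := (h1.seq h2).loop_true (b := hasCur) rfl (ih (a :: r))
      refine (Run.mono ?_ (t := 1 + 1 + (3 * l.length + 1) + 1) (by simp; omega))
      simpa using h3
  have := (run_popTmp s m).seq (key m.tmp m.inp)
  exact this.mono (by omega)

/-- The memory `m` with the reading position of the input `w` at `k`. -/
def Mem.at (m : Mem Γ N) (w : List Γ) (k : ℕ) : Mem Γ N :=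
  { m with inp := w.drop k, tmp := (w.take k).reverse }

/-- Read a letter, and move the reading position to the right. -/
def advance [Inhabited Γ] : Prog (Stk N) (Alph Γ N) (Reg Γ) :=
  .seq popInp (.ite hasCur pushTmp (.load id))

theorem run_advance [Inhabited Γ] (s : Reg Γ) (m : Mem Γ N) (w : List Γ) (k : ℕ) :
    Run advance s (m.at w k) (s.1, s.2.1, w[k]?) (m.at w (k + 1)) 3 := by
  have h1 := run_popInp s (m.at w k)
  refine Run.mono (h1.seq (t' := 2) ?_) le_rfl
  rcases lt_or_ge k w.length with hk | hk
  · have e1 : (m.at w k).inp.head? = some w[k] := by simp [Mem.at, hk]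
    have h2 := run_pushTmp s.1 s.2.1 w[k] ({ m.at w k with inp := (m.at w k).inp.tail } : Mem Γ N)
    have e2 : ({ m.at w k with inp := (m.at w k).inp.tail, tmp := w[k] :: (m.at w k).tmp } :
        Mem Γ N) = m.at w (k + 1) := by
      simp only [Mem.at, List.tail_drop, Mem.mk.injEq, true_and, and_true]
      rw [List.take_add_one, List.getElem?_eq_getElem hk, List.reverse_append]
      rfl
    rw [List.getElem?_eq_getElem hk, e1]
    refine Run.ite_true rfl ?_
    rw [← e2]
    exact h2
  · have e1 : (m.at w k).inp.head? = none := by simp [Mem.at, hk]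
    have e2 : ({ m.at w k with inp := (m.at w k).inp.tail } : Mem Γ N) = m.at w (k + 1) := by
      simp only [Mem.at, List.tail_drop, Mem.mk.injEq, true_and, and_true]
      rw [List.take_of_length_le hk, List.take_of_length_le (by omega)]
    rw [List.getElem?_eq_none hk, e1]
    refine Run.ite_false rfl ?_
    rw [← e2]
    exact Run.load id _ _

/-- Copy a counter, moving the reading position to the right for every unit. -/
def walkDown [Inhabited Γ] (i : Fin N) (b : Bool) : Prog (Stk N) (Alph Γ N) (Reg Γ) :=
  .seq (popCnt i b) (.loop hasGot (.seq pushScr (.seq advance (popCnt i b))))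

/-- Restore a counter from the copy. -/
def restoreCnt (i : Fin N) (b : Bool) : Prog (Stk N) (Alph Γ N) (Reg Γ) :=
  .seq popScr (.loop hasGot (.seq (pushCnt i b) popScr))

/-- Move the reading position to the right by the value of a counter. -/
def walk [Inhabited Γ] (i : Fin N) (b : Bool) : Prog (Stk N) (Alph Γ N) (Reg Γ) :=
  .seq (walkDown i b) (restoreCnt i b)

theorem run_walkDown [Inhabited Γ] (s : Reg Γ) (m : Mem Γ N) (w : List Γ) (k : ℕ) (i : Fin N)
    (b : Bool) : ∃ s', Run (walkDown i b) s (m.at w k) s'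
      ({ (m.set i b 0).at w (k + m.cnt i b) with scr := m.scr + m.cnt i b } : Mem Γ N)
      (6 * m.cnt i b + 2) := by
  have key : ∀ (x k r : ℕ) (c : Option Γ), ∃ s',
      Run (.loop hasGot (.seq pushScr (.seq advance (popCnt i b))))
      (s.1, decide (0 < x), c) ({ (m.set i b (x - 1)).at w k with scr := r } : Mem Γ N) s'
      ({ (m.set i b 0).at w (k + x) with scr := r + x } : Mem Γ N) (6 * x + 1) := by
    intro x
    induction x with
    | zero => intro k r c; exact ⟨_, Run.loop_false rfl⟩
    | succ x ih =>
      intro k r c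
      have h1 := run_pushScr (s.1, decide (0 < x + 1), c)
        ({ (m.set i b (x + 1 - 1)).at w k with scr := r } : Mem Γ N)
      have h2 := run_advance (s.1, decide (0 < x + 1), c)
        ({ m.set i b x with scr := r + 1 } : Mem Γ N) w k
      have h3 := run_popCnt i b (s.1, decide (0 < x + 1), w[k]?)
        (({ m.set i b x with scr := r + 1 } : Mem Γ N).at w (k + 1))
      have e : ((({ m.set i b x with scr := r + 1 } : Mem Γ N).at w (k + 1))).cnt i b = x :=
        Mem.set_cnt_self m i b x
      have e' : (((({ m.set i b x with scr := r + 1 } : Mem Γ N).at w (k + 1)))).set i b (x - 1) =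
          ({ (m.set i b (x - 1)).at w (k + 1) with scr := r + 1 } : Mem Γ N) := by
        simp [Mem.set, Mem.at]
      rw [e, e'] at h3
      obtain ⟨s', h4⟩ := ih (k + 1) (r + 1) w[k]?
      refine ⟨s', Run.mono (Run.loop_true (by simp [hasGot]) (h1.seq (h2.seq h3))
        (t' := 6 * x + 1) ?_) (by omega)⟩
      rw [show k + (x + 1) = k + 1 + x by omega, show r + (x + 1) = r + 1 + x by omega]
      exact h4
  have h1 := run_popCnt i b s (m.at w k)
  obtain ⟨s', h2⟩ := key (m.cnt i b) k m.scr s.2.2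
  exact ⟨s', Run.mono (h1.seq h2) (by omega)⟩

theorem run_restoreCnt (s : Reg Γ) (m : Mem Γ N) (i : Fin N) (b : Bool) :
    ∃ s', Run (restoreCnt i b) s m s'
      ({ m.set i b (m.cnt i b + m.scr) with scr := 0 } : Mem Γ N) (3 * m.scr + 2) := by
  have key : ∀ (x y : ℕ) (c : Option Γ), ∃ s',
      Run (.loop hasGot (.seq (pushCnt i b) popScr))
      (s.1, decide (0 < x), c) ({ m.set i b y with scr := x - 1 } : Mem Γ N) s'
      ({ m.set i b (y + x) with scr := 0 } : Mem Γ N) (3 * x + 1) := by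
    intro x
    induction x with
    | zero => intro y c; exact ⟨_, Run.loop_false rfl⟩
    | succ x ih =>
      intro y c
      have h1 := run_pushCnt i b (s.1, decide (0 < x + 1), c)
        ({ m.set i b y with scr := x } : Mem Γ N)
      have h2 := run_popScr (s.1, decide (0 < x + 1), c)
        ({ m.set i b (y + 1) with scr := x } : Mem Γ N)
      have e : (({ m.set i b y with scr := x } : Mem Γ N)).cnt i b = y := Mem.set_cnt_self m i b y
      have e' : (({ m.set i b y with scr := x } : Mem Γ N)).set i b (y + 1) =
          ({ m.set i b (y + 1) with scr := x } : Mem Γ N) := by simp [Mem.set]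
      rw [e, e'] at h1
      obtain ⟨s', h4⟩ := ih (y + 1) c
      refine ⟨s', Run.mono (Run.loop_true (by simp [hasGot]) (h1.seq h2)
        (t' := 3 * x + 1) ?_) (by omega)⟩
      rw [show y + (x + 1) = y + 1 + x by omega]
      exact h4
  have h1 := run_popScr s m
  obtain ⟨s', h2⟩ := key m.scr (m.cnt i b) s.2.2
  rw [Mem.set_self] at h2
  exact ⟨s', Run.mono (h1.seq h2) (by omega)⟩

theorem run_walk [Inhabited Γ] (s : Reg Γ) (m : Mem Γ N) (hm : m.scr = 0) (w : List Γ) (k : ℕ)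
    (i : Fin N) (b : Bool) : ∃ s', Run (walk i b) s (m.at w k) s'
      (m.at w (k + m.cnt i b)) (9 * m.cnt i b + 4) := by
  obtain ⟨s1, h1⟩ := run_walkDown s m w k i b
  obtain ⟨s2, h2⟩ := run_restoreCnt s1
    ({ (m.set i b 0).at w (k + m.cnt i b) with scr := m.scr + m.cnt i b } : Mem Γ N) i b
  refine ⟨s2, Run.mono (t := 6 * m.cnt i b + 2 + (3 * (m.scr + m.cnt i b) + 2)) ?_ (by omega)⟩
  have e : ({ Mem.set ({ (m.set i b 0).at w (k + m.cnt i b) with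
      scr := m.scr + m.cnt i b } : Mem Γ N) i b
      ((({ (m.set i b 0).at w (k + m.cnt i b) with
      scr := m.scr + m.cnt i b } : Mem Γ N)).cnt i b + (m.scr + m.cnt i b)) with scr := 0 }
      : Mem Γ N) = m.at w (k + m.cnt i b) := by
    simp [Mem.set, Mem.at, hm]
  rw [← e]
  exact h1.seq h2

/-- Move the reading position to the right by a constant. -/
def advances [Inhabited Γ] : ℕ → Prog (Stk N) (Alph Γ N) (Reg Γ)
  | 0 => .load id
  | c + 1 => .seq advance (advances c)

theorem run_advances [Inhabited Γ] (c : ℕ) (s : Reg Γ) (m : Mem Γ N) (w : List Γ) (k : ℕ) :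
    ∃ s', Run (advances c) s (m.at w k) s' (m.at w (k + c)) (3 * c + 1) := by
  induction c generalizing s k with
  | zero => exact ⟨_, Run.load _ _ _⟩
  | succ c ih =>
    obtain ⟨s', h⟩ := ih (s.1, s.2.1, w[k]?) (k + 1)
    refine ⟨s', Run.mono ((run_advance s m w k).seq (t' := 3 * c + 1) ?_) (by omega)⟩
    rw [show k + (c + 1) = k + 1 + c by omega]
    exact h

/-- Move the reading position to the right by the values of several counters. -/
def walks [Inhabited Γ] : List (Fin N × Bool) → Prog (Stk N) (Alph Γ N) (Reg Γ)
  | [] => .load id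
  | x :: l => .seq (walk x.1 x.2) (walks l)

theorem run_walks [Inhabited Γ] (l : List (Fin N × Bool)) (s : Reg Γ) (m : Mem Γ N)
    (hm : m.scr = 0) (w : List Γ) (k : ℕ) :
    ∃ s', Run (walks l) s (m.at w k) s' (m.at w (k + (l.map fun x => m.cnt x.1 x.2).sum))
      (9 * (l.map fun x => m.cnt x.1 x.2).sum + 4 * l.length + 1) := by
  induction l generalizing s k with
  | nil => exact ⟨_, Run.load _ _ _⟩
  | cons x l ih =>
    obtain ⟨s1, h1⟩ := run_walk s m hm w k x.1 x.2
    obtain ⟨s2, h2⟩ := ih s1 (k + m.cnt x.1 x.2)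
    refine ⟨s2, Run.mono (h1.seq (t' := 9 * (l.map fun x => m.cnt x.1 x.2).sum +
      4 * l.length + 1) ?_) (by simp; omega)⟩
    simp only [List.map_cons, List.sum_cons, ← Nat.add_assoc]
    exact h2

/-- Test the letter at a sum of counter values. -/
def readLetter [Inhabited Γ] (p : Option Γ → Bool) (c : ℕ) (l : List (Fin N × Bool)) :
    Prog (Stk N) (Alph Γ N) (Reg Γ) :=
  .seq (advances c) (.seq (walks l) (.seq advance (.seq (.load fun s => (p s.2.2, s.2)) moveBack)))

theorem run_readLetter [Inhabited Γ] (p : Option Γ → Bool) (c : ℕ) (l : List (Fin N × Bool))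
    (s : Reg Γ) (m : Mem Γ N) (h0 : m.scr = 0) (ht : m.tmp = []) :
    ∃ s', Run (readLetter p c l) s m s' m (3 * m.inp.length +
        (9 * (l.map fun x => m.cnt x.1 x.2).sum + 4 * l.length + 3 * c + 8)) ∧
      s'.1 = p m.inp[c + (l.map fun x => m.cnt x.1 x.2).sum]? := by
  set n := (l.map fun x => m.cnt x.1 x.2).sum with hn
  have e : ({ m with tmp := [] } : Mem Γ N) = m := by rw [← ht]
  have e0 : m.at m.inp 0 = m := by simpa [Mem.at] using e
  obtain ⟨s1, h1⟩ := run_advances c s m m.inp 0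
  obtain ⟨s2, h2⟩ := run_walks l s1 m h0 m.inp (0 + c)
  have h3 := run_advance s2 m m.inp (0 + c + n)
  have h4 := Run.load (fun s : Reg Γ => (p s.2.2, s.2)) (s2.1, s2.2.1, m.inp[0 + c + n]?)
    (m.at m.inp (0 + c + n + 1))
  have h5 := run_moveBack (p m.inp[0 + c + n]?, s2.2.1, m.inp[0 + c + n]?)
    (m.at m.inp (0 + c + n + 1))
  have e5 : ({ m.at m.inp (0 + c + n + 1) with
      inp := (m.at m.inp (0 + c + n + 1)).tmp.reverse ++ (m.at m.inp (0 + c + n + 1)).inp,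
      tmp := [] } : Mem Γ N) = m := by
    simpa [Mem.at] using e
  have e6 : (m.at m.inp (0 + c + n + 1)).tmp.length ≤ m.inp.length := by
    simp [Mem.at]
  rw [e5] at h5
  rw [e0] at h1
  refine ⟨_, (h1.seq (h2.seq (h3.seq (h4.seq h5)))).mono ?_, by simp⟩
  rw [← hn]
  omega

end WordLogic

namespace WordLogic

open Turing StackProg

variable {Γ : Type} {N : ℕ}

/-- Set the counter `(i, false)` to the length of the input, moving the input to the copy. -/
def countInp [Inhabited Γ] (i : Fin N) : Prog (Stk N) (Alph Γ N) (Reg Γ) :=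
  .seq popInp (.loop hasCur (.seq pushTmp (.seq (pushCnt i false) popInp)))

theorem run_countInp [Inhabited Γ] (i : Fin N) (s : Reg Γ) (m : Mem Γ N) (ht : m.tmp = [])
    (hi : m.cnt i false = 0) :
    Run (countInp i) s m (s.1, s.2.1, none)
      ({ m.set i false m.inp.length with inp := [], tmp := m.inp.reverse } : Mem Γ N)
      (4 * m.inp.length + 2) := by
  have key : ∀ (l r : List Γ) (y : ℕ),
      Run (.loop hasCur (.seq pushTmp (.seq (pushCnt i false) popInp)))
      (s.1, s.2.1, l.head?) ({ m.set i false y with inp := l.tail, tmp := r } : Mem Γ N)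
      (s.1, s.2.1, none)
      ({ m.set i false (y + l.length) with inp := [], tmp := l.reverse ++ r } : Mem Γ N)
      (4 * l.length + 1) := by
    intro l
    induction l with
    | nil => intro r y; exact Run.loop_false rfl
    | cons a l ih =>
      intro r y
      have h1 := run_pushTmp s.1 s.2.1 a ({ m.set i false y with inp := l, tmp := r } : Mem Γ N)
      have h2 := run_pushCnt i false (s.1, s.2.1, some a)
        ({ m.set i false y with inp := l, tmp := a :: r } : Mem Γ N)
      have h3 := run_popInp (s.1, s.2.1, some a)
        ({ m.set i false (y + 1) with inp := l, tmp := a :: r } : Mem Γ N)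
      have e : (({ m.set i false y with inp := l, tmp := a :: r } : Mem Γ N)).cnt i false = y :=
        Mem.set_cnt_self m i false y
      have e' : (({ m.set i false y with inp := l, tmp := a :: r } : Mem Γ N)).set i false (y + 1) =
          ({ m.set i false (y + 1) with inp := l, tmp := a :: r } : Mem Γ N) := by
        simp [Mem.set]
      rw [e, e'] at h2
      have h4 := ih (a :: r) (y + 1)
      refine Run.mono (Run.loop_true (b := hasCur) rfl (h1.seq (h2.seq h3))
        (t' := 4 * l.length + 1) ?_) (by simp; omega)
      rw [List.length_cons, show y + (l.length + 1) = y + 1 + l.length by omega,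
        List.reverse_cons, List.append_assoc]
      exact h4
  have h1 := run_popInp s m
  have h2 := key m.inp [] 0
  rw [Nat.zero_add, List.append_nil] at h2
  have e : ({ m.set i false 0 with inp := m.inp.tail, tmp := [] } : Mem Γ N) =
      { m with inp := m.inp.tail } := by
    rw [← hi, Mem.set_self, ← ht]
  rw [e] at h2
  exact (h1.seq h2).mono (by omega)

/-- Set a counter to zero. -/
def clearCnt (i : Fin N) (b : Bool) : Prog (Stk N) (Alph Γ N) (Reg Γ) :=
  .seq (popCnt i b) (.loop hasGot (popCnt i b))

theorem run_clearCnt (i : Fin N) (b : Bool) (s : Reg Γ) (m : Mem Γ N) :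
    ∃ s', Run (clearCnt i b) s m s' (m.set i b 0) (2 * m.cnt i b + 2) ∧ s'.1 = s.1 := by
  have key : ∀ x, ∃ s', Run (.loop hasGot (popCnt i b)) (s.1, decide (0 < x), s.2.2)
      (m.set i b (x - 1)) s' (m.set i b 0) (2 * x + 1) ∧ s'.1 = s.1 := by
    intro x
    induction x with
    | zero => exact ⟨_, Run.loop_false rfl, rfl⟩
    | succ x ih =>
      obtain ⟨s', h', hs⟩ := ih
      have h := run_popCnt i b (s.1, decide (0 < x + 1), s.2.2) (m.set i b (x + 1 - 1))
      rw [Mem.set_cnt_self, Mem.set_set] at h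
      exact ⟨s', (Run.loop_true (by simp [hasGot]) h h').mono (by omega), hs⟩
  obtain ⟨s', h', hs⟩ := key (m.cnt i b)
  exact ⟨s', ((run_popCnt i b s m).seq h').mono (by omega), hs⟩

/-- One round of the loop of an existential quantifier with the counter `i`. -/
def exBody (i : Fin N) (p : Prog (Stk N) (Alph Γ N) (Reg Γ)) : Prog (Stk N) (Alph Γ N) (Reg Γ) :=
  .seq p (.seq (popCnt i false) (.ite hasGot (pushCnt i true) (.load id)))

/-- The loop of an existential quantifier with the counter `i`. -/
def exLoop (i : Fin N) (p : Prog (Stk N) (Alph Γ N) (Reg Γ)) : Prog (Stk N) (Alph Γ N) (Reg Γ) :=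
  .loop (fun s => !s.1 && s.2.1) (exBody i p)

/-- The memory in which the variable stored in counter `i` has the value `x`. -/
def Mem.bind (m : Mem Γ N) (i : Fin N) (x y : ℕ) : Mem Γ N := (m.set i true x).set i false y

theorem run_exLoop (i : Fin N) (p : Prog (Stk N) (Alph Γ N) (Reg Γ)) (m : Mem Γ N)
    (Q : ℕ → Prop) (n T : ℕ)
    (hp : ∀ x ≤ n, ∀ s, ∃ s', Run p s (m.bind i x (n - x)) s' (m.bind i x (n - x)) T ∧
      (s'.1 = true ↔ Q x)) :
    ∀ y x, x + y = n → ∀ c, ∃ s' x' y', x' + y' ≤ n ∧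
      Run (exLoop i p) (false, true, c) (m.bind i x y) s' (m.bind i x' y') ((y + 1) * (T + 4) + 1) ∧
      (s'.1 = true ↔ ∃ z, x ≤ z ∧ z ≤ n ∧ Q z) := by
  intro y
  induction y with
  | zero =>
    intro x hx c
    obtain ⟨s1, h1, hQ⟩ := hp x (by omega) (false, true, c)
    rw [show n - x = 0 by omega] at h1
    have h2 := run_popCnt i false s1 (m.bind i x 0)
    have e : (m.bind i x 0).cnt i false = 0 := Mem.set_cnt_self _ i false 0
    rw [e] at h2
    have e' : (m.bind i x 0).set i false 0 = m.bind i x 0 := Mem.set_set _ i false 0 0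
    rw [show 0 - 1 = 0 from rfl, e'] at h2
    have h3 : Run (.ite hasGot (pushCnt i true) (.load id)) (s1.1, false, s1.2.2) (m.bind i x 0)
      (s1.1, false, s1.2.2) (m.bind i x 0) 2 := Run.ite_false rfl (Run.load id _ _)
    refine ⟨_, x, 0, hx.le, Run.mono (Run.loop_true rfl (h1.seq (h2.seq h3))
      (Run.loop_false (by simp))) (by omega), ?_⟩
    rw [hQ]
    constructor
    · exact fun h => ⟨x, le_rfl, by omega, h⟩
    · rintro ⟨z, hz, hz', h⟩
      rwa [show x = z by omega]
  | succ y ih =>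
    intro x hx c
    obtain ⟨s1, h1, hQ⟩ := hp x (by omega) (false, true, c)
    rw [show n - x = y + 1 by omega] at h1
    have h2 := run_popCnt i false s1 (m.bind i x (y + 1))
    have e : (m.bind i x (y + 1)).cnt i false = y + 1 := Mem.set_cnt_self _ i false _
    rw [e] at h2
    have e' : (m.bind i x (y + 1)).set i false (y + 1 - 1) = m.bind i x y :=
      Mem.set_set _ i false _ _
    rw [e'] at h2
    have h3 := run_pushCnt i true (s1.1, true, s1.2.2) (m.bind i x y)
    have e3 : (m.bind i x y).cnt i true = x := by
      rw [Mem.bind, Mem.set_cnt_other _ i (by simp), Mem.set_cnt_self]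
    have e4 : (m.bind i x y).set i true (x + 1) = m.bind i (x + 1) y := by
      rw [Mem.bind, Mem.set_comm _ i (by simp), Mem.set_set]; rfl
    rw [e3, e4] at h3
    have h4 := h1.seq (h2.seq (Run.ite_true (b := hasGot) (q := .load id) (by simp [hasGot]) h3))
    cases hb : s1.1 with
    | true =>
      refine ⟨_, x + 1, y, by omega, Run.mono (Run.loop_true rfl h4
        (Run.loop_false (by simp [hb]))) (by ring_nf; omega), ?_⟩
      simp only [hb, true_iff]
      exact ⟨x, le_rfl, by omega, hQ.1 hb⟩
    | false =>
      obtain ⟨s', x', y', hxy, h5, hs⟩ := ih (x + 1) (by omega) s1.2.2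
      rw [hb] at h4
      refine ⟨s', x', y', hxy, Run.mono (Run.loop_true rfl h4 h5) (by ring_nf; omega), ?_⟩
      rw [hs]
      constructor
      · rintro ⟨z, hz, hz', h⟩
        exact ⟨z, by omega, hz', h⟩
      · rintro ⟨z, hz, hz', h⟩
        rcases Nat.eq_or_lt_of_le hz with rfl | hlt
        · rw [← hQ, hb] at h
          exact absurd h (by simp)
        · exact ⟨z, hlt, hz', h⟩

/-- The program of an existential quantifier with the counter `i`. -/
def exProg [Inhabited Γ] (i : Fin N) (p : Prog (Stk N) (Alph Γ N) (Reg Γ)) :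
    Prog (Stk N) (Alph Γ N) (Reg Γ) :=
  .seq (countInp i) (.seq moveBack (.seq (.load fun s => (false, true, s.2.2))
    (.seq (exLoop i p) (.seq (clearCnt i true) (clearCnt i false)))))

theorem run_exProg [Inhabited Γ] (i : Fin N) (p : Prog (Stk N) (Alph Γ N) (Reg Γ)) (m : Mem Γ N)
    (ht : m.tmp = []) (hi : ∀ b, m.cnt i b = 0) (Q : ℕ → Prop) (T : ℕ)
    (hp : ∀ x ≤ m.inp.length, ∀ s, ∃ s', Run p s (m.bind i x (m.inp.length - x)) s'
      (m.bind i x (m.inp.length - x)) T ∧ (s'.1 = true ↔ Q x)) (s : Reg Γ) :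
    ∃ s', Run (exProg i p) s m s' m ((m.inp.length + 1) * (T + 4) + 11 * m.inp.length + 10) ∧
      (s'.1 = true ↔ ∃ x ≤ m.inp.length, Q x) := by
  set n := m.inp.length with hn
  have h1 := run_countInp i s m ht (hi false)
  set m1 : Mem Γ N := { m.set i false m.inp.length with inp := [], tmp := m.inp.reverse } with hm1
  have h2 := run_moveBack (s.1, s.2.1, none) m1
  have e2 : m.set i false m.inp.length = m.bind i 0 n := by
    rw [Mem.bind, ← hi true, Mem.set_self]
  have e2' : ({ m1 with inp := m1.tmp.reverse ++ m1.inp, tmp := [] } : Mem Γ N) =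
      m.bind i 0 n := by
    rw [← e2]; simp [hm1, Mem.set, ht]
  have e2l : m1.tmp.length = n := by simp [hm1, hn]
  rw [e2', e2l] at h2
  have h3 := Run.load (fun s : Reg Γ => (false, true, s.2.2)) (s.1, s.2.1, none)
    (m.bind i 0 n)
  obtain ⟨s4, x, y, hxy, h4, hs4⟩ := run_exLoop i p m Q n T hp n 0 (by omega) none
  obtain ⟨s5, h5, hs5⟩ := run_clearCnt i true s4 (m.bind i x y)
  obtain ⟨s6, h6, hs6⟩ := run_clearCnt i false s5 ((m.bind i x y).set i true 0)
  have e5 : (m.bind i x y).cnt i true = x := by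
    rw [Mem.bind, Mem.set_cnt_other _ i (by simp), Mem.set_cnt_self]
  have e6 : ((m.bind i x y).set i true 0).cnt i false = y := by
    rw [Mem.set_cnt_other _ i (by simp), Mem.bind, Mem.set_cnt_self]
  have e7 : ((m.bind i x y).set i true 0).set i false 0 = m := by
    have a : m.set i true 0 = m := by rw [← hi true, Mem.set_self]
    have b : m.set i false 0 = m := by rw [← hi false, Mem.set_self]
    rw [Mem.bind, Mem.set_comm _ i (by simp), Mem.set_set, Mem.set_comm m i (by simp),
      Mem.set_set, b, a]
  rw [e5] at h5
  rw [e6, e7] at h6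
  refine ⟨s6, Run.mono (h1.seq (h2.seq (h3.seq (h4.seq (h5.seq h6))))) ?_, ?_⟩
  · rw [← hn]; generalize (n + 1) * (T + 4) = B; omega
  · rw [hs6, hs5, hs4]
    simp

/-- The counter of the `i`-th variable (de Bruijn index) below `d` quantifiers. -/
def idx (N d i : ℕ) : Fin (N + 1) := Fin.ofNat (N + 1) (d - 1 - i)

/-- The program that evaluates a formula below `d` quantifiers. -/
def prog [Inhabited Γ] (N : ℕ) : Fml Γ → ℕ → Prog (Stk (N + 1)) (Alph Γ (N + 1)) (Reg Γ)
  | .letter p c l, d => readLetter p c (l.map fun x => (idx N d x.1, x.2))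
  | .not φ, d => .seq (prog N φ d) (.load fun s => (!s.1, s.2))
  | .and φ ψ, d => .seq (prog N φ d) (.ite (fun s => s.1) (prog N ψ d) (.load id))
  | .ex φ, d => exProg (Fin.ofNat (N + 1) d) (prog N φ (d + 1))

/-- A polynomial bound on the evaluation time. -/
noncomputable def timeBound : Fml Γ → Polynomial ℕ
  | .letter _ c l => 3 * .X + (9 * l.length * .X + 4 * l.length + 3 * c + 8 : Polynomial ℕ)
  | .not φ => timeBound φ + 1
  | .and φ ψ => timeBound φ + timeBound ψ + 2
  | .ex φ => (.X + 1) * (timeBound φ + 4) + 11 * .X + 10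

/-- The counters hold the values of the first `d` variables, and the others are zero. -/
def Mem.Holds (m : Mem Γ (N + 1)) (d : ℕ) (v : ℕ → ℕ) : Prop :=
  (∀ i < d, m.cnt (idx N d i) true = v i ∧ m.cnt (idx N d i) false = m.inp.length - v i) ∧
  ∀ j : Fin (N + 1), d ≤ j → ∀ b, m.cnt j b = 0

theorem run_prog [Inhabited Γ] (φ : Fml Γ) (d : ℕ) (hN : d + φ.depth ≤ N + 1) (hφ : φ.Scoped d)
    (v : ℕ → ℕ) (m : Mem Γ (N + 1)) (hm : m.Holds d v) (hv : ∀ i < d, v i ≤ m.inp.length)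
    (h0 : m.scr = 0) (ht : m.tmp = []) (s : Reg Γ) :
    ∃ s', Run (prog N φ d) s m s' m ((timeBound φ).eval m.inp.length) ∧
      (s'.1 = true ↔ φ.Eval m.inp v) := by
  induction φ generalizing d v m s with
  | letter p c l =>
    have e : (l.map fun x => (idx N d x.1, x.2)).map (fun x => m.cnt x.1 x.2) =
        l.map (val m.inp.length v) := by
      rw [List.map_map]
      refine List.map_congr_left fun x hx => ?_
      obtain ⟨h1, h2⟩ := hm.1 x.1 (hφ x hx)
      simp only [Function.comp, val]
      split_ifs with hb
      · rw [hb, h1]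
      · rw [Bool.not_eq_true] at hb
        rw [hb, h2]
    obtain ⟨s', h, hs⟩ := run_readLetter p c (l.map fun x => (idx N d x.1, x.2)) s m h0 ht
    rw [e] at h hs
    have hsum : (l.map (val m.inp.length v)).sum ≤ l.length * m.inp.length := by
      have := List.sum_le_card_nsmul (l.map (val m.inp.length v)) m.inp.length (by
        intro y hy
        obtain ⟨x, hx, rfl⟩ := List.mem_map.1 hy
        simp only [val]
        split_ifs
        · exact hv _ (hφ x hx)
        · omega)
      simpa using this
    refine ⟨s', h.mono ?_, by rw [hs]; rfl⟩
    simp only [timeBound, Polynomial.eval_add, Polynomial.eval_mul, Polynomial.eval_X,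
      Polynomial.eval_natCast, Polynomial.eval_ofNat, List.length_map]
    nlinarith
  | not φ ih =>
    obtain ⟨s', h, hs⟩ := ih d hN hφ v m hm hv h0 ht s
    refine ⟨_, (h.seq (Run.load _ _ _)).mono (by simp [timeBound]), ?_⟩
    simp only [Fml.Eval, ← hs]
    simp
  | and φ ψ ih1 ih2 =>
    simp only [Fml.depth] at hN
    obtain ⟨s1, h1, hs1⟩ := ih1 d (by omega) hφ.1 v m hm hv h0 ht s
    obtain ⟨s2, h2, hs2⟩ := ih2 d (by omega) hφ.2 v m hm hv h0 ht s1
    simp only [Fml.Eval, ← hs1, ← hs2]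
    cases hb : s1.1 with
    | true =>
      exact ⟨s2, (h1.seq (Run.ite_true (b := fun s => s.1) hb h2)).mono
        (by simp [timeBound]; omega), by simp⟩
    | false =>
      exact ⟨s1, (h1.seq (Run.ite_false (b := fun s => s.1) hb (Run.load id _ _))).mono
        (by simp [timeBound]), by simp [hb]⟩
  | ex φ ih =>
    simp only [Fml.depth] at hN
    have hd : (Fin.ofNat (N + 1) d).val = d := by
      simp only [Fin.ofNat]; exact Nat.mod_eq_of_lt (by omega)
    obtain ⟨s', h, hs⟩ := run_exProg (Fin.ofNat (N + 1) d) (prog N φ (d + 1)) m ht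
      (fun b => hm.2 _ hd.ge b) (fun x => φ.Eval m.inp (push x v))
      ((timeBound φ).eval m.inp.length) (by
        intro x hx s
        refine ih (d + 1) (by omega) hφ (push x v) (m.bind (Fin.ofNat (N + 1) d) x _) ?_ ?_ h0 ht s
        · constructor
          · intro i hi
            cases i with
            | zero =>
              have e : idx N (d + 1) 0 = Fin.ofNat (N + 1) d := by simp [idx]
              rw [e]
              refine ⟨?_, Mem.set_cnt_self _ _ _ _⟩
              rw [Mem.bind, Mem.set_cnt_other _ _ (by simp), Mem.set_cnt_self]
              rfl
            | succ i =>
              have e : idx N (d + 1) (i + 1) = idx N d i := by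
                rw [idx, idx]; congr 1; omega
              have hne : idx N d i ≠ Fin.ofNat (N + 1) d := by
                intro h
                have h' := congrArg Fin.val h
                rw [hd] at h'
                simp only [idx, Fin.ofNat] at h'
                rw [Nat.mod_eq_of_lt (by omega)] at h'
                omega
              rw [e, Mem.bind, Mem.set_cnt_ne _ hne, Mem.set_cnt_ne _ hne, Mem.set_cnt_ne _ hne,
                Mem.set_cnt_ne _ hne]
              exact hm.1 i (by omega)
          · intro j hj b
            have hne : j ≠ Fin.ofNat (N + 1) d := by
              intro h
              rw [h, hd] at hj
              omega
            rw [Mem.bind, Mem.set_cnt_ne _ hne, Mem.set_cnt_ne _ hne]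
            exact hm.2 j (by omega) b
        · intro i hi
          cases i with
          | zero => exact hx
          | succ i => exact hv i (by omega)) s
    exact ⟨s', h.mono (by simp [timeBound]), hs⟩

/-- The initial contents of the registers. -/
def reset : Reg Γ := (false, false, none)

/-- The stacks that hold only the output `b`. -/
def outStk (b : Bool) : ∀ k : Stk N, List (Alph Γ N k)
  | .out => [b]
  | .inp => []
  | .tmp => []
  | .cnt _ _ => []
  | .scr => []

/-- Delete the input. -/
def clearInp : Prog (Stk N) (Alph Γ N) (Reg Γ) := .seq popInp (.loop hasCur popInp)

theorem run_clearInp (s : Reg Γ) (m : Mem Γ N) :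
    ∃ s', Run clearInp s m s' { m with inp := [] } (2 * m.inp.length + 2) ∧ s'.1 = s.1 := by
  have key : ∀ l : List Γ, ∃ s', Run (.loop hasCur popInp) (s.1, s.2.1, l.head?)
      ({ m with inp := l.tail } : Mem Γ N) s' { m with inp := [] } (2 * l.length + 1) ∧
      s'.1 = s.1 := by
    intro l
    induction l with
    | nil => exact ⟨_, Run.loop_false rfl, rfl⟩
    | cons a l ih =>
      obtain ⟨s', h', hs⟩ := ih
      have h := run_popInp (s.1, s.2.1, some a) ({ m with inp := l } : Mem Γ N)
      exact ⟨s', (Run.loop_true (b := hasCur) rfl h h').mono (by simp; omega), hs⟩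
  obtain ⟨s', h', hs⟩ := key m.inp
  exact ⟨s', ((run_popInp s m).seq h').mono (by omega), hs⟩

open Abduction in
/-- The words that satisfy a formula without free variables are recognized in polynomial time. -/
theorem inP_of_fml [Fintype Γ] [Inhabited Γ] (φ : Fml Γ) (hφ : φ.Scoped 0) (v : ℕ → ℕ) :
    InP {w | φ.Eval w v} := by
  classical
  set N := φ.depth with hN
  let p : Prog (Stk (N + 1)) (Alph Γ (N + 1)) (Reg Γ) :=
    .seq (.seq (prog N φ 0) clearInp) (.seq (.push .out fun s => s.1) (.load fun _ => reset))
  have run : ∀ w : List Γ, ∃ n ≤ ((timeBound φ) + 2 * .X + 4 : Polynomial ℕ).eval w.length,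
      p.Exec (reset, Mem.stk ⟨w, [], fun _ _ => 0, 0⟩) (reset, outStk (decide (φ.Eval w v))) n := by
    intro w
    obtain ⟨s1, h1, hs⟩ := run_prog (N := N) φ 0 (by omega) hφ v ⟨w, [], fun _ _ => 0, 0⟩
      ⟨fun i hi => absurd hi (by omega), fun _ _ _ => rfl⟩ (fun i hi => absurd hi (by omega)) rfl
      rfl reset
    obtain ⟨s2, h2, hs2⟩ := run_clearInp s1 (⟨w, [], fun _ _ => 0, 0⟩ : Mem Γ (N + 1))
    obtain ⟨n, hn, h⟩ := h1.seq h2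
    have h3 := Prog.Exec.push (Γ := Alph Γ (N + 1)) (Stk.out : Stk (N + 1)) (fun s : Reg Γ => s.1)
      s2 (Mem.stk ⟨[], [], fun _ _ => 0, 0⟩)
    have e : Function.update (Mem.stk (⟨[], [], fun _ _ => 0, 0⟩ : Mem Γ (N + 1))) Stk.out
        (s2.1 :: Mem.stk (⟨[], [], fun _ _ => 0, 0⟩ : Mem Γ (N + 1)) Stk.out) =
        outStk (decide (φ.Eval w v)) := by
      have : s2.1 = decide (φ.Eval w v) := by
        rw [hs2, Bool.eq_iff_iff, hs, decide_eq_true_iff]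
      funext k; cases k <;> simp [Mem.stk, Function.update, outStk, this]
    rw [e] at h3
    refine ⟨_, ?_, h.seq (h3.seq (Prog.Exec.load (fun _ => reset) s2 _))⟩
    simp at hn ⊢
    omega
  have fin : Finite p.Lab := p.finite_lab
  let tm : FinTM2 :=
    { K := Stk (N + 1)
      k₀ := .inp
      k₁ := .out
      Γ := Alph Γ (N + 1)
      Λ := Option p.Lab
      main := some p.entry
      ΛFin := Fintype.ofFinite _
      σ := Reg Γ
      initialState := reset
      Γk₀Fin := inferInstanceAs (Fintype Γ)
      m := fun l => match l with
        | none => .halt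
        | some l => p.code none some l }
  choose n hn h using run
  refine ⟨{ tm := tm
            inputAlphabet := Equiv.refl _
            outputAlphabet := Equiv.refl _
            time := timeBound φ + 2 * .X + 5
            outputsFun := fun w => ⟨⟨n w + 1, ?_⟩, ?_⟩ }⟩
  · have h1 := (h w).steps (Λ := Option p.Lab) tm.m none some fun _ => rfl
    rw [add_comm, Function.iterate_add_apply]
    have e1 : initList tm (List.map (Equiv.refl Γ).invFun w) =
        (⟨some (some p.entry), reset, Mem.stk ⟨w, [], fun _ _ => 0, 0⟩⟩ :
          TM2.Cfg (Alph Γ (N + 1)) (Option p.Lab) (Reg Γ)) := by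
      simp only [initList]
      congr 1
      funext k
      cases k <;> simp [Mem.stk, tm]
    have e2 : haltList tm (List.map (Equiv.refl Bool).invFun
        (Computability.encodeBool (decide (φ.Eval w v)))) =
        (⟨none, reset, outStk (decide (φ.Eval w v))⟩ :
          TM2.Cfg (Alph Γ (N + 1)) (Option p.Lab) (Reg Γ)) := by
      simp only [haltList]
      congr 1
      funext k
      cases k <;> simp [outStk, tm, Computability.encodeBool]
    refine (congrArg _ (congrArg _ (congrArg some e1))).trans ?_
    refine (congrArg _ h1).trans ?_
    refine Eq.trans ?_ (congrArg some e2.symm)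
    rfl
  · have := hn w
    simp at this ⊢
    omega

end WordLogic

/-! ### First-order definable relations between positions of a word -/

namespace WordLogic

variable {Γ : Type}

/-- The relation `P` between a word and positions in it is definable by a first-order formula. -/
def FO (P : List Γ → (ℕ → ℕ) → Prop) : Prop :=
  ∃ φ : Fml Γ, ∀ w v, (∀ i, v i ≤ w.length) → (φ.Eval w v ↔ P w v)

/-- `t` is a sum of variables and a constant. -/
def Tm (t : (ℕ → ℕ) → ℕ) : Prop := ∃ (c : ℕ) (l : List ℕ), ∀ v, t v = c + (l.map v).sum

theorem Tm.var (i : ℕ) : Tm fun v => v i := ⟨0, [i], fun v => by simp⟩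

theorem Tm.const (c : ℕ) : Tm fun _ => c := ⟨c, [], fun v => by simp⟩

theorem Tm.add {t s : (ℕ → ℕ) → ℕ} (ht : Tm t) (hs : Tm s) : Tm fun v => t v + s v := by
  obtain ⟨c, l, h⟩ := ht
  obtain ⟨c', l', h'⟩ := hs
  exact ⟨c + c', l ++ l', fun v => by simp [h, h']; omega⟩

theorem Tm.shift {t : (ℕ → ℕ) → ℕ} (ht : Tm t) : Tm fun v => t fun k => v (k + 1) := by
  obtain ⟨c, l, h⟩ := ht
  exact ⟨c, l.map (· + 1), fun v => by simp [h, Function.comp_def]⟩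

namespace FO

theorem congr {P P' : List Γ → (ℕ → ℕ) → Prop} (h : FO P)
    (hP : ∀ w v, (∀ i, v i ≤ w.length) → (P' w v ↔ P w v)) : FO P' := by
  obtain ⟨φ, hφ⟩ := h
  exact ⟨φ, fun w v hv => (hφ w v hv).trans (hP w v hv).symm⟩

open Classical in
theorem letter (p : Option Γ → Prop) {t : (ℕ → ℕ) → ℕ} (ht : Tm t) :
    FO fun (w : List Γ) v => p w[t v]? := by
  obtain ⟨c, l, h⟩ := ht
  refine ⟨.letter (fun o => decide (p o)) c (l.map fun i => (i, true)), fun w v _ => ?_⟩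
  simp [Fml.Eval, h, Function.comp_def, val]

theorem const (p : Prop) : FO fun (_ : List Γ) _ => p := letter (fun _ => p) (Tm.const 0)

theorem not {P : List Γ → (ℕ → ℕ) → Prop} (h : FO P) : FO fun w v => ¬ P w v := by
  obtain ⟨φ, hφ⟩ := h
  exact ⟨.not φ, fun w v hv => not_congr (hφ w v hv)⟩

theorem and {P Q : List Γ → (ℕ → ℕ) → Prop} (hP : FO P) (hQ : FO Q) :
    FO fun w v => P w v ∧ Q w v := by
  obtain ⟨φ, hφ⟩ := hP
  obtain ⟨ψ, hψ⟩ := hQ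
  exact ⟨.and φ ψ, fun w v hv => and_congr (hφ w v hv) (hψ w v hv)⟩

theorem or {P Q : List Γ → (ℕ → ℕ) → Prop} (hP : FO P) (hQ : FO Q) :
    FO fun w v => P w v ∨ Q w v :=
  (hP.not.and hQ.not).not.congr fun w v _ => by tauto

theorem imp {P Q : List Γ → (ℕ → ℕ) → Prop} (hP : FO P) (hQ : FO Q) :
    FO fun w v => P w v → Q w v :=
  (hP.not.or hQ).congr fun w v _ => by tauto

theorem ex {P : List Γ → (ℕ → ℕ) → ℕ → Prop} (h : FO fun w v => P w (fun k => v (k + 1)) (v 0)) :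
    FO fun w v => ∃ i ≤ w.length, P w v i := by
  obtain ⟨φ, hφ⟩ := h
  refine ⟨.ex φ, fun w v hv => exists_congr fun i => and_congr_right fun hi => ?_⟩
  refine hφ w (push i v) fun k => ?_
  cases k with
  | zero => exact hi
  | succ k => exact hv k

theorem all {P : List Γ → (ℕ → ℕ) → ℕ → Prop} (h : FO fun w v => P w (fun k => v (k + 1)) (v 0)) :
    FO fun w v => ∀ i ≤ w.length, P w v i :=
  (FO.ex (P := fun w v i => ¬ P w v i) h.not).not.congr fun w v _ => by
    push Not; rfl

/-- `v i < v j` holds iff the position `v i + (n - v j)` is inside the word of length `n`. -/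
theorem lt (i j : ℕ) : FO fun (_ : List Γ) v => v i < v j := by
  refine ⟨.letter Option.isSome 0 [(i, true), (j, false)], fun w v hv => ?_⟩
  have := hv j
  simp only [Fml.Eval, List.map_cons, List.map_nil, List.sum_cons, List.sum_nil, val, if_true,
    Bool.false_eq_true, if_false]
  rw [← Option.ne_none_iff_isSome, ne_eq, List.getElem?_eq_none_iff]
  omega

theorem rename {P : List Γ → (ℕ → ℕ) → Prop} (h : FO P) (f : ℕ → ℕ) :
    FO fun w v => P w fun k => v (f k) := by
  obtain ⟨φ, hφ⟩ := h
  exact ⟨φ.rename f, fun w v hv => (Fml.eval_rename w φ f v).trans (hφ w _ fun k => hv _)⟩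

theorem comap {Δ : Type} {P : List Δ → (ℕ → ℕ) → Prop} (h : FO P) (g : Γ → Δ) :
    FO fun w v => P (w.map g) v := by
  obtain ⟨φ, hφ⟩ := h
  exact ⟨φ.comap g, fun w v hv => (Fml.eval_comap g w φ v).trans (hφ _ _ (by simpa using hv))⟩

theorem exists_mem_list {ι : Type} (l : List ι) {P : ι → List Γ → (ℕ → ℕ) → Prop}
    (h : ∀ x ∈ l, FO (P x)) : FO fun w v => ∃ x ∈ l, P x w v := by
  induction l with
  | nil => exact (FO.const False).congr fun w v _ => by simp
  | cons a l ih =>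
    exact ((h a (by simp)).or (ih fun x hx => h x (by simp [hx]))).congr fun w v _ => by simp

end FO

/-- Definable sets of words are decidable in polynomial time. -/
theorem inP_of_FO [Fintype Γ] [Inhabited Γ] {P : List Γ → Prop} (h : FO fun w _ => P w) :
    Abduction.InP {w | P w} := by
  obtain ⟨φ, hφ⟩ := h
  obtain ⟨d, hd⟩ := φ.exists_scoped
  -- Quantifying the free variables does not change the meaning, because `P` ignores them.
  have key : ∀ (d : ℕ) (φ : Fml Γ), φ.Scoped d →
      (∀ w v, (∀ i, v i ≤ w.length) → (φ.Eval w v ↔ P w)) →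
      ∃ ψ : Fml Γ, ψ.Scoped 0 ∧ ∀ w v, (∀ i, v i ≤ w.length) → (ψ.Eval w v ↔ P w) := by
    intro d
    induction d with
    | zero => exact fun φ h h' => ⟨φ, h, h'⟩
    | succ d ih =>
      refine fun φ h h' => ih (.ex φ) h fun w v hv => ?_
      have h0 : ∀ i ≤ w.length, ∀ k, push i v k ≤ w.length := by
        intro i hi k
        cases k with
        | zero => exact hi
        | succ k => exact hv k
      constructor
      · rintro ⟨i, hi, h1⟩
        exact (h' w _ (h0 i hi)).1 h1
      · intro hP
        exact ⟨0, Nat.zero_le _, (h' w _ (h0 0 (Nat.zero_le _))).2 hP⟩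
  obtain ⟨ψ, hψ, hP⟩ := key d φ hd hφ
  have := inP_of_fml ψ hψ fun _ => 0
  convert this using 2
  ext w
  exact (hP w _ fun _ => Nat.zero_le _).symm

end WordLogic

/-! ### Constants and atoms at positions of a word -/

namespace Abduction

open WordLogic

theorem drop_eq_append_iff {α : Type} (w s : List α) (i : ℕ) (P : Option α → Prop) :
    (∃ rest, w.drop i = s ++ rest ∧ P rest.head?) ↔
      (∀ k < s.length, w[i + k]? = s[k]?) ∧ P w[i + s.length]? := by
  constructor
  · rintro ⟨rest, h, hP⟩
    have h' : ∀ k, w[i + k]? = (s ++ rest)[k]? := fun k => by rw [← h, List.getElem?_drop]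
    refine ⟨fun k hk => by rw [h', List.getElem?_append_left hk], ?_⟩
    rw [h', List.getElem?_append_right le_rfl, Nat.sub_self, ← List.head?_eq_getElem?]
    exact hP
  · rintro ⟨h, hP⟩
    refine ⟨w.drop (i + s.length), ?_, by rwa [List.head?_drop]⟩
    refine List.ext_getElem? fun k => ?_
    rw [List.getElem?_drop]
    rcases lt_or_ge k s.length with hk | hk
    · rw [h k hk, List.getElem?_append_left hk]
    · rw [List.getElem?_append_right hk, List.getElem?_drop]
      congr 1; omega

/-- The symbol is a binary digit. -/
def IsBit : Option Sym → Prop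
  | some (.bit _) => True
  | _ => False

/-- The symbol (or the end of the word) may follow an atom. -/
def IsAtomEnd : Option Sym → Prop
  | none => True
  | some .set => True
  | some .atom => True
  | _ => False

theorem IsAtomEnd.not_isBit {o : Option Sym} (h : IsAtomEnd o) : ¬ IsBit o := by
  match o, h with
  | none, _ => exact fun h => h
  | some .set, _ => exact fun h => h
  | some .atom, _ => exact fun h => h

theorem bits_append_inj {l l' r r' : List Sym} (hl : ∀ x ∈ l, IsBit (some x))
    (hl' : ∀ x ∈ l', IsBit (some x)) (hr : ¬ IsBit r.head?) (hr' : ¬ IsBit r'.head?)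
    (h : l ++ r = l' ++ r') : l = l' ∧ r = r' := by
  induction l generalizing l' with
  | nil =>
    cases l' with
    | nil => exact ⟨rfl, h⟩
    | cons a l' =>
      simp only [List.nil_append] at h
      rw [h] at hr
      exact absurd (hl' a (by simp)) hr
  | cons a l ih =>
    cases l' with
    | nil =>
      simp only [List.nil_append] at h
      rw [← h] at hr'
      exact absurd (hl a (by simp)) hr'
    | cons b l' =>
      simp only [List.cons_append, List.cons.injEq] at h
      obtain ⟨rfl, h⟩ := h
      obtain ⟨rfl, rfl⟩ := ih (fun x hx => hl x (by simp [hx])) (fun x hx => hl' x (by simp [hx])) h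
      exact ⟨rfl, rfl⟩

theorem encodePosNum_getLast? (n : PosNum) :
    (Computability.encodePosNum n).getLast? = some true := by
  induction n with
  | one => rfl
  | bit0 n ih => simp [Computability.encodePosNum, List.getLast?_cons, ih]
  | bit1 n ih => simp [Computability.encodePosNum, List.getLast?_cons, ih]

theorem exists_encodePosNum (l : List Bool) (h : l.getLast? = some true) :
    ∃ n, Computability.encodePosNum n = l := by
  induction l with
  | nil => simp at h
  | cons a l ih =>
    rcases l.eq_nil_or_concat with rfl | ⟨l', b, rfl⟩
    · simp only [List.getLast?_singleton, Option.some.injEq] at h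
      exact ⟨.one, by rw [h]; rfl⟩
    · obtain ⟨n, hn⟩ := ih (by simpa [List.getLast?_cons] using h)
      cases a with
      | false => exact ⟨.bit0 n, by rw [← hn]; rfl⟩
      | true => exact ⟨.bit1 n, by rw [← hn]; rfl⟩

/-- The codes of numbers are the lists of digits without a superfluous leading zero. The least
significant digit is the first. -/
theorem exists_encodeNat_iff (l : List Bool) :
    (∃ n, Computability.encodeNat n = l) ↔ l = [] ∨ l.getLast? = some true := by
  constructor
  · rintro ⟨n, rfl⟩
    unfold Computability.encodeNat
    cases (n : Num) with
    | zero => exact Or.inl rfl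
    | pos p => exact Or.inr (encodePosNum_getLast? p)
  · rintro (rfl | h)
    · exact ⟨0, rfl⟩
    · obtain ⟨p, hp⟩ := exists_encodePosNum l h
      refine ⟨((Num.pos p : Num) : ℕ), ?_⟩
      rw [Computability.encodeNat, Num.of_to_nat]
      exact hp

theorem encodeNat_injective : Function.Injective Computability.encodeNat := fun a b h => by
  rw [← Computability.decode_encodeNat a, h, Computability.decode_encodeNat]

theorem isBit_of_mem_encodeSymbol {X : Type} [Encodable X] {x : X} {a : Sym}
    (h : a ∈ encodeSymbol x) : IsBit (some a) := by
  obtain ⟨b, _, rfl⟩ := List.mem_map.1 h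
  trivial

theorem encodeSymbol_injective {X : Type} [Encodable X] :
    Function.Injective (encodeSymbol : X → List Sym) := by
  intro x y h
  have hb : Function.Injective Sym.bit := fun a b h => by injection h
  exact Encodable.encode_injective (encodeNat_injective (List.map_injective_iff.2 hb h))

variable {V : Vocabulary} [Denumerable V.Const]

/-- At position `i` of `w`, there is the argument `c`. -/
def CAt (w : List Sym) (i : ℕ) (c : V.Const) : Prop :=
  ∃ rest, w.drop i = Sym.arg :: encodeSymbol c ++ rest ∧ ¬ IsBit rest.head?

/-- At position `i` of `w`, there are the arguments `l`, and nothing else before the end of an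
atom. -/
def ArgsAt (w : List Sym) (i : ℕ) (l : List V.Const) : Prop :=
  ∃ rest, w.drop i = l.flatMap (fun c => Sym.arg :: encodeSymbol c) ++ rest ∧ IsAtomEnd rest.head?

/-- At position `i` of `w`, there is an argument mark, followed by exactly `l` digits. -/
def RunAt (w : List Sym) (i l : ℕ) : Prop :=
  w[i]? = some Sym.arg ∧ (∀ k < l, IsBit w[i + 1 + k]?) ∧ ¬ IsBit w[i + 1 + l]?

theorem cAt_iff (w : List Sym) (i : ℕ) (c : V.Const) :
    CAt w i c ↔ w[i]? = some Sym.arg ∧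
      (∀ k < (encodeSymbol c).length, w[i + 1 + k]? = (encodeSymbol c)[k]?) ∧
      ¬ IsBit w[i + 1 + (encodeSymbol c).length]? := by
  rw [CAt, drop_eq_append_iff w (Sym.arg :: encodeSymbol c) i fun o => ¬ IsBit o]
  simp only [List.length_cons, ← and_assoc]
  refine and_congr ⟨fun h => ⟨h 0 (by omega), fun k hk => ?_⟩, fun h k hk => ?_⟩ ?_
  · rw [show i + 1 + k = i + (k + 1) by omega, h (k + 1) (by omega)]; rfl
  · cases k with
    | zero => exact h.1
    | succ k => rw [show i + (k + 1) = i + 1 + k by omega, h.2 k (by omega)]; rfl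
  · rw [show i + ((encodeSymbol c).length + 1) = i + 1 + (encodeSymbol c).length by omega]

theorem CAt.runAt {w : List Sym} {i : ℕ} {c : V.Const} (h : CAt w i c) :
    RunAt w i (encodeSymbol c).length := by
  obtain ⟨h1, h2, h3⟩ := (cAt_iff w i c).1 h
  refine ⟨h1, fun k hk => ?_, h3⟩
  rw [h2 k hk, List.getElem?_eq_getElem hk]
  exact isBit_of_mem_encodeSymbol (List.getElem_mem hk)

theorem RunAt.unique {w : List Sym} {i l l' : ℕ} (h : RunAt w i l) (h' : RunAt w i l') : l = l' := by
  rcases lt_trichotomy l l' with hl | hl | hl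
  · exact absurd (h'.2.1 l hl) h.2.2
  · exact hl
  · exact absurd (h.2.1 l' hl) h'.2.2

theorem isBit_lt {w : List Sym} {i : ℕ} (h : IsBit w[i]?) : i < w.length := by
  by_contra hi
  rw [List.getElem?_eq_none (by omega)] at h
  exact h

theorem RunAt.le {w : List Sym} {i l : ℕ} (h : RunAt w i l) : i + 1 + l ≤ w.length := by
  cases l with
  | zero => exact (List.getElem?_eq_some_iff.1 h.1).1
  | succ l => have := isBit_lt (h.2.1 l (by omega)); omega

theorem CAt.lt {w : List Sym} {i : ℕ} {c : V.Const} (h : CAt w i c) : i < w.length := by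
  have := h.runAt.le; omega

theorem CAt.unique {w : List Sym} {i : ℕ} {c c' : V.Const} (h : CAt w i c) (h' : CAt w i c') :
    c = c' := by
  have hl := h.runAt.unique h'.runAt
  obtain ⟨-, h2, -⟩ := (cAt_iff w i c).1 h
  obtain ⟨-, h2', -⟩ := (cAt_iff w i c').1 h'
  refine encodeSymbol_injective (List.ext_getElem? fun k => ?_)
  rcases lt_or_ge k (encodeSymbol c).length with hk | hk
  · rw [← h2 k hk, ← h2' k (hl ▸ hk)]
  · rw [List.getElem?_eq_none hk, List.getElem?_eq_none (hl ▸ hk)]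

/-- The constants in a word are found at the argument marks followed by digits the last of which,
if there is one, is a one. -/
theorem exists_cAt_iff (w : List Sym) (i : ℕ) : (∃ c : V.Const, CAt w i c) ↔
    ∃ l ≤ w.length, RunAt w i l ∧ (l = 0 ∨ w[i + l]? = some (Sym.bit true)) := by
  constructor
  · rintro ⟨c, h⟩
    refine ⟨_, by have := h.runAt.le; omega, h.runAt, ?_⟩
    obtain ⟨-, h2, -⟩ := (cAt_iff w i c).1 h
    rcases (exists_encodeNat_iff _).1 ⟨Encodable.encode c, rfl⟩ with h0 | h0
    · left; simp [encodeSymbol, h0]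
    · right
      have hl : (encodeSymbol c).getLast? = some (Sym.bit true) := by
        simp [encodeSymbol, List.getLast?_map, h0]
      have hpos : 0 < (encodeSymbol c).length := by
        rw [List.length_pos_iff]; rintro h; rw [h] at hl; simp at hl
      rw [List.getLast?_eq_getElem?] at hl
      rw [← hl, ← h2 _ (by omega)]
      congr 1; omega
  · rintro ⟨l, -, h, hl⟩
    have h1 : ∀ k < l, ∃ b, w[i + 1 + k]? = some (Sym.bit b) := by
      intro k hk
      have := h.2.1 k hk
      match hw : w[i + 1 + k]?, this with
      | some (.bit b), _ => exact ⟨b, rfl⟩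
    choose! f hf using h1
    obtain ⟨n, hn⟩ := (exists_encodeNat_iff ((List.range l).map f)).2 (by
      rcases hl with rfl | hl
      · left; rfl
      · right
        cases l with
        | zero => rw [Nat.add_zero, h.1] at hl; simp at hl
        | succ l =>
          rw [List.range_succ, List.map_append, List.map_singleton, List.getLast?_concat]
          have := hf l (by omega)
          rw [show i + 1 + l = i + (l + 1) by omega, hl] at this
          simp only [Option.some.injEq, Sym.bit.injEq] at this
          rw [← this])
    have hc : encodeSymbol (Denumerable.ofNat V.Const n) = (List.range l).map fun k => Sym.bit (f k) := by
      rw [encodeSymbol, Denumerable.encode_ofNat, hn, List.map_map]; rfl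
    refine ⟨Denumerable.ofNat V.Const n, (cAt_iff _ _ _).2 ⟨h.1, ?_, ?_⟩⟩
    · intro k hk
      rw [hc] at hk ⊢
      simp only [List.length_map, List.length_range] at hk
      rw [hf k hk]
      simp [hk]
    · rw [hc, List.length_map, List.length_range]
      exact h.2.2

/-- At the positions `i` and `j` of `w`, there are argument marks, followed by the same digits. -/
def SameRun (w : List Sym) (i j : ℕ) : Prop :=
  ∃ l ≤ w.length, RunAt w i l ∧ RunAt w j l ∧
    ∀ k ≤ w.length, k < l → ∀ b, w[i + 1 + k]? = some (Sym.bit b) → w[j + 1 + k]? = some (Sym.bit b)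

theorem CAt.sameRun_iff {w : List Sym} {i j : ℕ} {c : V.Const} (h : CAt w i c) :
    SameRun w j i ↔ CAt w j c := by
  obtain ⟨h1, h2, h3⟩ := (cAt_iff w i c).1 h
  constructor
  · rintro ⟨l, hl, hj, hi, hk⟩
    obtain rfl := hi.unique h.runAt
    refine (cAt_iff w j c).2 ⟨hj.1, fun k hk' => ?_, hj.2.2⟩
    have hb := hj.2.1 k hk'
    match hw : w[j + 1 + k]?, hb with
    | some (.bit b), _ => rw [← h2 k hk', hk k (by omega) hk' b hw]
  · intro h'
    obtain ⟨h1', h2', h3'⟩ := (cAt_iff w j c).1 h'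
    have := h.runAt.le
    refine ⟨(encodeSymbol c).length, by omega, h'.runAt, h.runAt, fun k _ hk b hb => ?_⟩
    rw [h2 k hk, ← h2' k hk, hb]

theorem not_isBit_head?_args {l : List V.Const} {rest : List Sym} (h : IsAtomEnd rest.head?) :
    ¬ IsBit (l.flatMap (fun c => Sym.arg :: encodeSymbol c) ++ rest).head? := by
  cases l with
  | nil => exact h.not_isBit
  | cons c l => exact fun h => h

theorem args_append_inj {l l' : List V.Const} {r r' : List Sym} (hr : IsAtomEnd r.head?)
    (hr' : IsAtomEnd r'.head?)
    (h : l.flatMap (fun c => Sym.arg :: encodeSymbol c) ++ r =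
      l'.flatMap (fun c => Sym.arg :: encodeSymbol c) ++ r') : l = l' ∧ r = r' := by
  induction l generalizing l' with
  | nil =>
    cases l' with
    | nil => exact ⟨rfl, h⟩
    | cons c l' =>
      simp only [List.flatMap_nil, List.nil_append] at h
      rw [h] at hr
      exact hr.elim
  | cons c l ih =>
    cases l' with
    | nil =>
      simp only [List.flatMap_nil, List.nil_append] at h
      rw [← h] at hr'
      exact hr'.elim
    | cons c' l' =>
      simp only [List.flatMap_cons, List.cons_append, List.cons.injEq, List.append_assoc,
        true_and] at h
      obtain ⟨h1, h2⟩ := bits_append_inj (fun _ => isBit_of_mem_encodeSymbol)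
        (fun _ => isBit_of_mem_encodeSymbol) (not_isBit_head?_args hr) (not_isBit_head?_args hr') h
      obtain ⟨rfl, rfl⟩ := ih h2
      exact ⟨by rw [encodeSymbol_injective h1], rfl⟩

theorem argsAt_nil (w : List Sym) (i : ℕ) : ArgsAt w i ([] : List V.Const) ↔ IsAtomEnd w[i]? := by
  simp [ArgsAt, List.head?_drop]

theorem argsAt_cons (w : List Sym) (i : ℕ) (c : V.Const) (l : List V.Const) :
    ArgsAt w i (c :: l) ↔ CAt w i c ∧ ArgsAt w (i + 1 + (encodeSymbol c).length) l := by
  have e : ∀ rest : List Sym, w.drop i = Sym.arg :: encodeSymbol c ++ rest →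
      w.drop (i + 1 + (encodeSymbol c).length) = rest := by
    intro rest h
    have : (w.drop i).drop (1 + (encodeSymbol c).length) = rest := by
      rw [h, show 1 + (encodeSymbol c).length = (Sym.arg :: encodeSymbol c).length by simp; omega,
        List.drop_left]
    rw [← this, List.drop_drop]
    congr 1; omega
  constructor
  · rintro ⟨rest, h, hr⟩
    simp only [List.flatMap_cons, List.append_assoc] at h
    exact ⟨⟨_, h, not_isBit_head?_args hr⟩, rest, e _ h, hr⟩
  · rintro ⟨⟨rest', h', -⟩, rest, h, hr⟩
    rw [e _ h'] at h
    exact ⟨rest, by rw [h', h]; simp, hr⟩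

/-- The constants that occur in a word. -/
def Dom (V : Vocabulary) [Denumerable V.Const] (w : List Sym) : Set V.Const := {c | ∃ i, CAt w i c}

theorem ArgsAt.mem_dom {w : List Sym} {i : ℕ} {l : List V.Const} (h : ArgsAt w i l) {c : V.Const}
    (hc : c ∈ l) : c ∈ Dom V w := by
  induction l generalizing i with
  | nil => simp at hc
  | cons d l ih =>
    obtain ⟨h1, h2⟩ := (argsAt_cons w i d l).1 h
    rcases List.mem_cons.1 hc with rfl | hc
    · exact ⟨i, h1⟩
    · exact ih h2 hc

variable [Encodable V.Pred]

/-- At position `i` of `w`, there is the atom `a`. -/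
def Occ (w : List Sym) (i : ℕ) (a : GroundAtom V) : Prop :=
  ∃ rest, w.drop i = encodeAtom a ++ rest ∧ IsAtomEnd rest.head?

theorem encodeAtom_append_inj {a b : GroundAtom V} {r r' : List Sym} (hr : IsAtomEnd r.head?)
    (hr' : IsAtomEnd r'.head?) (h : encodeAtom a ++ r = encodeAtom b ++ r') : a = b ∧ r = r' := by
  simp only [encodeAtom, List.cons_append, List.cons.injEq, List.append_assoc, true_and] at h
  obtain ⟨h1, h2⟩ := bits_append_inj (fun _ => isBit_of_mem_encodeSymbol)
    (fun _ => isBit_of_mem_encodeSymbol) (not_isBit_head?_args hr) (not_isBit_head?_args hr') h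
  obtain ⟨h3, rfl⟩ := args_append_inj hr hr' h2
  obtain ⟨p, x⟩ := a
  obtain ⟨q, y⟩ := b
  obtain rfl : p = q := encodeSymbol_injective h1
  exact ⟨congrArg (Atom.mk p) (List.ofFn_injective h3), rfl⟩

theorem Occ.unique {w : List Sym} {i : ℕ} {a b : GroundAtom V} (h : Occ w i a) (h' : Occ w i b) :
    a = b := by
  obtain ⟨r, h, hr⟩ := h
  obtain ⟨r', h', hr'⟩ := h'
  exact (encodeAtom_append_inj hr hr' (h.symm.trans h')).1

theorem occ_iff (w : List Sym) (i : ℕ) (a : GroundAtom V) :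
    Occ w i a ↔ w[i]? = some Sym.atom ∧
      (∀ k < (encodeSymbol a.pred).length, w[i + 1 + k]? = (encodeSymbol a.pred)[k]?) ∧
      ArgsAt w (i + 1 + (encodeSymbol a.pred).length) (List.ofFn a.args) := by
  set n := (encodeSymbol a.pred).length with hn
  have key : (∃ rest, w.drop i = Sym.atom :: encodeSymbol a.pred ++ rest ∧ True) ↔
      w[i]? = some Sym.atom ∧ ∀ k < n, w[i + 1 + k]? = (encodeSymbol a.pred)[k]? := by
    rw [drop_eq_append_iff w (Sym.atom :: encodeSymbol a.pred) i fun _ => True, and_true]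
    simp only [List.length_cons]
    refine ⟨fun h => ⟨h 0 (by omega), fun k hk => ?_⟩, fun h k hk => ?_⟩
    · rw [show i + 1 + k = i + (k + 1) by omega, h (k + 1) (by omega)]; rfl
    · cases k with
      | zero => exact h.1
      | succ k => rw [show i + (k + 1) = i + 1 + k by omega, h.2 k (by omega)]; rfl
  rw [← and_assoc, ← key]
  have e : ∀ rest : List Sym, w.drop i = Sym.atom :: encodeSymbol a.pred ++ rest →
      w.drop (i + 1 + n) = rest := by
    intro rest h
    have : (w.drop i).drop (1 + n) = rest := by
      rw [h, show 1 + n = (Sym.atom :: encodeSymbol a.pred).length by simp; omega,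
        List.drop_left]
    rw [← this, List.drop_drop]
    congr 1; omega
  constructor
  · rintro ⟨rest, h, hr⟩
    simp only [encodeAtom, List.append_assoc] at h
    exact ⟨⟨_, h, trivial⟩, rest, e _ h, hr⟩
  · rintro ⟨⟨rest', h', -⟩, rest, h, hr⟩
    rw [e _ h'] at h
    exact ⟨rest, by rw [h', h]; simp [encodeAtom], hr⟩

theorem Occ.lt {w : List Sym} {i : ℕ} {a : GroundAtom V} (h : Occ w i a) : i < w.length :=
  (List.getElem?_eq_some_iff.1 ((occ_iff w i a).1 h).1).1

theorem Occ.args_mem_dom {w : List Sym} {i : ℕ} {a : GroundAtom V} (h : Occ w i a)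
    (k : Fin (V.arity a.pred)) : a.args k ∈ Dom V w :=
  ((occ_iff w i a).1 h).2.2.mem_dom ((List.mem_ofFn' _ _).2 ⟨k, rfl⟩)

/-- The symbol begins a set. -/
def isSet : Sym → Bool
  | .set => true
  | _ => false

/-- The position `i` of `w` is in the `k`-th set, counted from zero. -/
def InBlock (w : List Sym) (k i : ℕ) : Prop := (w.take i).countP isSet = k + 1

/-- The `k`-th set of atoms in `w`, counted from zero. -/
def block (V : Vocabulary) [Encodable V.Pred] [Denumerable V.Const] (k : ℕ) (w : List Sym) :
    Set (GroundAtom V) := {a | ∃ i, InBlock w k i ∧ Occ w i a}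

end Abduction

/-! ### Definability of relations between constants in a word -/

namespace Abduction

open WordLogic

theorem fo_forall_lt {Γ : Type} (n : ℕ) {P : ℕ → List Γ → (ℕ → ℕ) → Prop} (h : ∀ k, FO (P k)) :
    FO fun w v => ∀ k < n, P k w v :=
  (FO.exists_mem_list (List.range n) fun k _ => (h k).not).not.congr fun w v _ => by
    simp only [List.mem_range]; push Not; rfl

theorem fo_runAt {t : (ℕ → ℕ) → ℕ} (ht : Tm t) (l : ℕ) : FO fun w v => RunAt w (t v) (v l) := by
  have h1 : FO fun (w : List Sym) v => w[t v]? = some Sym.arg := FO.letter (· = some Sym.arg) ht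
  have h2 : FO fun (w : List Sym) v => ∀ k ≤ w.length, k < v l → IsBit w[t v + 1 + k]? :=
    FO.all ((FO.lt 0 (l + 1)).imp (FO.letter IsBit ((ht.shift.add (Tm.const 1)).add (Tm.var 0))))
  have h3 : FO fun (w : List Sym) v => ¬ IsBit w[t v + 1 + v l]? :=
    (FO.letter IsBit ((ht.add (Tm.const 1)).add (Tm.var l))).not
  refine (h1.and (h2.and h3)).congr fun w v hv => ?_
  refine and_congr_right fun _ => and_congr_left fun _ => forall_congr' fun k => ?_
  exact ⟨fun h _ => h, fun h hk => h (by have := hv l; omega) hk⟩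

theorem fo_sameRun {t s : (ℕ → ℕ) → ℕ} (ht : Tm t) (hs : Tm s) :
    FO fun w v => SameRun w (t v) (s v) := by
  have h : ∀ b, FO fun (w : List Sym) v =>
      w[t (fun k => v (k + 2)) + 1 + v 0]? = some (Sym.bit b) →
        w[s (fun k => v (k + 2)) + 1 + v 0]? = some (Sym.bit b) := fun b =>
    (FO.letter (· = some (Sym.bit b)) ((ht.shift.shift.add (Tm.const 1)).add (Tm.var 0))).imp
      (FO.letter (· = some (Sym.bit b)) ((hs.shift.shift.add (Tm.const 1)).add (Tm.var 0)))
  refine FO.ex ((fo_runAt ht.shift 0).and ((fo_runAt hs.shift 0).and (FO.all ((FO.lt 0 1).imp ?_))))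
  exact ((h true).and (h false)).congr fun w v _ => Bool.forall_bool.trans and_comm

theorem fo_startsWith (s : List Sym) {t : (ℕ → ℕ) → ℕ} (ht : Tm t) :
    FO fun w v => ∀ k < s.length, w[t v + k]? = s[k]? :=
  fo_forall_lt _ fun k => FO.letter (· = s[k]?) (ht.add (Tm.const k))

variable {V : Vocabulary} [Denumerable V.Const]

theorem fo_exists_cAt {t : (ℕ → ℕ) → ℕ} (ht : Tm t) :
    FO fun w v => ∃ c : V.Const, CAt w (t v) c := by
  refine FO.congr ?_ fun w v _ => exists_cAt_iff w (t v)
  refine FO.ex ((fo_runAt ht.shift 0).and (FO.or ?_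
    (FO.letter (· = some (Sym.bit true)) (ht.shift.add (Tm.var 0)))))
  refine (FO.ex (P := fun _ v i => i < v 0) (FO.lt 0 1)).not.congr fun w v hv => ?_
  constructor
  · rintro h ⟨i, _, hi⟩; omega
  · intro h; by_contra h0; exact h ⟨0, Nat.zero_le _, by omega⟩

theorem fo_cAt (c : V.Const) {t : (ℕ → ℕ) → ℕ} (ht : Tm t) : FO fun w v => CAt w (t v) c :=
  ((FO.letter (· = some Sym.arg) ht).and ((fo_startsWith _ (ht.add (Tm.const 1))).and
    (FO.letter IsBit ((ht.add (Tm.const 1)).add (Tm.const _))).not)).congr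
    fun w v _ => cAt_iff w (t v) c

/-- At position `i` of `w`, there are the terms in the list, and nothing else before the end of an
atom. A variable `j` stands for the constant at position `v j`. -/
def ArgsMatch (w : List Sym) (v : ℕ → ℕ) : ℕ → List (Term V) → Prop
  | i, [] => IsAtomEnd w[i]?
  | i, .var j :: l => ∃ m ≤ w.length, (RunAt w i m ∧ SameRun w i (v j)) ∧ ArgsMatch w v (i + 1 + m) l
  | i, .const c :: l => CAt w i c ∧ ArgsMatch w v (i + 1 + (encodeSymbol c).length) l

theorem argsMatch_iff {w : List Sym} {v : ℕ → ℕ} {ρ : ℕ → V.Const} (h : ∀ i, CAt w (v i) (ρ i))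
    (l : List (Term V)) (i : ℕ) : ArgsMatch w v i l ↔ ArgsAt w i (l.map (Term.subst ρ)) := by
  induction l generalizing i with
  | nil => exact (argsAt_nil w i).symm
  | cons t l ih =>
    rw [List.map_cons, argsAt_cons]
    cases t with
    | var j =>
      simp only [ArgsMatch, (h j).sameRun_iff, ih, Term.subst]
      constructor
      · rintro ⟨m, -, ⟨h1, h2⟩, h3⟩
        rw [h1.unique h2.runAt] at h3
        exact ⟨h2, h3⟩
      · rintro ⟨h2, h3⟩
        exact ⟨_, by have := h2.runAt.le; omega, ⟨h2.runAt, h2⟩, h3⟩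
    | const c => simp only [ArgsMatch, ih, Term.subst]

theorem fo_argsMatch (l : List (Term V)) (f : ℕ → ℕ) {t : (ℕ → ℕ) → ℕ} (ht : Tm t) :
    FO fun w v => ArgsMatch w (fun k => v (f k)) (t v) l := by
  induction l generalizing f t with
  | nil => exact FO.letter IsAtomEnd ht
  | cons a l ih =>
    cases a with
    | var j =>
      exact FO.ex (((fo_runAt ht.shift 0).and (fo_sameRun ht.shift (Tm.var (f j + 1)))).and
        (ih (fun k => f k + 1) ((ht.shift.add (Tm.const 1)).add (Tm.var 0))))
    | const c =>
      exact (fo_cAt c ht).and (ih f ((ht.add (Tm.const 1)).add (Tm.const _)))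

open Classical in
theorem countP_take_succ (w : List Sym) (i : ℕ) : (w.take (i + 1)).countP isSet =
    (w.take i).countP isSet + if w[i]? = some Sym.set then 1 else 0 := by
  rw [List.take_add_one, List.countP_append]
  congr 1
  rcases w[i]? with _ | a
  · simp
  · cases a <;> simp [isSet, List.countP_cons]

theorem countP_take_eq_zero_iff (w : List Sym) (i : ℕ) :
    (w.take i).countP isSet = 0 ↔ ∀ j < i, w[j]? ≠ some Sym.set := by
  induction i with
  | zero => simp
  | succ i ih =>
    rw [countP_take_succ, Nat.add_eq_zero_iff, ih]
    constructor
    · rintro ⟨h1, h2⟩ j hj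
      rcases Nat.lt_succ_iff_lt_or_eq.1 hj with hj | rfl
      · exact h1 j hj
      · intro h; simp [h] at h2
    · intro h
      exact ⟨fun j hj => h j (by omega), if_neg (h i (by omega))⟩

theorem countP_take_eq_succ_iff (w : List Sym) (k i : ℕ) :
    (w.take i).countP isSet = k + 1 ↔ ∃ j < i, w[j]? = some Sym.set ∧
      (w.take j).countP isSet = k ∧ ∀ m, j < m → m < i → w[m]? ≠ some Sym.set := by
  induction i with
  | zero => simp
  | succ i ih =>
    rw [countP_take_succ]
    split_ifs with h
    · rw [Nat.add_right_cancel_iff]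
      constructor
      · exact fun hk => ⟨i, by omega, h, hk, fun m h1 h2 => by omega⟩
      · rintro ⟨j, hj, -, hk, h'⟩
        rcases Nat.lt_succ_iff_lt_or_eq.1 hj with hj | rfl
        · exact absurd h (h' i hj (by omega))
        · exact hk
    · rw [Nat.add_zero, ih]
      constructor
      · rintro ⟨j, hj, h1, h2, h3⟩
        refine ⟨j, by omega, h1, h2, fun m hm hm' => ?_⟩
        rcases Nat.lt_succ_iff_lt_or_eq.1 hm' with hm' | rfl
        · exact h3 m hm hm'
        · exact h
      · rintro ⟨j, hj, h1, h2, h3⟩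
        rcases Nat.lt_succ_iff_lt_or_eq.1 hj with hj | rfl
        · exact ⟨j, hj, h1, h2, fun m hm hm' => h3 m hm (by omega)⟩
        · exact absurd h1 h

theorem fo_countP (k i : ℕ) : FO fun w v => (w.take (v i)).countP isSet = k := by
  induction k generalizing i with
  | zero =>
    refine (FO.all (P := fun w v j => j < v i → ¬ w[j]? = some Sym.set)
      ((FO.lt 0 (i + 1)).imp (FO.letter (· = some Sym.set) (Tm.var 0)).not)).congr
      fun w v hv => (countP_take_eq_zero_iff w _).trans ?_
    exact ⟨fun h j _ hj => h j hj, fun h j hj => h j (by have := hv i; omega) hj⟩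
  | succ k ih =>
    refine (FO.ex (P := fun w v j => (j < v i ∧ w[j]? = some Sym.set) ∧
      (w.take j).countP isSet = k ∧
      ∀ m ≤ w.length, j < m → m < v i → ¬ w[m]? = some Sym.set)
      (((FO.lt 0 (i + 1)).and (FO.letter (· = some Sym.set) (Tm.var 0))).and
      ((ih 0).and (FO.all ((FO.lt 1 0).imp ((FO.lt 0 (i + 2)).imp
        (FO.letter (· = some Sym.set) (Tm.var 0)).not)))))).congr
      fun w v hv => (countP_take_eq_succ_iff w k _).trans ?_
    have := hv i
    constructor
    · rintro ⟨j, hj, h1, h2, h3⟩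
      exact ⟨j, by omega, ⟨hj, h1⟩, h2, fun m _ => h3 m⟩
    · rintro ⟨j, -, ⟨hj, h1⟩, h2, h3⟩
      exact ⟨j, hj, h1, h2, fun m hm hm' => h3 m (by omega) hm hm'⟩

theorem fo_inBlock (k i : ℕ) : FO fun w v => InBlock w k (v i) := fo_countP (k + 1) i

/-- The relation `P` between a word, a position in it, and constants that occur in it is definable:
there is a first-order formula that agrees with `P`, whatever positions are taken for the
constants. -/
def CDef (P : List Sym → ℕ → (ℕ → V.Const) → Prop) : Prop :=
  ∃ Q : List Sym → (ℕ → ℕ) → Prop, FO Q ∧ ∀ w s v ρ, s ≤ w.length → (∀ i, CAt w (v i) (ρ i)) →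
    (Q w (push s v) ↔ P w s ρ)

namespace CDef

variable {P Q : List Sym → ℕ → (ℕ → V.Const) → Prop}

theorem congr (h : CDef P) (hQ : ∀ w s ρ, s ≤ w.length → (∀ i, ρ i ∈ Dom V w) →
    (Q w s ρ ↔ P w s ρ)) : CDef Q := by
  obtain ⟨F, hF, h⟩ := h
  exact ⟨F, hF, fun w s v ρ hs hv =>
    (h w s v ρ hs hv).trans (hQ w s ρ hs fun i => ⟨_, hv i⟩).symm⟩

theorem const (p : Prop) : CDef fun _ _ (_ : ℕ → V.Const) => p :=
  ⟨_, FO.const p, fun _ _ _ _ _ _ => Iff.rfl⟩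

theorem not (h : CDef P) : CDef fun w s ρ => ¬ P w s ρ := by
  obtain ⟨F, hF, h⟩ := h
  exact ⟨_, hF.not, fun w s v ρ hs hv => not_congr (h w s v ρ hs hv)⟩

theorem and (h : CDef P) (h' : CDef Q) : CDef fun w s ρ => P w s ρ ∧ Q w s ρ := by
  obtain ⟨F, hF, h⟩ := h
  obtain ⟨F', hF', h'⟩ := h'
  exact ⟨_, hF.and hF', fun w s v ρ hs hv => and_congr (h w s v ρ hs hv) (h' w s v ρ hs hv)⟩

theorem or (h : CDef P) (h' : CDef Q) : CDef fun w s ρ => P w s ρ ∨ Q w s ρ :=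
  (h.not.and h'.not).not.congr fun _ _ _ _ _ => by tauto

theorem imp (h : CDef P) (h' : CDef Q) : CDef fun w s ρ => P w s ρ → Q w s ρ :=
  (h.not.or h').congr fun _ _ _ _ _ => by tauto

theorem exists_mem_list {ι : Type} (l : List ι) {P : ι → List Sym → ℕ → (ℕ → V.Const) → Prop}
    (h : ∀ x ∈ l, CDef (P x)) : CDef fun w s ρ => ∃ x ∈ l, P x w s ρ := by
  induction l with
  | nil => exact (CDef.const False).congr fun w s ρ _ _ => by simp
  | cons a l ih =>
    exact ((h a (by simp)).or (ih fun x hx => h x (by simp [hx]))).congr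
      fun w s ρ _ _ => by simp

theorem exists_mem {ι : Type} {S : Set ι} (hS : S.Finite)
    {P : ι → List Sym → ℕ → (ℕ → V.Const) → Prop}
    (h : ∀ x ∈ S, CDef (P x)) : CDef fun w s ρ => ∃ x ∈ S, P x w s ρ :=
  (exists_mem_list hS.toFinset.toList fun x hx => h x (by simpa using hx)).congr
    fun _ _ _ _ _ => by simp

theorem forall_mem {ι : Type} {S : Set ι} (hS : S.Finite)
    {P : ι → List Sym → ℕ → (ℕ → V.Const) → Prop}
    (h : ∀ x ∈ S, CDef (P x)) : CDef fun w s ρ => ∀ x ∈ S, P x w s ρ :=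
  (exists_mem hS fun x hx => (h x hx).not).not.congr fun _ _ _ _ _ => by push Not; rfl

theorem forall_mem_list {ι : Type} (l : List ι)
    {P : ι → List Sym → ℕ → (ℕ → V.Const) → Prop}
    (h : ∀ x ∈ l, CDef (P x)) : CDef fun w s ρ => ∀ x ∈ l, P x w s ρ :=
  (exists_mem_list l fun x hx => (h x hx).not).not.congr fun _ _ _ _ _ => by push Not; rfl

theorem eq_const (i : ℕ) (c : V.Const) : CDef fun _ _ ρ => ρ i = c :=
  ⟨_, fo_cAt c (Tm.var (i + 1)), fun w s v ρ _ hv => by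
    constructor
    · exact fun h => (hv i).unique h
    · rintro rfl; exact hv i⟩

theorem eq_var (i j : ℕ) : CDef fun _ _ (ρ : ℕ → V.Const) => ρ i = ρ j :=
  ⟨_, fo_sameRun (Tm.var (i + 1)) (Tm.var (j + 1)), fun w s v ρ _ hv => by
    refine ((hv j).sameRun_iff).trans ⟨fun h => (hv i).unique h, fun h => ?_⟩
    rw [← h]; exact hv i⟩

/-- The environment `ρ` with a new variable `0` of value `c`; the others are shifted. -/
def pushC (c : V.Const) (ρ : ℕ → V.Const) : ℕ → V.Const
  | 0 => c
  | k + 1 => ρ k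

theorem ex {P : List Sym → ℕ → (ℕ → V.Const) → V.Const → Prop}
    (h : CDef fun w s ρ => P w s (fun k => ρ (k + 1)) (ρ 0)) :
    CDef fun w s ρ => ∃ c ∈ Dom V w, P w s ρ c := by
  obtain ⟨F, hF, h⟩ := h
  have h1 : FO fun w v => F w (fun k => v (push 1 (push 0 fun k => k + 2) k)) := hF.rename _
  refine ⟨_, FO.ex (P := fun w v i => (∃ c : V.Const, CAt w i c) ∧
    F w (push (v 0) (push i fun k => v (k + 1)))) ((fo_exists_cAt (V := V) (Tm.var 0)).and ?_),
    fun w s v ρ hs hv => ?_⟩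
  · refine h1.congr fun w v _ => ?_
    have : (fun k => v (push 1 (push 0 fun k => k + 2) k)) =
        push (v (0 + 1)) (push (v 0) fun k => v (k + 1 + 1)) := by
      funext k
      rcases k with _ | _ | k <;> rfl
    rw [this]
  · have key : ∀ i (c : V.Const), CAt w i c →
        (F w (push s (push i v)) ↔ P w s ρ c) := fun i c hc =>
      h w s (push i v) (pushC c ρ) hs fun k => by
        cases k with
        | zero => exact hc
        | succ k => exact hv k
    constructor
    · rintro ⟨i, -, ⟨c, hc⟩, hi⟩
      exact ⟨c, ⟨i, hc⟩, (key i c hc).1 hi⟩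
    · rintro ⟨c, ⟨i, hc⟩, hP⟩
      exact ⟨i, hc.lt.le, ⟨c, hc⟩, (key i c hc).2 hP⟩

theorem all {P : List Sym → ℕ → (ℕ → V.Const) → V.Const → Prop}
    (h : CDef fun w s ρ => P w s (fun k => ρ (k + 1)) (ρ 0)) :
    CDef fun w s ρ => ∀ c ∈ Dom V w, P w s ρ c :=
  (ex (P := fun w s ρ c => ¬ P w s ρ c) h.not).not.congr fun _ _ _ _ _ => by push Not; rfl

/-- Quantification over the first `m` variables; the others are shifted. -/
theorem exists_extend (h : CDef P) (m : ℕ) : CDef fun w s ρ => ∃ θ : ℕ → V.Const,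
    (∀ i, θ i ∈ Dom V w) ∧ (∀ i, θ (i + m) = ρ i) ∧ P w s θ := by
  induction m with
  | zero =>
    refine h.congr fun w s ρ _ hρ => ⟨?_, fun hP => ⟨ρ, hρ, fun _ => rfl, hP⟩⟩
    rintro ⟨θ, -, h2, hP⟩
    obtain rfl : θ = ρ := funext h2
    exact hP
  | succ m ih =>
    refine (ex (P := fun w s ρ c => ∃ θ : ℕ → V.Const, (∀ i, θ i ∈ Dom V w) ∧
      (∀ i, θ (i + m) = pushC c ρ i) ∧ P w s θ) (ih.congr fun w s ρ _ _ => ?_)).congr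
      fun w s ρ _ _ => ?_
    · have : pushC (ρ 0) (fun k => ρ (k + 1)) = ρ := by
        funext k; cases k <;> rfl
      rw [this]
    · constructor
      · rintro ⟨θ, h1, h2, hP⟩
        refine ⟨θ m, h1 m, θ, h1, fun i => ?_, hP⟩
        cases i with
        | zero => simp [pushC]
        | succ i => rw [show i + 1 + m = i + (m + 1) by omega, h2]; rfl
      · rintro ⟨c, _, θ, h1, h2, hP⟩
        refine ⟨θ, h1, fun i => ?_, hP⟩
        rw [show i + (m + 1) = i + 1 + m by omega, h2]; rfl

/-- Quantification over all assignments of constants in the word to the variables, for a relation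
that depends on only finitely many variables. -/
theorem exists_assignment (h : CDef P) (n : ℕ)
    (hn : ∀ w s ρ ρ', (∀ i < n, ρ i = ρ' i) → (P w s ρ → P w s ρ')) :
    CDef fun w s (_ : ℕ → V.Const) => ∃ ρ : ℕ → V.Const, (∀ i, ρ i ∈ Dom V w) ∧ P w s ρ := by
  refine (h.exists_extend n).congr fun w s ρ _ hρ => ⟨?_, ?_⟩
  · rintro ⟨θ, h1, hP⟩
    refine ⟨fun i => if i < n then θ i else ρ (i - n), fun i => ?_, fun i => ?_,
      hn w s θ _ (fun i hi => by simp [hi]) hP⟩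
    · dsimp only; split_ifs
      · exact h1 i
      · exact hρ _
    · simp
  · rintro ⟨θ, h1, -, hP⟩
    exact ⟨θ, h1, hP⟩

theorem forall_assignment (h : CDef P) (n : ℕ)
    (hn : ∀ w s ρ ρ', (∀ i < n, ρ i = ρ' i) → (P w s ρ → P w s ρ')) :
    CDef fun w s (_ : ℕ → V.Const) => ∀ ρ : ℕ → V.Const, (∀ i, ρ i ∈ Dom V w) → P w s ρ :=
  (exists_assignment h.not n fun w s ρ ρ' he hP hP' =>
    hP (hn w s ρ' ρ (fun i hi => (he i hi).symm) hP')).not.congr fun _ _ _ _ _ => by push Not; rfl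

theorem pos {P : List Sym → ℕ → Prop} (h : FO fun w v => P w (v 0)) :
    CDef fun w s (_ : ℕ → V.Const) => P w s :=
  ⟨_, h, fun _ _ _ _ _ _ => Iff.rfl⟩

theorem exists_lt_pos (h : CDef P) : CDef fun w s ρ => ∃ i < s, P w i ρ := by
  obtain ⟨F, hF, h⟩ := h
  have h1 : FO fun w v => F w (fun k => v (push 0 (fun k => k + 2) k)) := hF.rename _
  refine ⟨_, FO.ex (P := fun w v i => i < v 0 ∧ F w (push i fun k => v (k + 1)))
    ((FO.lt 0 1).and (h1.congr fun w v _ => ?_)), fun w s v ρ hs hv => ?_⟩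
  · have : (fun k => v (push 0 (fun k => k + 2) k)) = push (v 0) fun k => v (k + 1 + 1) := by
      funext k
      cases k <;> rfl
    rw [this]
  · constructor
    · rintro ⟨i, hi, his, hF⟩
      exact ⟨i, his, (h w i v ρ hi hv).1 hF⟩
    · rintro ⟨i, his, hP⟩
      exact ⟨i, his.le.trans hs, his, (h w i v ρ (his.le.trans hs) hv).2 hP⟩

theorem exists_pos (h : CDef P) : CDef fun w _ ρ => ∃ i ≤ w.length, P w i ρ := by
  obtain ⟨F, hF, h⟩ := h
  have h1 : FO fun w v => F w (fun k => v (push 0 (fun k => k + 2) k)) := hF.rename _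
  refine ⟨_, FO.ex (P := fun w v i => F w (push i fun k => v (k + 1)))
    (h1.congr fun w v _ => ?_), fun w s v ρ hs hv => ?_⟩
  · have : (fun k => v (push 0 (fun k => k + 2) k)) = push (v 0) fun k => v (k + 1 + 1) := by
      funext k
      cases k <;> rfl
    rw [this]
  · exact exists_congr fun i => and_congr_right fun hi => h w i v ρ hi hv

theorem forall_pos (h : CDef P) : CDef fun w _ ρ => ∀ i ≤ w.length, P w i ρ :=
  h.not.exists_pos.not.congr fun _ _ _ _ _ => by push Not; rfl

/-- A definable property of words is first-order, together with the existence of constants. -/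
theorem fo {P : List Sym → Prop} (h : CDef fun w _ (_ : ℕ → V.Const) => P w) :
    FO fun w _ => (Dom V w).Nonempty ∧ P w := by
  obtain ⟨F, hF, h⟩ := h
  have h1 : FO fun w v => F w (fun k => v ((fun _ => 0) k)) := hF.rename _
  refine (FO.ex (P := fun w _ i => (∃ c : V.Const, CAt w i c) ∧ F w fun _ => i)
    ((fo_exists_cAt (V := V) (Tm.var 0)).and h1)).congr fun w v _ => ?_
  have key : ∀ i (c : V.Const), i ≤ w.length → CAt w i c → (F w (fun _ => i) ↔ P w) := by
    intro i c hi hc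
    refine Iff.trans ?_ (h w i (fun _ => i) (fun _ => c) hi fun _ => hc)
    have : (fun _ => i) = push i fun _ => i := by funext k; cases k <;> rfl
    rw [← this]
  constructor
  · rintro ⟨⟨c, i, hc⟩, hP⟩
    exact ⟨i, hc.lt.le, ⟨c, hc⟩, (key i c hc.lt.le hc).2 hP⟩
  · rintro ⟨i, hi, ⟨c, hc⟩, hi'⟩
    exact ⟨⟨c, i, hc⟩, (key i c hi hc).1 hi'⟩

variable [Encodable V.Pred]

theorem occ (a : Atom V (Term V)) : CDef fun w s ρ => Occ w s (a.map (Term.subst ρ)) := by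
  refine ⟨fun w v => w[v 0]? = some Sym.atom ∧
    (∀ k < (encodeSymbol a.pred).length, w[v 0 + 1 + k]? = (encodeSymbol a.pred)[k]?) ∧
    ArgsMatch w (fun k => v (k + 1)) (v 0 + 1 + (encodeSymbol a.pred).length) (List.ofFn a.args),
    (FO.letter (· = some Sym.atom) (Tm.var 0)).and
      ((fo_startsWith _ ((Tm.var 0).add (Tm.const 1))).and
      (fo_argsMatch _ _ (((Tm.var 0).add (Tm.const 1)).add (Tm.const _)))),
    fun w s v ρ hs hv => ?_⟩
  change _ ↔ Occ w s _
  rw [occ_iff]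
  refine and_congr_right fun _ => and_congr_right fun _ => ?_
  have : (fun k => push s v (k + 1)) = v := rfl
  rw [this, argsMatch_iff hv, List.map_ofFn]
  rfl

theorem occ_before (k : ℕ) (a : Atom V (Term V)) :
    CDef fun w s ρ => ∃ i < s, InBlock w k i ∧ Occ w i (a.map (Term.subst ρ)) :=
  ((pos (fo_inBlock k 0)).and (occ a)).exists_lt_pos

theorem mem_block (k : ℕ) (a : Atom V (Term V)) :
    CDef fun w _ ρ => a.map (Term.subst ρ) ∈ block V k w :=
  ((pos (fo_inBlock k 0)).and (occ a)).exists_pos.congr fun _ _ _ _ _ =>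
    ⟨fun ⟨i, h, h'⟩ => ⟨i, h'.lt.le, h, h'⟩, fun ⟨i, _, h⟩ => ⟨i, h⟩⟩

end CDef

end Abduction

/-! ### Stable models of stratified programs -/

namespace Abduction

variable {V : Vocabulary}

/-- `I` contains the facts `S` and is a model of the reduct with respect to `M` of the grounding of
`R` over the set `D` of constants. -/
def ReductOn (D : Set V.Const) (R : Set (Rule V)) (S M I : Set (GroundAtom V)) : Prop :=
  S ⊆ I ∧ ∀ r ∈ R, ∀ θ : ℕ → V.Const, (∀ i, θ i ∈ D) →
    (∀ a ∈ r.neg, a.map (Term.subst θ) ∉ M) →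
    (∀ a ∈ r.pos, a.map (Term.subst θ) ∈ I) → r.head.map (Term.subst θ) ∈ I

/-- `M` is a stable model of the facts `S` and the grounding of `R` over `D`. -/
def StableOn (D : Set V.Const) (R : Set (Rule V)) (S M : Set (GroundAtom V)) : Prop :=
  IsLeast {I | ReductOn D R S M I} M

theorem isReductModel_union_facts [Nonempty V.Const] (R : Set (Rule V))
    (S M I : Set (GroundAtom V)) :
    IsReductModel (R ∪ facts S) M I ↔ ReductOn Set.univ R S M I := by
  constructor
  · intro h
    obtain ⟨c⟩ := ‹Nonempty V.Const›
    exact ⟨fun a ha => h _ (Or.inr ⟨a, ha, rfl⟩) (fun _ => c) (by simp [GroundAtom.fact])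
      (by simp [GroundAtom.fact]), fun r hr θ _ => h r (Or.inl hr) θ⟩
  · rintro ⟨h1, h2⟩ r (hr | ⟨a, ha, rfl⟩) θ
    · exact h2 r hr θ fun _ => trivial
    · exact fun _ _ => h1 ha

theorem isStableModel_union_facts [Nonempty V.Const] (R : Set (Rule V))
    (S M : Set (GroundAtom V)) :
    IsStableModel (R ∪ facts S) M ↔ StableOn Set.univ R S M := by
  simp only [IsStableModel, StableOn, isReductModel_union_facts]

/-- The least model of the reduct. -/
def leastModel (D : Set V.Const) (R : Set (Rule V)) (S M : Set (GroundAtom V)) :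
    Set (GroundAtom V) := {a | ∀ I, ReductOn D R S M I → a ∈ I}

theorem isLeast_leastModel (D : Set V.Const) (R : Set (Rule V)) (S M : Set (GroundAtom V)) :
    IsLeast {I | ReductOn D R S M I} (leastModel D R S M) :=
  ⟨⟨fun _ ha _ hI => hI.1 ha, fun r hr θ hθ hneg hpos I hI =>
    hI.2 r hr θ hθ hneg fun a ha => hpos a ha I hI⟩, fun I hI _ ha => ha I hI⟩

theorem stableOn_iff {D : Set V.Const} {R : Set (Rule V)} {S M : Set (GroundAtom V)} :
    StableOn D R S M ↔ leastModel D R S M = M :=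
  ⟨fun h => (isLeast_leastModel D R S M).unique h, fun h => by
    have := isLeast_leastModel D R S M
    rwa [h] at this⟩

/-- In a stratified program, the least model of the reduct with respect to `X` depends, up to a
level, only on the part of `X` below that level. -/
theorem leastModel_subset_of_agree {D : Set V.Const} {R : Set (Rule V)} {S X Y : Set (GroundAtom V)}
    {level : V.Pred → ℕ} (hl : ∀ r ∈ R, (∀ a ∈ r.pos, level a.pred ≤ level r.head.pred) ∧
      (∀ a ∈ r.neg, level a.pred < level r.head.pred)) {n : ℕ}
    (h : ∀ a : GroundAtom V, level a.pred < n → (a ∈ X ↔ a ∈ Y)) {a : GroundAtom V}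
    (ha : level a.pred ≤ n) (haX : a ∈ leastModel D R S X) : a ∈ leastModel D R S Y := by
  refine (haX {a | a ∈ leastModel D R S X ∧ (level a.pred ≤ n → a ∈ leastModel D R S Y)}
    ⟨fun _ ha => ⟨(isLeast_leastModel D R S X).1.1 ha,
      fun _ => (isLeast_leastModel D R S Y).1.1 ha⟩, ?_⟩).2 ha
  intro r hr θ hθ hneg hpos
  refine ⟨(isLeast_leastModel D R S X).1.2 r hr θ hθ hneg fun a ha => (hpos a ha).1, fun hn => ?_⟩
  refine (isLeast_leastModel D R S Y).1.2 r hr θ hθ (fun a ha hY => hneg a ha ?_)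
    fun a ha => (hpos a ha).2 (((hl r hr).1 a ha).trans hn)
  exact (h _ (((hl r hr).2 a ha).trans_le hn)).2 hY

theorem leastModel_agree {D : Set V.Const} {R : Set (Rule V)} {S X Y : Set (GroundAtom V)}
    {level : V.Pred → ℕ} (hl : ∀ r ∈ R, (∀ a ∈ r.pos, level a.pred ≤ level r.head.pred) ∧
      (∀ a ∈ r.neg, level a.pred < level r.head.pred)) {n : ℕ}
    (h : ∀ a : GroundAtom V, level a.pred < n → (a ∈ X ↔ a ∈ Y)) (a : GroundAtom V)
    (ha : level a.pred < n + 1) : a ∈ leastModel D R S X ↔ a ∈ leastModel D R S Y :=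
  ⟨leastModel_subset_of_agree hl h (Nat.lt_succ_iff.1 ha),
    leastModel_subset_of_agree hl (fun a ha => (h a ha).symm) (Nat.lt_succ_iff.1 ha)⟩

theorem stableOn_unique {D : Set V.Const} {R : Set (Rule V)} (hR : Stratified R)
    {S M M' : Set (GroundAtom V)} (h : StableOn D R S M) (h' : StableOn D R S M') : M = M' := by
  obtain ⟨level, hl⟩ := hR
  have key : ∀ n, ∀ a : GroundAtom V, level a.pred < n → (a ∈ M ↔ a ∈ M') := by
    intro n
    induction n with
    | zero => exact fun a ha => absurd ha (Nat.not_lt_zero _)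
    | succ n ih =>
      rw [stableOn_iff] at h h'
      rw [← h, ← h']
      exact leastModel_agree hl ih
  ext a
  exact key _ a (Nat.lt_succ_self _)

theorem exists_stableOn (D : Set V.Const) {R : Set (Rule V)} (hR : Stratified R)
    (S : Set (GroundAtom V)) : ∃ M, StableOn D R S M := by
  obtain ⟨level, hl⟩ := hR
  let Z : ℕ → Set (GroundAtom V) := fun n => (leastModel D R S)^[n] ∅
  have hZ : ∀ n, Z (n + 1) = leastModel D R S (Z n) := fun n =>
    Function.iterate_succ_apply' _ _ _
  have step : ∀ n, ∀ a : GroundAtom V, level a.pred < n → (a ∈ Z n ↔ a ∈ Z (n + 1)) := by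
    intro n
    induction n with
    | zero => exact fun a ha => absurd ha (Nat.not_lt_zero _)
    | succ n ih =>
      rw [hZ n, hZ (n + 1)]
      rw [hZ n] at ih ⊢
      exact leastModel_agree hl ih
  have mono : ∀ k n, ∀ a : GroundAtom V, level a.pred < n → (a ∈ Z n ↔ a ∈ Z (n + k)) := by
    intro k
    induction k with
    | zero => exact fun n a _ => Iff.rfl
    | succ k ih =>
      intro n a ha
      exact (ih n a ha).trans (step (n + k) a (by omega))
  let M : Set (GroundAtom V) := {a | a ∈ Z (level a.pred + 1)}
  have hM : ∀ n, ∀ a : GroundAtom V, level a.pred < n → (a ∈ M ↔ a ∈ Z n) := by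
    intro n a ha
    obtain ⟨k, rfl⟩ := Nat.exists_eq_add_of_lt ha
    have := mono k (level a.pred + 1) a (Nat.lt_succ_self _)
    rw [show level a.pred + k + 1 = level a.pred + 1 + k by omega]
    exact this
  refine ⟨M, stableOn_iff.2 ?_⟩
  ext a
  rw [leastModel_agree hl (hM (level a.pred)) a (Nat.lt_succ_self _), ← hZ]
  rfl

/-! ### Symmetry -/

/-- The atoms that are mapped into `M` by the renaming `g` of constants. -/
def comapAtoms (g : V.Const → V.Const) (M : Set (GroundAtom V)) : Set (GroundAtom V) :=
  {a | a.map g ∈ M}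

/-- The constants of a program. -/
def rulesConsts (R : Set (Rule V)) : Set V.Const := {c | ∃ r ∈ R, c ∈ r.consts}

theorem Term.subst_comp {g : V.Const → V.Const} {t : Term V} (h : ∀ c ∈ t.consts, g c = c)
    (θ : ℕ → V.Const) : g (t.subst θ) = t.subst fun i => g (θ i) := by
  cases t with
  | var i => rfl
  | const c => exact h c rfl

theorem Atom.map_subst_comp {g : V.Const → V.Const} {a : Atom V (Term V)}
    (h : ∀ c ∈ a.consts, g c = c) (θ : ℕ → V.Const) :
    (a.map (Term.subst θ)).map g = a.map (Term.subst fun i => g (θ i)) := by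
  obtain ⟨p, x⟩ := a
  simp only [Atom.map, Atom.mk.injEq, heq_eq_eq, true_and]
  funext k
  exact Term.subst_comp (fun c hc => h c ⟨k, hc⟩) θ

theorem head_consts_subset {R : Set (Rule V)} {r : Rule V} (hr : r ∈ R) :
    r.head.consts ⊆ rulesConsts R := fun _ hc => ⟨r, hr, Or.inl hc⟩

theorem pos_consts_subset {R : Set (Rule V)} {r : Rule V} (hr : r ∈ R) {a : Atom V (Term V)}
    (ha : a ∈ r.pos) : a.consts ⊆ rulesConsts R :=
  fun _ hc => ⟨r, hr, Or.inr ⟨a, List.mem_append_left _ ha, hc⟩⟩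

theorem neg_consts_subset {R : Set (Rule V)} {r : Rule V} (hr : r ∈ R) {a : Atom V (Term V)}
    (ha : a ∈ r.neg) : a.consts ⊆ rulesConsts R :=
  fun _ hc => ⟨r, hr, Or.inr ⟨a, List.mem_append_right _ ha, hc⟩⟩

theorem ReductOn.comap {R : Set (Rule V)} {S M I : Set (GroundAtom V)} {g : V.Const → V.Const}
    (hg : ∀ c ∈ rulesConsts R, g c = c) (h : ReductOn Set.univ R S M I) :
    ReductOn Set.univ R (comapAtoms g S) (comapAtoms g M) (comapAtoms g I) := by
  refine ⟨fun a ha => h.1 ha, fun r hr θ _ hneg hpos => ?_⟩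
  simp only [comapAtoms, Set.mem_ofPred_eq] at hneg hpos ⊢
  rw [Atom.map_subst_comp fun c hc => hg c (head_consts_subset hr hc)]
  refine h.2 r hr _ (fun _ => trivial) (fun a ha => ?_) fun a ha => ?_
  · rw [← Atom.map_subst_comp fun c hc => hg c (neg_consts_subset hr ha hc)]
    exact hneg a ha
  · rw [← Atom.map_subst_comp fun c hc => hg c (pos_consts_subset hr ha hc)]
    exact hpos a ha

theorem comapAtoms_symm (g : Equiv.Perm V.Const) (M : Set (GroundAtom V)) :
    comapAtoms g.symm (comapAtoms g M) = M := by
  ext a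
  simp [comapAtoms, Atom.map]

theorem StableOn.comap {R : Set (Rule V)} {S M : Set (GroundAtom V)} {g : Equiv.Perm V.Const}
    (hg : ∀ c ∈ rulesConsts R, g c = c) (h : StableOn Set.univ R S M) :
    StableOn Set.univ R (comapAtoms g S) (comapAtoms g M) := by
  refine ⟨h.1.comap hg, fun I hI a ha => ?_⟩
  have hg' : ∀ c ∈ rulesConsts R, g.symm c = c := fun c hc => by
    rw [Equiv.symm_apply_eq, hg c hc]
  have h1 := ReductOn.comap (g := g.symm) hg' hI
  rw [comapAtoms_symm, comapAtoms_symm] at h1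
  have h2 := h.2 h1 ha
  simpa [comapAtoms, Atom.map] using h2

theorem StableOn.comap_eq {R : Set (Rule V)} (hR : Stratified R) {S M : Set (GroundAtom V)}
    {g : Equiv.Perm V.Const} (hg : ∀ c ∈ rulesConsts R, g c = c)
    (hS : ∀ c ∈ constsOf S, g c = c) (h : StableOn Set.univ R S M) : comapAtoms g M = M := by
  have h1 := h.comap hg
  have h2 : comapAtoms g S = S := by
    have fix : ∀ a ∈ S, a.map g = a := fun a ha => by
      obtain ⟨p, x⟩ := a
      simp only [Atom.map, Atom.mk.injEq, heq_eq_eq, true_and]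
      exact funext fun k => hS _ ⟨_, ha, k, rfl⟩
    ext a
    constructor
    · intro ha
      have h3 := fix _ ha
      have h4 : a.map g = a := by
        have := congrArg (fun b => Atom.map g.symm b) h3
        simp only [Atom.map, Equiv.symm_apply_apply] at this
        exact this
      rw [← h4]; exact ha
    · intro ha
      simp only [comapAtoms, Set.mem_ofPred_eq, fix a ha, ha]
  rw [h2] at h1
  exact stableOn_unique hR h1 h

/-! ### Restriction to finitely many constants -/

/-- The ground atoms all of whose arguments are in `D`. -/
def overD (D : Set V.Const) : Set (GroundAtom V) := {a | ∀ k, a.args k ∈ D}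

/-- The variables of the atom are smaller than `K`. -/
def Atom.VarsLt (a : Atom V (Term V)) (K : ℕ) : Prop := ∀ k i, a.args k = .var i → i < K

/-- The variables of the rule are smaller than `K`. -/
def Rule.VarsLt (r : Rule V) (K : ℕ) : Prop :=
  r.head.VarsLt K ∧ (∀ a ∈ r.pos, a.VarsLt K) ∧ ∀ a ∈ r.neg, a.VarsLt K

theorem Atom.VarsLt.mono {a : Atom V (Term V)} {m n : ℕ} (h : a.VarsLt m) (hmn : m ≤ n) :
    a.VarsLt n := fun k i hi => (h k i hi).trans_le hmn

theorem Rule.VarsLt.mono {r : Rule V} {m n : ℕ} (h : r.VarsLt m) (hmn : m ≤ n) : r.VarsLt n :=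
  ⟨h.1.mono hmn, fun a ha => (h.2.1 a ha).mono hmn, fun a ha => (h.2.2 a ha).mono hmn⟩

theorem Atom.map_subst_congr {a : Atom V (Term V)} {K : ℕ} (h : a.VarsLt K) {θ θ' : ℕ → V.Const}
    (he : ∀ i < K, θ i = θ' i) : a.map (Term.subst θ) = a.map (Term.subst θ') := by
  obtain ⟨p, x⟩ := a
  simp only [Atom.map, Atom.mk.injEq, heq_eq_eq, true_and]
  funext k
  cases hx : x k with
  | var i => exact he i (h k i hx)
  | const c => rfl

/-- If there are `K` constants in `D` beyond those in `Act`, then `K` constants can be renamed to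
constants in `D` without moving `Act` or those that are already in `D`. -/
theorem exists_perm_into {Act D : Set V.Const} {K : ℕ} (hAct : Act ⊆ D) (T : Finset V.Const)
    (hT : ∀ c ∈ T, c ∈ D ∧ c ∉ Act) (hK : K ≤ T.card) (θ : ℕ → V.Const) :
    ∃ g : Equiv.Perm V.Const, (∀ c ∈ Act, g c = c) ∧ (∀ i < K, g (θ i) ∈ D) ∧
      ∀ i < K, θ i ∈ D → g (θ i) = θ i := by
  classical
  have key : ∀ m ≤ K, ∃ g : Equiv.Perm V.Const, (∀ c ∈ Act, g c = c) ∧ (∀ i < m, g (θ i) ∈ D) ∧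
      ∀ i < K, θ i ∈ D → g (θ i) = θ i := by
    intro m
    induction m with
    | zero => exact fun _ => ⟨1, fun _ _ => rfl, fun i hi => absurd hi (by omega), fun _ _ _ => rfl⟩
    | succ m ih =>
      intro hm
      obtain ⟨g, h1, h2, h3⟩ := ih (by omega)
      by_cases hD : g (θ m) ∈ D
      · refine ⟨g, h1, fun i hi => ?_, h3⟩
        rcases Nat.lt_succ_iff_lt_or_eq.1 hi with hi | rfl
        · exact h2 i hi
        · exact hD
      -- One of the `K` values is outside `D`, hence some element of `T` is not a value.
      obtain ⟨d, hdT, hd⟩ : ∃ d ∈ T, d ∉ ((Finset.range K).erase m).image fun i => g (θ i) := by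
        refine Finset.exists_mem_notMem_of_card_lt_card (lt_of_lt_of_le ?_ hK)
        refine Finset.card_image_le.trans_lt ?_
        rw [Finset.card_erase_of_mem (by simpa using hm), Finset.card_range]
        omega
      have hd' : ∀ i < K, g (θ i) ≠ d := by
        intro i hi h
        by_cases him : i = m
        · subst him; rw [h] at hD; exact hD (hT d hdT).1
        · exact hd (Finset.mem_image.2 ⟨i, by simp [him, hi], h⟩)
      refine ⟨g.trans (Equiv.swap (g (θ m)) d), fun c hc => ?_, fun i hi => ?_, fun i hi hi' => ?_⟩
      · rw [Equiv.trans_apply, h1 c hc]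
        refine Equiv.swap_apply_of_ne_of_ne ?_ ?_
        · rintro rfl; exact hD (hAct hc)
        · rintro rfl; exact (hT _ hdT).2 hc
      · rw [Equiv.trans_apply]
        by_cases him : g (θ i) = g (θ m)
        · rw [him, Equiv.swap_apply_left]; exact (hT d hdT).1
        · rw [Equiv.swap_apply_of_ne_of_ne him (hd' i (by omega))]
          refine h2 i ?_
          rcases Nat.lt_succ_iff_lt_or_eq.1 hi with hi | rfl
          · exact hi
          · exact absurd rfl him
      · rw [Equiv.trans_apply, Equiv.swap_apply_of_ne_of_ne ?_ (hd' i hi), h3 i hi hi']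
        intro h
        rw [h3 i hi hi'] at h
        exact hD (h ▸ hi')
  exact key K le_rfl

theorem Atom.map_subst_mem_overD {D : Set V.Const} {a : Atom V (Term V)} {K : ℕ} (h : a.VarsLt K)
    (hc : a.consts ⊆ D) {θ : ℕ → V.Const} (hθ : ∀ i < K, θ i ∈ D) :
    a.map (Term.subst θ) ∈ overD D := by
  intro k
  change (a.args k).subst θ ∈ D
  cases hx : a.args k with
  | var i => exact hθ i (h k i hx)
  | const c => exact hc ⟨k, by rw [hx]; rfl⟩

theorem Atom.map_eq_of_overD {g : V.Const → V.Const} {a : GroundAtom V} {D : Set V.Const}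
    (ha : a ∈ overD D) (hg : ∀ c ∈ D, g c = c) : a.map g = a := by
  obtain ⟨p, x⟩ := a
  simp only [Atom.map, Atom.mk.injEq, heq_eq_eq, true_and]
  exact funext fun k => hg _ (ha k)

/-- The stable model over all constants, restricted to a set of constants that contains those of
the program and the facts and sufficiently many others, is the stable model over that set: the
instances of the rules can be renamed to instances over that set. -/
theorem StableOn.restrict {R : Set (Rule V)} (hR : Stratified R) {S M : Set (GroundAtom V)}
    {Act D : Set V.Const} {K : ℕ} (hK0 : 0 < K) (hRK : ∀ r ∈ R, r.VarsLt K) (hAct : Act ⊆ D)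
    (T : Finset V.Const) (hT : ∀ c ∈ T, c ∈ D ∧ c ∉ Act) (hK : K ≤ T.card)
    (hRA : rulesConsts R ⊆ Act) (hSA : constsOf S ⊆ Act) (h : StableOn Set.univ R S M) :
    StableOn D R S (M ∩ overD D) := by
  have inv : ∀ g : Equiv.Perm V.Const, (∀ c ∈ Act, g c = c) → ∀ a : GroundAtom V,
      a.map g ∈ M ↔ a ∈ M := fun g hg a => by
    have := h.comap_eq hR (fun c hc => hg c (hRA hc)) (fun c hc => hg c (hSA hc))
    exact Set.ext_iff.1 this a
  obtain ⟨d₀, hd₀⟩ : ∃ d, d ∈ T := Finset.card_pos.1 (by omega)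
  refine ⟨⟨fun a ha => ⟨h.1.1 ha, fun k => hAct (hSA ⟨a, ha, k, rfl⟩)⟩, ?_⟩, ?_⟩
  · intro r hr θ hθ hneg hpos
    have hover : ∀ a : Atom V (Term V), a.VarsLt K → a.consts ⊆ rulesConsts R →
        a.map (Term.subst θ) ∈ overD D := fun a ha hc =>
      a.map_subst_mem_overD ha (hc.trans (hRA.trans hAct)) fun i _ => hθ i
    refine ⟨h.1.2 r hr θ (fun _ => trivial) (fun a ha hM => hneg a ha ⟨hM, ?_⟩)
      fun a ha => (hpos a ha).1, hover _ (hRK r hr).1 (head_consts_subset hr)⟩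
    exact hover a ((hRK r hr).2.2 a ha) (neg_consts_subset hr ha)
  · intro I hI
    have hmain : ReductOn Set.univ R S M {a | ∀ g : Equiv.Perm V.Const, (∀ c ∈ Act, g c = c) →
        a.map g ∈ overD D → a.map g ∈ I} := by
      constructor
      · intro a ha g hg _
        have : a.map g = a := Atom.map_eq_of_overD (D := Act) (fun k => hSA ⟨a, ha, k, rfl⟩) hg
        rw [this]; exact hI.1 ha
      · intro r hr θ _ hneg hpos g hg hgD
        obtain ⟨g', h1, h2, h3⟩ := exists_perm_into hAct T hT hK fun i => g (θ i)
        classical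
        let θ' : ℕ → V.Const := fun i => if i < K then g' (g (θ i)) else d₀
        have hθ' : ∀ i, θ' i ∈ D := fun i => by
          dsimp only [θ']
          split_ifs with hi
          · exact h2 i hi
          · exact (hT d₀ hd₀).1
        have hgg : ∀ c ∈ Act, (g.trans g') c = c := fun c hc => by
          rw [Equiv.trans_apply, hg c hc, h1 c hc]
        have hmap : ∀ a : Atom V (Term V), a.VarsLt K → a.consts ⊆ rulesConsts R →
            a.map (Term.subst θ') = (a.map (Term.subst θ)).map (g.trans g') := by
          intro a ha hc
          rw [Atom.map_subst_comp fun c hc' => hgg c (hRA (hc hc'))]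
          exact Atom.map_subst_congr ha fun i hi => by simp [θ', hi]
        have hhead : (r.head.map (Term.subst θ)).map g = r.head.map (Term.subst θ') := by
          rw [Atom.map_subst_comp fun c hc => hg c (hRA (head_consts_subset hr hc))] at hgD ⊢
          obtain ⟨⟨p, x⟩, pos, neg⟩ := r
          simp only [Atom.map, Atom.mk.injEq, heq_eq_eq, true_and]
          funext k
          have hk := hgD k
          simp only [Atom.map] at hk
          cases hx : x k with
          | var i =>
            have hi : i < K := (hRK _ hr).1 k i hx
            rw [hx] at hk
            simp only [Term.subst, θ', hi, if_true]
            exact (h3 i hi hk).symm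
          | const c => rfl
        rw [hhead]
        refine hI.2 r hr θ' hθ' (fun a ha hM => hneg a ha ?_) fun a ha => ?_
        · have := hM.1
          rw [hmap a ((hRK r hr).2.2 a ha) (neg_consts_subset hr ha)] at this
          exact (inv _ hgg _).1 this
        · have e := hmap a ((hRK r hr).2.1 a ha) (pos_consts_subset hr ha)
          rw [e]
          refine hpos a ha (g.trans g') hgg ?_
          rw [← e]
          exact Atom.map_subst_mem_overD (K := K) ((hRK r hr).2.1 a ha)
            ((pos_consts_subset hr ha).trans (hRA.trans hAct)) fun i _ => hθ' i
    rintro a ⟨haM, haD⟩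
    have := h.2 hmain haM 1 (fun _ _ => rfl)
    exact this haD

theorem exists_varsLt {R : Set (Rule V)} (hR : R.Finite) : ∃ K, ∀ r ∈ R, r.VarsLt K := by
  have atom : ∀ a : Atom V (Term V), ∃ K, a.VarsLt K := by
    intro a
    refine ⟨Finset.univ.sup fun k => match a.args k with | .var i => i + 1 | .const _ => 0,
      fun k i hi => ?_⟩
    have := Finset.le_sup (f := fun k => match a.args k with | .var i => i + 1 | .const _ => 0)
      (Finset.mem_univ k)
    simp only [hi] at this
    exact this
  have list : ∀ l : List (Atom V (Term V)), ∃ K, ∀ a ∈ l, a.VarsLt K := by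
    intro l
    induction l with
    | nil => exact ⟨0, by simp⟩
    | cons a l ih =>
      obtain ⟨K, hK⟩ := ih
      obtain ⟨K', hK'⟩ := atom a
      refine ⟨max K K', fun b hb => ?_⟩
      rcases List.mem_cons.1 hb with rfl | hb
      · exact hK'.mono (le_max_right _ _)
      · exact (hK b hb).mono (le_max_left _ _)
  have rule : ∀ r : Rule V, ∃ K, r.VarsLt K := by
    intro r
    obtain ⟨k1, h1⟩ := atom r.head
    obtain ⟨k2, h2⟩ := list r.pos
    obtain ⟨k3, h3⟩ := list r.neg
    exact ⟨k1 + k2 + k3, h1.mono (by omega),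
      fun a ha => (h2 a ha).mono (by omega), fun a ha => (h3 a ha).mono (by omega)⟩
  choose f hf using rule
  obtain ⟨K, hK⟩ := (hR.image f).bddAbove
  refine ⟨K, fun r hr => ?_⟩
  have hle : f r ≤ K := hK ⟨r, hr, rfl⟩
  exact (hf r).mono hle

end Abduction

/-! ### Integrity constraints over finitely many constants -/

namespace Abduction

open FirstOrder FirstOrder.Language

variable {V : Vocabulary}

/-- The value of a term of the first-order language. -/
def foValue {n : ℕ} (xs : Fin n → V.Const) : V.lang.Term (Empty ⊕ Fin n) → V.Const
  | .var (Sum.inl e) => e.elim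
  | .var (Sum.inr i) => xs i
  | .func (l := 0) c _ => c
  | .func (l := _ + 1) f _ => Empty.elim f

/-- The truth of a formula in the set `M` of ground atoms, with quantifiers over `D`. -/
def TrueOn (D : Set V.Const) (M : Set (GroundAtom V)) :
    {n : ℕ} → V.lang.BoundedFormula Empty n → (Fin n → V.Const) → Prop
  | _, .falsum, _ => False
  | _, .equal t s, xs => foValue xs t = foValue xs s
  | _, .rel R ts, xs => (⟨R.1, fun i => foValue xs (ts (Fin.cast R.2 i))⟩ : GroundAtom V) ∈ M
  | _, .imp φ ψ, xs => TrueOn D M φ xs → TrueOn D M ψ xs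
  | _, .all φ, xs => ∀ c ∈ D, TrueOn D M φ (Fin.snoc xs c)

theorem realize_term_eq (M : Set (GroundAtom V)) {n : ℕ} (xs : Fin n → V.Const)
    (v : Empty → V.Const) (t : V.lang.Term (Empty ⊕ Fin n)) :
    @Term.realize V.lang V.Const (herbrand M) _ (Sum.elim v xs) t = foValue xs t := by
  match t with
  | .var (Sum.inl e) => exact e.elim
  | .var (Sum.inr i) => rfl
  | .func (l := 0) c _ => rfl
  | .func (l := _ + 1) f _ => exact Empty.elim f

theorem realize_iff_trueOn (M : Set (GroundAtom V)) {n : ℕ} (φ : V.lang.BoundedFormula Empty n)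
    (v : Empty → V.Const) (xs : Fin n → V.Const) :
    @BoundedFormula.Realize V.lang V.Const (herbrand M) _ _ φ v xs ↔ TrueOn Set.univ M φ xs := by
  induction φ with
  | falsum => exact Iff.rfl
  | equal t s => simp only [BoundedFormula.Realize, TrueOn, realize_term_eq]
  | rel R ts => simp only [BoundedFormula.Realize, TrueOn, realize_term_eq]; exact Iff.rfl
  | imp φ ψ ih1 ih2 => simp only [BoundedFormula.Realize, TrueOn, ih1, ih2]
  | all φ ih => simp only [BoundedFormula.Realize, TrueOn, ih, Set.mem_univ, true_imp_iff]

theorem satisfies_iff_trueOn (M : Set (GroundAtom V)) (C : Set V.lang.Sentence) :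
    Satisfies M C ↔ ∀ φ ∈ C, TrueOn Set.univ M φ Fin.elim0 := by
  refine forall₂_congr fun φ _ => ?_
  rw [← Subsingleton.elim (default : Fin 0 → V.Const) Fin.elim0]
  exact realize_iff_trueOn M φ _ _

theorem foValue_comp {n : ℕ} (xs : Fin n → V.Const) {g : V.Const → V.Const}
    (t : V.lang.Term (Empty ⊕ Fin n)) (h : ∀ c ∈ foTermConsts t, g c = c) :
    foValue (fun i => g (xs i)) t = g (foValue xs t) := by
  match t with
  | .var (Sum.inl e) => exact e.elim
  | .var (Sum.inr i) => rfl
  | .func (l := 0) c _ => exact (h c rfl).symm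
  | .func (l := _ + 1) f _ => exact Empty.elim f

theorem foValue_mem {n : ℕ} (xs : Fin n → V.Const) {D : Set V.Const}
    (t : V.lang.Term (Empty ⊕ Fin n)) (h : foTermConsts t ⊆ D) (hx : ∀ i, xs i ∈ D) :
    foValue xs t ∈ D := by
  match t with
  | .var (Sum.inl e) => exact e.elim
  | .var (Sum.inr i) => exact hx i
  | .func (l := 0) c _ => exact h rfl
  | .func (l := _ + 1) f _ => exact Empty.elim f

theorem snoc_comp {n : ℕ} {X Y : Type} (g : X → Y) (xs : Fin n → X) (c : X) :
    (fun i => g ((Fin.snoc xs c : Fin (n + 1) → X) i)) =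
      (Fin.snoc (fun i => g (xs i)) (g c) : Fin (n + 1) → Y) := by
  funext i
  refine Fin.lastCases ?_ (fun i => ?_) i
  · simp
  · simp

theorem trueOn_comp (M : Set (GroundAtom V)) {n : ℕ} (φ : V.lang.BoundedFormula Empty n)
    (g : Equiv.Perm V.Const) (h : ∀ c ∈ foConsts φ, g c = c) (xs : Fin n → V.Const) :
    TrueOn Set.univ M φ (fun i => g (xs i)) ↔ TrueOn Set.univ (comapAtoms g M) φ xs := by
  induction φ with
  | falsum => exact Iff.rfl
  | equal t s =>
    simp only [TrueOn]
    rw [foValue_comp xs t fun c hc => h c (Or.inl hc), foValue_comp xs s fun c hc => h c (Or.inr hc),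
      g.injective.eq_iff]
  | rel R ts =>
    simp only [TrueOn, comapAtoms, Atom.map, Set.mem_ofPred_eq]
    have : ∀ i, foValue (fun i => g (xs i)) (ts (Fin.cast R.2 i)) =
        g (foValue xs (ts (Fin.cast R.2 i))) :=
      fun i => foValue_comp xs _ fun c hc => h c ⟨_, hc⟩
    simp only [this]
  | imp φ ψ ih1 ih2 =>
    simp only [TrueOn, ih1 (fun c hc => h c (Or.inl hc)), ih2 (fun c hc => h c (Or.inr hc))]
  | all φ ih =>
    simp only [TrueOn, Set.mem_univ, true_imp_iff]
    constructor
    · intro h' c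
      rw [← ih h, snoc_comp]
      exact h' (g c)
    · intro h' c
      have := h' (g.symm c)
      rw [← ih h, snoc_comp, Equiv.apply_symm_apply] at this
      exact this

theorem satisfies_comap {M : Set (GroundAtom V)} {C : Set V.lang.Sentence}
    {g : Equiv.Perm V.Const} (h : ∀ φ ∈ C, ∀ c ∈ foConsts φ, g c = c) :
    Satisfies (comapAtoms g M) C ↔ Satisfies M C := by
  rw [satisfies_iff_trueOn, satisfies_iff_trueOn]
  refine forall₂_congr fun φ hφ => ?_
  rw [← trueOn_comp M φ g (h φ hφ)]
  rw [Subsingleton.elim (fun i => g (Fin.elim0 i)) Fin.elim0]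

/-- The nesting depth of quantifiers. -/
def foDepth : {n : ℕ} → V.lang.BoundedFormula Empty n → ℕ
  | _, .falsum => 0
  | _, .equal _ _ => 0
  | _, .rel _ _ => 0
  | _, .imp φ ψ => max (foDepth φ) (foDepth ψ)
  | _, .all φ => foDepth φ + 1

/-- If `M` is invariant under the renamings that fix `Act`, then quantifiers may be restricted to
a set that contains `Act` and sufficiently many other constants. -/
theorem trueOn_restrict {M : Set (GroundAtom V)} {Act D : Set V.Const} (hAct : Act ⊆ D)
    (hM : ∀ g : Equiv.Perm V.Const, (∀ c ∈ Act, g c = c) → comapAtoms g M = M)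
    (T : Finset V.Const) (hT : ∀ c ∈ T, c ∈ D ∧ c ∉ Act) {n : ℕ}
    (φ : V.lang.BoundedFormula Empty n) (hφ : foConsts φ ⊆ Act) (hn : n + foDepth φ ≤ T.card)
    (xs : Fin n → V.Const) (hx : ∀ i, xs i ∈ D) :
    TrueOn Set.univ M φ xs ↔ TrueOn D (M ∩ overD D) φ xs := by
  classical
  induction φ with
  | falsum => exact Iff.rfl
  | equal t s => exact Iff.rfl
  | rel R ts =>
    refine ⟨fun h => ⟨h, fun i => ?_⟩, fun h => h.1⟩
    exact foValue_mem xs _ (fun c hc => hAct (hφ ⟨_, hc⟩)) hx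
  | imp φ ψ ih1 ih2 =>
    simp only [foDepth] at hn
    exact imp_congr (ih1 (fun c hc => hφ (Or.inl hc)) (by omega) xs hx)
      (ih2 (fun c hc => hφ (Or.inr hc)) (by omega) xs hx)
  | @all n φ ih =>
    simp only [foDepth] at hn
    have ih' : ∀ c ∈ D, TrueOn Set.univ M φ (Fin.snoc xs c) ↔
        TrueOn D (M ∩ overD D) φ (Fin.snoc xs c) := fun c hc =>
      ih hφ (by omega) _ fun i => by
        refine Fin.lastCases ?_ (fun i => ?_) i
        · simpa using hc
        · simpa using hx i
    constructor
    · intro h c hc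
      exact (ih' c hc).1 (h c trivial)
    · intro h c _
      by_cases hc : c ∈ D
      · exact (ih' c hc).2 (h c hc)
      -- A constant outside `D` may be swapped with one in `D` that is not yet in use.
      obtain ⟨d, hdT, hd⟩ : ∃ d ∈ T, d ∉ Finset.univ.image xs := by
        refine Finset.exists_mem_notMem_of_card_lt_card (lt_of_le_of_lt Finset.card_image_le ?_)
        rw [Finset.card_univ, Fintype.card_fin]; omega
      have hfix : ∀ e ∈ Act, Equiv.swap c d e = e := fun e he =>
        Equiv.swap_apply_of_ne_of_ne (by rintro rfl; exact hc (hAct he))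
          (by rintro rfl; exact (hT _ hdT).2 he)
      have h1 := (ih' d (hT d hdT).1).2 (h d (hT d hdT).1)
      have h2 : (fun i => Equiv.swap c d ((Fin.snoc xs c : Fin (n + 1) → V.Const) i)) =
          (Fin.snoc xs d : Fin (n + 1) → V.Const) := by
        rw [snoc_comp, Equiv.swap_apply_left]
        congr 1
        funext i
        refine Equiv.swap_apply_of_ne_of_ne ?_ ?_
        · intro he; exact hc (he ▸ hx i)
        · intro he; exact hd (Finset.mem_image.2 ⟨i, Finset.mem_univ _, he⟩)
      rw [← h2, trueOn_comp M φ _ fun e he => hfix e (hφ he), hM _ hfix] at h1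
      exact h1

theorem finite_foConsts {α : Type} {n : ℕ} (φ : V.lang.BoundedFormula α n) :
    (foConsts φ).Finite := by
  have ht : ∀ {β : Type} (t : V.lang.Term β), (foTermConsts t).Finite := by
    intro β t
    match t with
    | .var _ => exact Set.finite_empty
    | .func (l := 0) c _ => exact Set.finite_singleton c
    | .func (l := _ + 1) f _ => exact Empty.elim f
  induction φ with
  | falsum => exact Set.finite_empty
  | equal t s => exact (ht t).union (ht s)
  | rel R ts =>
    have : foConsts (.rel R ts : V.lang.BoundedFormula α _) = ⋃ i, foTermConsts (ts i) := by
      ext c; simp [foConsts]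
    rw [this]
    exact Set.finite_iUnion fun i => ht _
  | imp φ ψ ih1 ih2 => exact ih1.union ih2
  | all φ ih => exact ih

/-! ### Definability of integrity constraints -/

/-- The term of a rule that corresponds to a term of the first-order language, with the last of
the bound variables as variable `0`. -/
def ruleTerm {n : ℕ} : V.lang.Term (Empty ⊕ Fin n) → Term V
  | .var (Sum.inl e) => e.elim
  | .var (Sum.inr i) => .var (n - 1 - i)
  | .func (l := 0) c _ => .const c
  | .func (l := _ + 1) f _ => Empty.elim f

theorem subst_ruleTerm {n : ℕ} (ρ : ℕ → V.Const) (t : V.lang.Term (Empty ⊕ Fin n)) :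
    (ruleTerm t).subst ρ = foValue (fun i => ρ (n - 1 - i)) t := by
  match t with
  | .var (Sum.inl e) => exact e.elim
  | .var (Sum.inr i) => rfl
  | .func (l := 0) c _ => rfl
  | .func (l := _ + 1) f _ => exact Empty.elim f

namespace CDef

variable [Denumerable V.Const]

theorem subst_eq (t s : Term V) : CDef fun _ _ ρ => t.subst ρ = s.subst ρ := by
  match t, s with
  | .var i, .var j => exact eq_var i j
  | .var i, .const c => exact eq_const i c
  | .const c, .var i => exact (eq_const i c).congr fun _ _ ρ _ _ => eq_comm
  | .const c, .const d => exact CDef.const (c = d)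

variable [Encodable V.Pred]

theorem trueOn (k : ℕ) {n : ℕ} (φ : V.lang.BoundedFormula Empty n) :
    CDef fun w _ ρ => TrueOn (Dom V w) (block V k w) φ fun i => ρ (n - 1 - i) := by
  induction φ with
  | falsum => exact CDef.const False
  | equal t s =>
    exact (subst_eq (ruleTerm t) (ruleTerm s)).congr fun w _ ρ _ _ => by
      rw [subst_ruleTerm, subst_ruleTerm]; rfl
  | rel R ts =>
    refine (mem_block k ⟨R.1, fun i => ruleTerm (ts (Fin.cast R.2 i))⟩).congr
      fun w _ ρ _ _ => ?_
    simp only [Atom.map, subst_ruleTerm]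
    exact Iff.rfl
  | imp φ ψ ih1 ih2 => exact ih1.imp ih2
  | @all n φ ih =>
    refine CDef.all (P := fun w _ ρ c => TrueOn (Dom V w) (block V k w) φ
      (Fin.snoc (fun i => ρ (n - 1 - i)) c)) (ih.congr fun w _ ρ _ _ => ?_)
    have : (Fin.snoc (fun i : Fin n => ρ (n - 1 - i + 1)) (ρ 0) : Fin (n + 1) → V.Const) =
        fun i : Fin (n + 1) => ρ (n + 1 - 1 - i) := by
      funext i
      refine Fin.lastCases ?_ (fun i => ?_) i
      · simp
      · simp only [Fin.snoc_castSucc, Fin.val_castSucc]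
        congr 1
        omega
    rw [this]

theorem satisfies (k : ℕ) (φ : V.lang.Sentence) :
    CDef fun w _ (_ : ℕ → V.Const) => TrueOn (Dom V w) (block V k w) φ Fin.elim0 :=
  (trueOn k φ).congr fun w _ ρ _ _ => by
    rw [Subsingleton.elim (fun i : Fin 0 => ρ (0 - 1 - i)) Fin.elim0]

end CDef

end Abduction

/-! ### Explanations for stratified programs -/

namespace Abduction

variable {V : Vocabulary}

/-- The unique stable model of `R` with the facts `S` satisfies `C` and `O`. -/
def Supports (R : Set (Rule V)) (C : Set V.lang.Sentence) (O S : Set (GroundAtom V)) : Prop :=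
  ∃ M, StableOn Set.univ R S M ∧ Satisfies M C ∧ O ⊆ M

/-- For stratified programs, all kinds of agreement coincide. -/
theorem agrees_iff [Nonempty V.Const] {R : Set (Rule V)} (hR : Stratified R)
    (C : Set V.lang.Sentence) (O S : Set (GroundAtom V)) (τ : AgreementKind) :
    Agrees (R ∪ facts S) C O τ ↔ Supports R C O S := by
  obtain ⟨M, hM⟩ := exists_stableOn Set.univ hR S
  have hex : ∀ Q : Set (GroundAtom V) → Prop,
      (∃ M, IsStableModel (R ∪ facts S) M ∧ Q M) ↔ Q M := fun Q => by
    simp only [isStableModel_union_facts]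
    exact ⟨fun ⟨M', h, hQ⟩ => stableOn_unique hR h hM ▸ hQ, fun h => ⟨M, hM, h⟩⟩
  have hall : ∀ Q : Set (GroundAtom V) → Prop,
      (∀ M, IsStableModel (R ∪ facts S) M → Q M) ↔ Q M := fun Q => by
    simp only [isStableModel_union_facts]
    exact ⟨fun h => h M hM, fun hQ M' h => stableOn_unique hR h hM ▸ hQ⟩
  have hcons : Consistent (R ∪ facts S) := ⟨M, (isStableModel_union_facts R S M).2 hM⟩
  have hS : Supports R C O S ↔ Satisfies M C ∧ O ⊆ M :=
    ⟨fun ⟨M', h, hQ⟩ => stableOn_unique hR h hM ▸ hQ, fun h => ⟨M, hM, h⟩⟩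
  have hall' : ∀ Q Q' : Set (GroundAtom V) → Prop,
      (∀ M, IsStableModel (R ∪ facts S) M → Q M → Q' M) ↔ (Q M → Q' M) :=
    fun Q Q' => hall fun M => Q M → Q' M
  rw [hS]
  cases τ with
  | typeA => simp only [Agrees, Entails, hcons, hall, true_and]
  | typeB => simp only [Agrees, Entails, hcons, hall, hex, true_and]; exact and_comm
  | typeC => simp only [Agrees, hall', hex]; tauto
  | typeD => simp only [Agrees, hex]

theorem fact_injective : Function.Injective (GroundAtom.fact : GroundAtom V → Rule V) := by
  rintro ⟨p, x⟩ ⟨q, y⟩ h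
  simp only [GroundAtom.fact, Atom.map, Rule.mk.injEq, Atom.mk.injEq, and_true] at h
  obtain ⟨rfl, h⟩ := h
  rw [heq_eq_eq] at h
  congr 1
  funext k
  have := congrFun h k
  injection this

theorem mem_facts {S : Set (GroundAtom V)} {a : GroundAtom V} :
    GroundAtom.fact a ∈ facts S ↔ a ∈ S := fact_injective.mem_set_image

/-- Removing the facts `F` does not affect the rules of `R`, as their heads are not abducible. -/
theorem prog_update_eq {A : Set V.Pred} {R : Set (Rule V)} (hheads : ∀ r ∈ R, r.head.pred ∉ A)
    {B E F : Set (GroundAtom V)} (hF : F ⊆ groundAtoms A) :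
    ((R ∪ facts B) ∪ facts E) \ facts F = R ∪ facts ((B ∪ E) \ F) := by
  ext r
  constructor
  · rintro ⟨(hr | ⟨a, ha, rfl⟩) | ⟨a, ha, rfl⟩, hF'⟩
    · exact Or.inl hr
    · exact Or.inr (mem_facts.2 ⟨Or.inl ha, fun h => hF' (mem_facts.2 h)⟩)
    · exact Or.inr (mem_facts.2 ⟨Or.inr ha, fun h => hF' (mem_facts.2 h)⟩)
  · rintro (hr | ⟨a, ⟨ha, haF⟩, rfl⟩)
    · refine ⟨Or.inl (Or.inl hr), ?_⟩
      rintro ⟨a, ha, rfl⟩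
      exact hheads _ hr (hF ha)
    · refine ⟨?_, fun h => haF (mem_facts.1 h)⟩
      rcases ha with ha | ha
      · exact Or.inl (Or.inr (mem_facts.2 ha))
      · exact Or.inr (mem_facts.2 ha)

/-- The conditions on explanations, in terms of the sets `B`, `O`, `E` and `F`. -/
structure Explains (A : Set V.Pred) (R : Set (Rule V)) (C : Set V.lang.Sentence)
    (B O E F : Set (GroundAtom V)) : Prop where
  finE : E.Finite
  finF : F.Finite
  subE : E ⊆ groundAtoms A
  subF : F ⊆ groundAtoms A
  disj : Disjoint E F
  subB : F ⊆ B
  supports : Supports R C O ((B ∪ E) \ F)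

section

variable [Nonempty V.Const] {A : Set V.Pred} {R : Set (Rule V)} {C : Set V.lang.Sentence}
  {B O : Set (GroundAtom V)}

theorem isExplanation_iff (hR : Stratified R) (hheads : ∀ r ∈ R, r.head.pred ∉ A)
    {T : AbductiveTheory V} (hT : IsTheory T A R C B) (τ : AgreementKind)
    (E F : Set (GroundAtom V)) : IsExplanation τ T O E F ↔ Explains A R C B O E F := by
  obtain ⟨-, h2, h3, h4⟩ := hT
  have hsub : F ⊆ groundAtoms A → (facts F ⊆ R ∪ facts B ↔ F ⊆ B) := by
    intro hF
    constructor
    · intro h a ha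
      rcases h (mem_facts.2 ha) with h | h
      · exact absurd (hF ha) (hheads _ h)
      · exact mem_facts.1 h
    · rintro h _ ⟨a, ha, rfl⟩
      exact Or.inr (mem_facts.2 (h ha))
  simp only [IsExplanation, h2, h3, h4]
  constructor
  · rintro ⟨h1, h2, h3, h4, h5, h6, h7⟩
    rw [prog_update_eq hheads h4, agrees_iff hR] at h7
    exact ⟨h1, h2, h3, h4, h5, (hsub h4).1 h6, h7⟩
  · rintro ⟨h1, h2, h3, h4, h5, h6, h7⟩
    rw [prog_update_eq hheads h4, agrees_iff hR]
    exact ⟨h1, h2, h3, h4, h5, (hsub h4).2 h6, h7⟩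

end

/-- The constants of a program and of integrity constraints. -/
def baseConsts (R : Set (Rule V)) (C : Set V.lang.Sentence) : Set V.Const :=
  rulesConsts R ∪ {c | ∃ φ ∈ C, c ∈ foConsts φ}

theorem theory_consts_eq {A : Set V.Pred} {R : Set (Rule V)} {C : Set V.lang.Sentence}
    {B : Set (GroundAtom V)} {T : AbductiveTheory V} (hT : IsTheory T A R C B) :
    T.consts = baseConsts R C ∪ constsOf B := by
  obtain ⟨-, h2, h3, h4⟩ := hT
  have hfact : ∀ (a : GroundAtom V) (c : V.Const), c ∈ (GroundAtom.fact a).consts ↔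
      ∃ k, a.args k = c := by
    intro a c
    simp only [GroundAtom.fact, Rule.consts, List.nil_append, List.not_mem_nil, false_and,
      exists_false, Set.mem_union, Set.mem_ofPred_eq, or_false, Atom.consts, Atom.map, Term.consts,
      Set.mem_singleton_iff, eq_comm]
  ext c
  simp only [AbductiveTheory.consts, baseConsts, rulesConsts, h2, h4, Set.mem_union,
    Set.mem_ofPred_eq, constsOf]
  constructor
  · rintro (⟨r, hr | ⟨a, ha, rfl⟩, hc⟩ | h)
    · exact Or.inl (Or.inl ⟨r, hr, hc⟩)
    · exact Or.inr ⟨a, ha, (hfact a c).1 hc⟩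
    · exact Or.inl (Or.inr h)
  · rintro ((⟨r, hr, hc⟩ | h) | ⟨a, ha, hc⟩)
    · exact Or.inl ⟨r, Or.inl hr, hc⟩
    · exact Or.inr h
    · exact Or.inl ⟨_, Or.inr ⟨a, ha, rfl⟩, (hfact a c).2 hc⟩

/-- The constants of the input and of the fixed program and constraints. -/
def usedConsts (R : Set (Rule V)) (C : Set V.lang.Sentence) (B O : Set (GroundAtom V)) :
    Set V.Const := baseConsts R C ∪ (constsOf B ∪ constsOf O)

theorem isFresh_iff {A : Set V.Pred} {R : Set (Rule V)} {C : Set V.lang.Sentence}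
    {B : Set (GroundAtom V)} {T : AbductiveTheory V} (hT : IsTheory T A R C B)
    (O E : Set (GroundAtom V)) (ξ : V.Const) :
    IsFresh T O E ξ ↔ ξ ∉ usedConsts R C B O ∧ ξ ∉ constsOf E := by
  rw [IsFresh, theory_consts_eq hT]
  simp only [usedConsts, Set.mem_union]
  tauto

/-- A single replacement function is a family of pairwise independent ones, so the degree is zero
only if no replacement function gives an explanation. -/
theorem degree_eq_zero_iff (τ : AgreementKind) (T : AbductiveTheory V)
    (O E F : Set (GroundAtom V)) (ξ : V.Const) :
    degree τ T O E F ξ = 0 ↔ ∀ f : Replacement E, ¬ IsExplanation τ T O (f.apply ξ) F := by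
  have h0 : (0 : ℕ∞) = ⊥ := rfl
  rw [degree, h0, sSup_eq_bot]
  constructor
  · intro h f hf
    have := h 1 ⟨{f}, by simp, by simpa using hf, by simp⟩
    exact absurd this (by simp)
  · rintro h n ⟨S, -, hS, rfl⟩
    rcases S.eq_empty_or_nonempty with rfl | ⟨f, hf⟩
    · simp
    · exact absurd (hS f hf) (h f)

theorem isConstrainedExplanation_iff [Nonempty V.Const] {A : Set V.Pred} {R : Set (Rule V)}
    {C : Set V.lang.Sentence} {B O : Set (GroundAtom V)} (hR : Stratified R)
    (hheads : ∀ r ∈ R, r.head.pred ∉ A) {T : AbductiveTheory V} (hT : IsTheory T A R C B)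
    (τ : AgreementKind) (E F : Set (GroundAtom V)) :
    IsConstrainedExplanation τ T O E F ↔ Explains A R C B O E F ∧
      ∀ ξ, ξ ∉ usedConsts R C B O → ξ ∉ constsOf E →
        ∀ f : Replacement E, ¬ Explains A R C B O (f.apply ξ) F := by
  simp only [IsConstrainedExplanation, isExplanation_iff hR hheads hT, isFresh_iff hT,
    degree_eq_zero_iff, and_imp]

theorem map_eq_self_of_consts {S : Set (GroundAtom V)} {g : V.Const → V.Const}
    (hg : ∀ c ∈ constsOf S, g c = c) {a : GroundAtom V} (ha : a ∈ S) : a.map g = a :=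
  Atom.map_eq_of_overD (D := constsOf S) (fun k => ⟨a, ha, k, rfl⟩) hg

theorem comapAtoms_eq_self {S : Set (GroundAtom V)} {g : Equiv.Perm V.Const}
    (hg : ∀ c ∈ constsOf S, g c = c) : comapAtoms g S = S := by
  ext a
  constructor
  · intro ha
    have h := congrArg (Atom.map g.symm) (map_eq_self_of_consts hg ha)
    simp only [Atom.map, Equiv.symm_apply_apply] at h
    have h' : a.map g = a := h
    rw [← h']; exact ha
  · intro ha
    change a.map g ∈ S
    rwa [map_eq_self_of_consts hg ha]

/-- Support is invariant under renamings of constants that fix the program, the constraints and the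
observation. -/
theorem Supports.comap {R : Set (Rule V)} {C : Set V.lang.Sentence} {O S : Set (GroundAtom V)}
    (h : Supports R C O S) {g : Equiv.Perm V.Const} (hg : ∀ c ∈ baseConsts R C, g c = c)
    (hO : ∀ c ∈ constsOf O, g c = c) : Supports R C O (comapAtoms g S) := by
  obtain ⟨M, h1, h2, h3⟩ := h
  refine ⟨comapAtoms g M, h1.comap fun c hc => hg c (Or.inl hc),
    (satisfies_comap fun φ hφ c hc => hg c (Or.inr ⟨φ, hφ, hc⟩)).2 h2, fun a ha => ?_⟩
  change a.map g ∈ M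
  rw [map_eq_self_of_consts hO ha]
  exact h3 ha

theorem finite_comapAtoms {S : Set (GroundAtom V)} (h : S.Finite) (g : Equiv.Perm V.Const) :
    (comapAtoms g S).Finite := by
  refine h.preimage fun a _ b _ hab => ?_
  have h (a : GroundAtom V) : (a.map g).map g.symm = a := by
    simp only [Atom.map, Equiv.symm_apply_apply]
  rw [← h a, ← h b, show a.map g = b.map g from hab]

/-- Renaming the constants of `E`, except those of the input and of the fixed program and
constraints, preserves explanations. -/
theorem Explains.comap {A : Set V.Pred} {R : Set (Rule V)} {C : Set V.lang.Sentence}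
    {B O E F : Set (GroundAtom V)} (h : Explains A R C B O E F) {g : Equiv.Perm V.Const}
    (hg : ∀ c ∈ usedConsts R C B O, g c = c) : Explains A R C B O (comapAtoms g E) F := by
  have hB : comapAtoms g B = B := comapAtoms_eq_self fun c hc => hg c (Or.inr (Or.inl hc))
  have hF : comapAtoms g F = F := comapAtoms_eq_self fun c ⟨a, ha, hc⟩ =>
    hg c (Or.inr (Or.inl ⟨a, h.subB ha, hc⟩))
  refine ⟨finite_comapAtoms h.finE g, h.finF, fun a ha => h.subE (a := a.map g) ha, h.subF, ?_,
    h.subB, ?_⟩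
  · rw [← hF]
    exact h.disj.preimage _
  · have := h.supports.comap (g := g) (fun c hc => hg c (Or.inl hc))
      fun c hc => hg c (Or.inr (Or.inr hc))
    have e : comapAtoms g ((B ∪ E) \ F) = (comapAtoms g B ∪ comapAtoms g E) \ comapAtoms g F := rfl
    rwa [e, hB, hF] at this

theorem finite_constsOf {S : Set (GroundAtom V)} (h : S.Finite) : (constsOf S).Finite := by
  have : constsOf S = ⋃ a ∈ S, Set.range a.args := by
    ext c; simp [constsOf]
  rw [this]
  exact h.biUnion fun a _ => Set.finite_range _

theorem finite_baseConsts {R : Set (Rule V)} (hR : R.Finite) {C : Set V.lang.Sentence}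
    (hC : C.Finite) : (baseConsts R C).Finite := by
  have ht : ∀ t : Term V, t.consts.Finite := fun t => by
    cases t with
    | var i => exact Set.finite_empty
    | const c => exact Set.finite_singleton c
  have ha : ∀ a : Atom V (Term V), a.consts.Finite := fun a => by
    have : a.consts = ⋃ k, (a.args k).consts := by ext c; simp [Atom.consts]
    rw [this]
    exact Set.finite_iUnion fun k => ht _
  have hr : ∀ r : Rule V, r.consts.Finite := fun r => by
    refine (ha _).union ?_
    have : {c | ∃ a ∈ r.pos ++ r.neg, c ∈ a.consts} = ⋃ a ∈ {a | a ∈ r.pos ++ r.neg}, a.consts := by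
      ext c; simp
    rw [this]
    exact (List.finite_toSet _).biUnion fun a _ => ha a
  refine Set.Finite.union ?_ ?_
  · have : rulesConsts R = ⋃ r ∈ R, r.consts := by ext c; simp [rulesConsts]
    rw [this]
    exact hR.biUnion fun r _ => hr r
  · have : {c | ∃ φ ∈ C, c ∈ foConsts φ} = ⋃ φ ∈ C, foConsts φ := by ext c; simp
    rw [this]
    exact hC.biUnion fun φ _ => finite_foConsts φ

/-! ### Replacement functions -/

open Classical in
/-- The map that replaces `ξ` by `c`. -/
noncomputable def unreplace (ξ c x : V.Const) : V.Const := if x = ξ then c else x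

/-- `E'` is obtained from `E` by replacing some occurrences of `c` by a constant `ξ` that does not
occur in `E`: replacing `ξ` by `c` gives a bijection from `E'` to `E`. -/
structure IsReplaced (E E' : Set (GroundAtom V)) (ξ c : V.Const) : Prop where
  maps : ∀ a ∈ E', a.map (unreplace ξ c) ∈ E
  surj : ∀ a ∈ E, ∃ b ∈ E', b.map (unreplace ξ c) = a
  inj : ∀ d ∈ E, ∀ a ∈ E', ∀ b ∈ E', a.map (unreplace ξ c) = d → b.map (unreplace ξ c) = d → a = b
  mem : ∃ a ∈ E', ∃ k, a.args k = ξ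

/-- The values of replacement functions at `ξ` are the sets described by `IsReplaced`; this and
`IsReplaced.exists_replacement` replace quantification over sets of occurrences by quantification
over sets of atoms. -/
theorem Replacement.isReplaced {E : Set (GroundAtom V)} {ξ : V.Const} (hξ : ξ ∉ constsOf E)
    (f : Replacement E) : IsReplaced E (f.apply ξ) ξ f.c := by
  classical
  have key : ∀ a ∈ E, Atom.map (unreplace ξ f.c)
      (⟨a.pred, fun k => if ⟨a, k⟩ ∈ f.occs then ξ else a.args k⟩ : GroundAtom V) = a := by
    intro a ha
    obtain ⟨p, x⟩ := a
    simp only [Atom.map, Atom.mk.injEq, heq_eq_eq, true_and]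
    funext k
    split_ifs with h
    · simp only [unreplace, if_true]
      exact (f.eq _ h).symm
    · have : x k ≠ ξ := fun h' => hξ ⟨_, ha, k, h'⟩
      simp [unreplace, this]
  refine ⟨?_, ?_, ?_, ?_⟩
  · rintro _ ⟨a, ha, rfl⟩
    have := key a ha
    convert ha
  · intro a ha
    exact ⟨_, ⟨a, ha, rfl⟩, by convert key a ha⟩
  · rintro d hd _ ⟨a, ha, rfl⟩ _ ⟨b, hb, rfl⟩ h1 h2
    have h1' : a = d := (key a ha).symm.trans (by convert h1)
    have h2' : b = d := (key b hb).symm.trans (by convert h2)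
    rw [h1', h2']
  · obtain ⟨o, ho⟩ := f.nonempty
    refine ⟨_, ⟨o.atom, f.mem o ho, rfl⟩, o.pos, ?_⟩
    exact if_pos ho

theorem IsReplaced.exists_replacement {E E' : Set (GroundAtom V)} {ξ c : V.Const}
    (h : IsReplaced E E' ξ c) : ∃ f : Replacement E, f.apply ξ = E' := by
  classical
  let f : Replacement E :=
    { c := c
      occs := {o | ∃ a ∈ E', ∃ k : Fin (V.arity a.pred),
        (⟨a.map (unreplace ξ c), k⟩ : Occurrence V) = o ∧ a.args k = ξ}
      nonempty := by
        obtain ⟨a, ha, k, hk⟩ := h.mem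
        exact ⟨_, a, ha, k, rfl, hk⟩
      mem := by
        rintro _ ⟨a, ha, k, rfl, hk⟩
        exact h.maps a ha
      eq := by
        rintro _ ⟨a, ha, k, rfl, hk⟩
        simp [Atom.map, unreplace, hk] }
  have key : ∀ b ∈ E', (⟨(b.map (unreplace ξ c)).pred, fun k =>
      if ⟨b.map (unreplace ξ c), k⟩ ∈ f.occs then ξ else (b.map (unreplace ξ c)).args k⟩ :
      GroundAtom V) = b := by
    intro b hb
    have hocc : ∀ k, (⟨b.map (unreplace ξ c), k⟩ : Occurrence V) ∈ f.occs ↔ b.args k = ξ := by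
      intro k
      constructor
      · rintro ⟨a, ha, k', he, hk⟩
        have h1 : a.map (unreplace ξ c) = b.map (unreplace ξ c) := congrArg Occurrence.atom he
        obtain rfl := h.inj _ (h.maps b hb) a ha b hb h1 rfl
        injection he with _ he
        rw [← he]; exact hk
      · intro hk
        exact ⟨b, hb, k, rfl, hk⟩
    obtain ⟨p, x⟩ := b
    refine congrArg (Atom.mk p) (funext fun k => (if_congr (hocc k) rfl rfl).trans ?_)
    simp only [Atom.map]
    by_cases hk : x k = ξ
    · simp [hk]
    · simp [hk, unreplace]
  refine ⟨f, Set.Subset.antisymm ?_ ?_⟩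
  · rintro _ ⟨a, ha, rfl⟩
    obtain ⟨b, hb, rfl⟩ := h.surj a ha
    have := key b hb
    convert hb
  · intro b hb
    exact ⟨_, h.maps b hb, by convert key b hb⟩

open Classical in
/-- The choice of the fresh constant is immaterial. -/
theorem IsReplaced.comap {E E' : Set (GroundAtom V)} {ξ ξ' c : V.Const}
    (h : IsReplaced E E' ξ c) (hξ : ξ ∉ constsOf E) (hξ' : ξ' ∉ constsOf E) :
    ∃ f : Replacement E, f.apply ξ' = comapAtoms (Equiv.swap ξ ξ') E' := by
  obtain ⟨f, rfl⟩ := h.exists_replacement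
  refine ⟨f, ?_⟩
  have key : ∀ a ∈ E, Atom.map (Equiv.swap ξ ξ')
      (⟨a.pred, fun k => if ⟨a, k⟩ ∈ f.occs then ξ' else a.args k⟩ : GroundAtom V) =
      ⟨a.pred, fun k => if ⟨a, k⟩ ∈ f.occs then ξ else a.args k⟩ := by
    intro a ha
    simp only [Atom.map, Atom.mk.injEq, heq_eq_eq, true_and]
    funext k
    split_ifs with hk
    · simp
    · exact Equiv.swap_apply_of_ne_of_ne (fun h => hξ ⟨a, ha, k, h⟩) fun h => hξ' ⟨a, ha, k, h⟩
  ext b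
  constructor
  · rintro ⟨a, ha, rfl⟩
    exact ⟨a, ha, by convert (key a ha).symm⟩
  · rintro ⟨a, ha, hab⟩
    refine ⟨a, ha, ?_⟩
    have h1 := congrArg (Atom.map (Equiv.swap ξ ξ')) (key a ha)
    have h2 := congrArg (Atom.map (Equiv.swap ξ ξ')) hab
    simp only [Atom.map, Equiv.swap_apply_self] at h1 h2
    have h3 : b = _ := h2.symm.trans (by convert h1.symm)
    rw [h3]

open Classical in
/-- Renaming `c` to the fresh constant `ξ` replaces all occurrences of `c`. -/
theorem isReplaced_comapAtoms_swap {E : Set (GroundAtom V)} {ξ c : V.Const}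
    (hξ : ξ ∉ constsOf E) (hc : c ∈ constsOf E) :
    IsReplaced E (comapAtoms (Equiv.swap c ξ) E) ξ c := by
  have hmap : ∀ a ∈ comapAtoms (Equiv.swap c ξ) E,
      a.map (unreplace ξ c) = a.map (Equiv.swap c ξ) := by
    intro a ha
    refine congrArg (Atom.mk a.pred) (funext fun k => ?_)
    have h1 : a.args k ≠ c := by
      intro h
      exact hξ ⟨_, ha, k, by simp [Atom.map, h]⟩
    by_cases h2 : a.args k = ξ
    · simp [unreplace, h2]
    · simp [unreplace, h2, Equiv.swap_apply_of_ne_of_ne h1 h2]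
  have hinv : ∀ a : GroundAtom V, (a.map (Equiv.swap c ξ)).map (Equiv.swap c ξ) = a := fun a => by
    simp only [Atom.map, Equiv.swap_apply_self]
  have hmem : ∀ a ∈ E, a.map (Equiv.swap c ξ) ∈ comapAtoms (Equiv.swap c ξ) E := fun a ha => by
    change (a.map (Equiv.swap c ξ)).map (Equiv.swap c ξ) ∈ E
    rwa [hinv]
  refine ⟨fun a ha => ?_, fun a ha => ?_, fun d _ a ha b hb h1 h2 => ?_, ?_⟩
  · rw [hmap a ha]
    exact ha
  · exact ⟨_, hmem a ha, by rw [hmap _ (hmem a ha), hinv]⟩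
  · rw [hmap a ha] at h1
    rw [hmap b hb] at h2
    rw [← hinv a, ← hinv b, h1, h2]
  · obtain ⟨a, ha, k, hk⟩ := hc
    exact ⟨_, hmem a ha, k, by simp [Atom.map, hk]⟩

/-- A constrained explanation does not introduce constants: all occurrences of such a constant
could be replaced by a fresh one. -/
theorem constsOf_subset_usedConsts [Infinite V.Const] {A : Set V.Pred} {R : Set (Rule V)}
    (hR : R.Finite) {C : Set V.lang.Sentence} (hC : C.Finite) {B O E F : Set (GroundAtom V)}
    (hB : B.Finite) (hO : O.Finite) (h : Explains A R C B O E F)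
    (hcon : ∀ ξ, ξ ∉ usedConsts R C B O → ξ ∉ constsOf E →
      ∀ f : Replacement E, ¬ Explains A R C B O (f.apply ξ) F) :
    constsOf E ⊆ usedConsts R C B O := by
  classical
  intro c hc
  by_contra hcu
  obtain ⟨ξ, hξ⟩ := (((finite_baseConsts hR hC).union ((finite_constsOf hB).union
    (finite_constsOf hO))).union (finite_constsOf h.finE)).exists_notMem
  have h1 : ξ ∉ usedConsts R C B O := fun h => hξ (Or.inl h)
  have h2 : ξ ∉ constsOf E := fun h => hξ (Or.inr h)
  obtain ⟨f, hf⟩ := (isReplaced_comapAtoms_swap h2 hc).exists_replacement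
  refine hcon ξ h1 h2 f ?_
  rw [hf]
  refine h.comap fun d hd => Equiv.swap_apply_of_ne_of_ne ?_ ?_
  · rintro rfl; exact hcu hd
  · rintro rfl; exact h1 hd

end Abduction

/-! ### Definability of relations between atoms in a word -/

namespace Abduction

open WordLogic

variable {V : Vocabulary} [Denumerable V.Const]

namespace CDef

theorem exists_args (p : V.Pred) {P : List Sym → ℕ → (ℕ → V.Const) → GroundAtom V → Prop}
    (h : CDef fun w s ρ => P w s (fun i => ρ (i + V.arity p)) ⟨p, fun k => ρ k⟩) :
    CDef fun w s ρ => ∃ x : Fin (V.arity p) → V.Const, (∀ k, x k ∈ Dom V w) ∧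
      P w s ρ ⟨p, x⟩ := by
  refine (h.exists_extend (V.arity p)).congr fun w s ρ _ hρ => ⟨?_, ?_⟩
  · rintro ⟨x, hx, hP⟩
    refine ⟨fun i => if hi : i < V.arity p then x ⟨i, hi⟩ else ρ (i - V.arity p),
      fun i => ?_, fun i => by simp, by simpa using hP⟩
    dsimp only; split_ifs
    · exact hx _
    · exact hρ _
  · rintro ⟨θ, h1, h2, hP⟩
    refine ⟨fun k => θ k, fun k => h1 k, ?_⟩
    rwa [funext h2] at hP

/-- Quantification over the atoms with constants in the word and a predicate in a finite set. The
arguments of the atom become the first variables. -/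
theorem exists_atom {Q : Set V.Pred} (hQ : Q.Finite)
    {P : List Sym → ℕ → (ℕ → V.Const) → GroundAtom V → Prop}
    (h : ∀ p ∈ Q, CDef fun w s ρ => P w s (fun i => ρ (i + V.arity p)) ⟨p, fun k => ρ k⟩) :
    CDef fun w s ρ => ∃ a ∈ overD (Dom V w), a.pred ∈ Q ∧ P w s ρ a :=
  (exists_mem hQ fun p hp => exists_args p (h p hp)).congr fun _ _ _ _ _ =>
    ⟨fun ⟨⟨p, x⟩, hx, hp, hP⟩ => ⟨p, hp, x, hx, hP⟩, fun ⟨p, hp, x, hx, hP⟩ => ⟨⟨p, x⟩, hx, hp, hP⟩⟩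

theorem forall_atom {Q : Set V.Pred} (hQ : Q.Finite)
    {P : List Sym → ℕ → (ℕ → V.Const) → GroundAtom V → Prop}
    (h : ∀ p ∈ Q, CDef fun w s ρ => P w s (fun i => ρ (i + V.arity p)) ⟨p, fun k => ρ k⟩) :
    CDef fun w s ρ => ∀ a ∈ overD (Dom V w), a.pred ∈ Q → P w s ρ a :=
  (exists_atom (P := fun w s ρ a => ¬ P w s ρ a) hQ fun p hp => (h p hp).not).not.congr
    fun _ _ _ _ _ => by push Not; rfl

theorem map_unreplace_eq (p q : V.Pred) (f : Fin (V.arity p) → ℕ) (g : Fin (V.arity q) → ℕ)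
    (i j : ℕ) : CDef fun _ _ (ρ : ℕ → V.Const) =>
      (⟨p, fun k => ρ (f k)⟩ : GroundAtom V).map (unreplace (ρ i) (ρ j)) =
        ⟨q, fun k => ρ (g k)⟩ := by
  by_cases hpq : p = q
  · subst hpq
    refine (forall_mem_list (List.finRange (V.arity p)) fun k _ =>
      ((eq_var (f k) i).and (eq_var j (g k))).or
        ((eq_var (f k) i).not.and (eq_var (f k) (g k)))).congr fun w s ρ _ _ => ?_
    simp only [Atom.map, Atom.mk.injEq, heq_eq_eq, true_and, funext_iff, List.mem_finRange,
      true_imp_iff, unreplace]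
    refine forall_congr' fun k => ?_
    split_ifs with h <;> simp [h]
  · exact (const False).congr fun w s ρ _ _ => iff_false_intro fun h => hpq (congrArg Atom.pred h)

theorem atom_eq (p q : V.Pred) (f : Fin (V.arity p) → ℕ) (g : Fin (V.arity q) → ℕ) :
    CDef fun _ _ (ρ : ℕ → V.Const) =>
      (⟨p, fun k => ρ (f k)⟩ : GroundAtom V) = ⟨q, fun k => ρ (g k)⟩ := by
  by_cases hpq : p = q
  · subst hpq
    refine (forall_mem_list (List.finRange (V.arity p)) fun k _ => eq_var (f k) (g k)).congr
      fun _ _ _ _ _ => ?_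
    simp only [Atom.mk.injEq, heq_eq_eq, true_and, funext_iff, List.mem_finRange, true_imp_iff]
  · exact (const False).congr fun w s ρ _ _ => iff_false_intro fun h => hpq (congrArg Atom.pred h)

theorem ne_args {p : V.Pred} (f : Fin (V.arity p) → ℕ) (i : ℕ) :
    CDef fun _ _ (ρ : ℕ → V.Const) => ∀ k, ρ (f k) ≠ ρ i :=
  (forall_mem_list (List.finRange (V.arity p)) fun k _ => (eq_var (f k) i).not).congr
    fun _ _ _ _ _ => by simp

theorem mem_dom (c : V.Const) : CDef fun w _ (_ : ℕ → V.Const) => c ∈ Dom V w :=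
  (ex (P := fun _ _ _ d => d = c) (eq_const 0 c)).congr fun _ _ _ _ _ => by simp

theorem notMem {S : Set V.Const} (hS : S.Finite) (i : ℕ) :
    CDef fun _ _ (ρ : ℕ → V.Const) => ρ i ∉ S :=
  (forall_mem hS fun c _ => (eq_const i c).not).congr fun _ _ _ _ _ =>
    ⟨fun h _ hc he => h (he ▸ hc), fun h hc => h _ hc rfl⟩

theorem forall_lt (n : ℕ) {P : ℕ → List Sym → ℕ → (ℕ → V.Const) → Prop}
    (h : ∀ i, CDef (P i)) : CDef fun w s ρ => ∀ i < n, P i w s ρ :=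
  (forall_mem_list (List.range n) fun i _ => h i).congr fun _ _ _ _ _ => by
    simp only [List.mem_range]

variable [Encodable V.Pred]

theorem mem_block_var (k : ℕ) (p : V.Pred) (f : Fin (V.arity p) → ℕ) :
    CDef fun w _ ρ => (⟨p, fun i => ρ (f i)⟩ : GroundAtom V) ∈ block V k w :=
  mem_block k ⟨p, fun i => .var (f i)⟩

theorem occ_var (p : V.Pred) (f : Fin (V.arity p) → ℕ) :
    CDef fun w s ρ => Occ w s (⟨p, fun i => ρ (f i)⟩ : GroundAtom V) :=
  occ ⟨p, fun i => .var (f i)⟩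

end CDef

variable [Encodable V.Pred]

theorem block_subset_overD (k : ℕ) (w : List Sym) : block V k w ⊆ overD (Dom V w) :=
  fun _ ⟨_, _, h⟩ j => h.args_mem_dom j

/-! ### The conditions on certificates -/

/-- The facts for the candidate `(E', F)`: the sets `B`, `F` and `E'` are the blocks `0`, `3` and
`5` of the word. -/
def baseFacts (A : Set V.Pred) (w : List Sym) : Set (GroundAtom V) :=
  {a | a.pred ∈ A ∧ (a ∈ block V 0 w ∨ a ∈ block V 5 w) ∧ a ∉ block V 3 w}

/-- The atom at position `s` of the word is a fact or follows by a rule from atoms that occur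
earlier in block `4`. -/
def Justified (A : Set V.Pred) (R : Set (Rule V)) (w : List Sym) (s : ℕ) : Prop :=
  (∃ a ∈ overD (Dom V w), a.pred ∈ A ∧ a ∈ baseFacts A w ∧ Occ w s a) ∨
    ∃ r ∈ R, ∃ θ : ℕ → V.Const, (∀ i, θ i ∈ Dom V w) ∧ Occ w s (r.head.map (Term.subst θ)) ∧
      (∀ b ∈ r.pos, ∃ i < s, InBlock w 4 i ∧ Occ w i (b.map (Term.subst θ))) ∧
      ∀ b ∈ r.neg, b.map (Term.subst θ) ∉ block V 4 w

/-- Block `4` of the word is the stable model over the constants of the word, listed in the order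
of a derivation. -/
structure ListsModel (A : Set V.Pred) (R : Set (Rule V)) (w : List Sym) : Prop where
  facts : ∀ a ∈ overD (Dom V w), a.pred ∈ A → a ∈ baseFacts A w → a ∈ block V 4 w
  rules : ∀ r ∈ R, ∀ θ : ℕ → V.Const, (∀ i, θ i ∈ Dom V w) →
    (∀ b ∈ r.neg, b.map (Term.subst θ) ∉ block V 4 w) →
    (∀ b ∈ r.pos, b.map (Term.subst θ) ∈ block V 4 w) → r.head.map (Term.subst θ) ∈ block V 4 w
  justified : ∀ s ≤ w.length, InBlock w 4 s → w[s]? = some Sym.atom → Justified A R w s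

/-- The word contains the constants in `base` and at least `K` others that do not occur in the
facts. -/
def HasFresh (A : Set V.Pred) (base : Set V.Const) (K : ℕ) (w : List Sym) : Prop :=
  (∀ c ∈ base, c ∈ Dom V w) ∧ ∃ θ : ℕ → V.Const, (∀ i, θ i ∈ Dom V w) ∧
    (∀ i < K, ∀ j < K, i ≠ j → θ i ≠ θ j) ∧
    ∀ i < K, θ i ∉ base ∧
      ∀ a ∈ overD (Dom V w), a.pred ∈ A → a ∈ baseFacts A w → ∀ k, a.args k ≠ θ i

/-- The conditions on the blocks `0` to `3` that do not involve stable models, for predicates in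
`A` and `H`. -/
def InputOk (A H : Set V.Pred) (w : List Sym) : Prop :=
  (∀ a ∈ overD (Dom V w), a.pred ∈ H → a ∉ block V 0 w ∧ a ∉ block V 2 w ∧ a ∉ block V 3 w) ∧
    ∀ a ∈ overD (Dom V w), a.pred ∈ A →
      a ∉ block V 1 w ∧ (a ∈ block V 3 w → a ∈ block V 0 w ∧ a ∉ block V 2 w)

/-- The listed model satisfies the constraints and the observation. -/
def ModelOk (A H : Set V.Pred) (C : Set V.lang.Sentence) (w : List Sym) : Prop :=
  (∀ φ ∈ C, TrueOn (Dom V w) (block V 4 w) φ Fin.elim0) ∧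
    ∀ a ∈ overD (Dom V w), a.pred ∈ A ∪ H → a ∈ block V 1 w → a ∈ block V 4 w

/-- Blocks `2` and `5` contain the same abducibles. -/
def SameBlocks (A : Set V.Pred) (w : List Sym) : Prop :=
  ∀ a ∈ overD (Dom V w), a.pred ∈ A → (a ∈ block V 5 w ↔ a ∈ block V 2 w)

/-- The abducibles in block `5` are obtained from those in block `2` by replacing some occurrences
of `c` by `ξ`. -/
def ReplacedBlocks (A : Set V.Pred) (w : List Sym) (ξ c : V.Const) : Prop :=
  ((∀ a ∈ overD (Dom V w), a.pred ∈ A → a ∈ block V 5 w → ∃ b ∈ overD (Dom V w), b.pred ∈ A ∧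
      b ∈ block V 2 w ∧ a.map (unreplace ξ c) = b) ∧
    (∀ b ∈ overD (Dom V w), b.pred ∈ A → b ∈ block V 2 w → ∃ a ∈ overD (Dom V w), a.pred ∈ A ∧
      a ∈ block V 5 w ∧ a.map (unreplace ξ c) = b)) ∧
  (∀ d ∈ overD (Dom V w), d.pred ∈ A → d ∈ block V 2 w →
    ∀ a ∈ overD (Dom V w), a.pred ∈ A → a ∈ block V 5 w →
    ∀ b ∈ overD (Dom V w), b.pred ∈ A → b ∈ block V 5 w →
    a.map (unreplace ξ c) = d → b.map (unreplace ξ c) = d → a = b) ∧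
  ∃ a ∈ overD (Dom V w), a.pred ∈ A ∧ a ∈ block V 5 w ∧ ∃ k, a.args k = ξ

/-- The constant `ξ` is neither in `base` nor in the blocks `0`, `1` and `2`. -/
def FreshIn (A H : Set V.Pred) (base : Set V.Const) (w : List Sym) (ξ : V.Const) : Prop :=
  ξ ∉ base ∧ ∀ a ∈ overD (Dom V w), a.pred ∈ A ∪ H →
    (a ∈ block V 0 w ∨ a ∈ block V 1 w) ∨ a ∈ block V 2 w → ∀ k, a.args k ≠ ξ

/-- The certificate in the blocks `4` and `5` of the word shows that the blocks `0` to `3` are not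
a positive instance: `(E, F)` is no explanation, or there is a replacement function whose value at
a fresh constant gives an explanation. -/
def Refutes (A H : Set V.Pred) (R : Set (Rule V)) (C : Set V.lang.Sentence) (K : ℕ)
    (w : List Sym) : Prop :=
  HasFresh A (baseConsts R C) K w ∧ (¬ InputOk A H w ∨ ListsModel A R w ∧
    (SameBlocks A w ∧ ¬ ModelOk A H C w ∨
      (∃ ξ ∈ Dom V w, ∃ c ∈ Dom V w, FreshIn A H (baseConsts R C) w ξ ∧ ReplacedBlocks A w ξ c) ∧
        ModelOk A H C w))

namespace CDef

variable {A H : Set V.Pred} {R : Set (Rule V)} {C : Set V.lang.Sentence}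

theorem mem_baseFacts {p : V.Pred} (f : Fin (V.arity p) → ℕ) :
    CDef fun w _ ρ => (⟨p, fun i => ρ (f i)⟩ : GroundAtom V) ∈ baseFacts A w :=
  (const (p ∈ A)).and (((mem_block_var 0 p f).or (mem_block_var 5 p f)).and
    (mem_block_var 3 p f).not)

theorem justified (hA : A.Finite) (hR : R.Finite) :
    CDef fun w s (_ : ℕ → V.Const) => Justified A R w s := by
  obtain ⟨K, hK⟩ := exists_varsLt hR
  refine (exists_atom hA fun p _ => (mem_baseFacts _).and (occ_var p _)).or
    (exists_mem hR fun r hr => exists_assignment ((occ r.head).and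
      ((forall_mem_list r.pos fun b _ => occ_before 4 b).and
        (forall_mem_list r.neg fun b _ => (mem_block 4 b).not))) K ?_)
  rintro w s ρ ρ' h ⟨h1, h2, h3⟩
  refine ⟨?_, fun b hb => ?_, fun b hb => ?_⟩
  · rwa [Atom.map_subst_congr (hK r hr).1 h] at h1
  · have := h2 b hb
    rwa [Atom.map_subst_congr ((hK r hr).2.1 b hb) h] at this
  · have := h3 b hb
    rwa [Atom.map_subst_congr ((hK r hr).2.2 b hb) h] at this

theorem listsModel (hA : A.Finite) (hR : R.Finite) :
    CDef fun w _ (_ : ℕ → V.Const) => ListsModel A R w := by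
  obtain ⟨K, hK⟩ := exists_varsLt hR
  have h1 : CDef fun w _ (_ : ℕ → V.Const) =>
      ∀ a ∈ overD (Dom V w), a.pred ∈ A → a ∈ baseFacts A w → a ∈ block V 4 w :=
    forall_atom hA fun p _ => (mem_baseFacts _).imp (mem_block_var 4 p _)
  have h2 : CDef fun w _ (_ : ℕ → V.Const) => ∀ r ∈ R, ∀ θ : ℕ → V.Const,
      (∀ i, θ i ∈ Dom V w) → (∀ b ∈ r.neg, b.map (Term.subst θ) ∉ block V 4 w) →
      (∀ b ∈ r.pos, b.map (Term.subst θ) ∈ block V 4 w) →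
      r.head.map (Term.subst θ) ∈ block V 4 w := by
    refine forall_mem hR fun r hr => forall_assignment
      ((forall_mem_list r.neg fun b _ => (mem_block 4 b).not).imp
      ((forall_mem_list r.pos fun b _ => mem_block 4 b).imp (mem_block 4 r.head))) K ?_
    intro w s ρ ρ' h hP h1 h2
    have := hP (fun b hb => ?_) fun b hb => ?_
    · rwa [Atom.map_subst_congr (hK r hr).1 h] at this
    · rw [Atom.map_subst_congr ((hK r hr).2.2 b hb) h]
      exact h1 b hb
    · rw [Atom.map_subst_congr ((hK r hr).2.1 b hb) h]
      exact h2 b hb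
  have h3 : CDef fun w _ (_ : ℕ → V.Const) =>
      ∀ s ≤ w.length, InBlock w 4 s → w[s]? = some Sym.atom → Justified A R w s :=
    ((pos (fo_inBlock 4 0)).imp ((pos (P := fun w s => w[s]? = some Sym.atom)
      (FO.letter (· = some Sym.atom) (Tm.var 0))).imp (justified hA hR))).forall_pos
  exact (h1.and (h2.and h3)).congr fun _ _ _ _ _ =>
    ⟨fun h => ⟨h.1, h.2, h.3⟩, fun h => ⟨h.1, h.2.1, h.2.2⟩⟩

theorem hasFresh (hA : A.Finite) {base : Set V.Const} (hb : base.Finite) (K : ℕ) :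
    CDef fun w _ (_ : ℕ → V.Const) => HasFresh A base K w := by
  refine (forall_mem hb fun c _ => mem_dom c).and (exists_assignment
    ((forall_lt K fun i => forall_lt K fun j => (const (i ≠ j)).imp (eq_var i j).not).and
      (forall_lt K fun i => (notMem hb i).and
        (forall_atom hA fun p _ => (mem_baseFacts _).imp (ne_args _ _)))) K ?_)
  rintro w s ρ ρ' h ⟨h1, h2⟩
  exact ⟨fun i hi j hj => by rw [← h i hi, ← h j hj]; exact h1 i hi j hj,
    fun i hi => by rw [← h i hi]; exact h2 i hi⟩

theorem inputOk (hA : A.Finite) (hH : H.Finite) :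
    CDef fun w _ (_ : ℕ → V.Const) => InputOk A H w :=
  (forall_atom hH fun p _ => (mem_block_var 0 p _).not.and
    ((mem_block_var 2 p _).not.and (mem_block_var 3 p _).not)).and
    (forall_atom hA fun p _ => (mem_block_var 1 p _).not.and
      ((mem_block_var 3 p _).imp ((mem_block_var 0 p _).and (mem_block_var 2 p _).not)))

theorem modelOk (hA : A.Finite) (hH : H.Finite) (hC : C.Finite) :
    CDef fun w _ (_ : ℕ → V.Const) => ModelOk A H C w :=
  (forall_mem hC fun φ _ => satisfies 4 φ).and
    (forall_atom (hA.union hH) fun p _ => (mem_block_var 1 p _).imp (mem_block_var 4 p _))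

theorem sameBlocks (hA : A.Finite) : CDef fun w _ (_ : ℕ → V.Const) => SameBlocks A w :=
  forall_atom hA fun p _ => (((mem_block_var 5 p _).imp (mem_block_var 2 p _)).and
    ((mem_block_var 2 p _).imp (mem_block_var 5 p _))).congr fun _ _ _ _ _ => iff_def

theorem replacedBlocks (hA : A.Finite) (i j : ℕ) :
    CDef fun w _ (ρ : ℕ → V.Const) => ReplacedBlocks A w (ρ i) (ρ j) := by
  refine ((forall_atom hA fun p _ => (mem_block_var 5 p _).imp
      (exists_atom hA fun q _ => (mem_block_var 2 q _).and (map_unreplace_eq p q _ _ _ _))).and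
    (forall_atom hA fun p _ => (mem_block_var 2 p _).imp
      (exists_atom hA fun q _ => (mem_block_var 5 q _).and (map_unreplace_eq q p _ _ _ _)))).and
    ((forall_atom hA fun d _ => (mem_block_var 2 d _).imp
      (forall_atom hA fun p _ => (mem_block_var 5 p _).imp
        (forall_atom hA fun q _ => (mem_block_var 5 q _).imp
          ((map_unreplace_eq p d _ _ _ _).imp
            ((map_unreplace_eq q d _ _ _ _).imp (atom_eq p q _ _)))))).and
      (exists_atom hA fun p _ => (mem_block_var 5 p _).and
        ((ne_args _ (i + V.arity p)).not.congr fun w s ρ _ _ => by push Not; rfl)))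

theorem freshIn (hA : A.Finite) (hH : H.Finite) {base : Set V.Const} (hb : base.Finite) (i : ℕ) :
    CDef fun w _ (ρ : ℕ → V.Const) => FreshIn A H base w (ρ i) :=
  (notMem hb i).and (forall_atom (hA.union hH) fun p _ =>
    (((mem_block_var 0 p _).or (mem_block_var 1 p _)).or (mem_block_var 2 p _)).imp (ne_args _ _))

theorem refutes (hA : A.Finite) (hH : H.Finite) (hR : R.Finite) (hC : C.Finite) (K : ℕ) :
    CDef fun w _ (_ : ℕ → V.Const) => Refutes A H R C K w :=
  (hasFresh hA (finite_baseConsts hR hC) K).and ((inputOk hA hH).not.or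
    ((listsModel hA hR).and (((sameBlocks hA).and (modelOk hA hH hC).not).or
      ((ex (P := fun w _ _ ξ => ∃ c ∈ Dom V w, FreshIn A H (baseConsts R C) w ξ ∧
          ReplacedBlocks A w ξ c)
        (ex (P := fun w _ ρ c => FreshIn A H (baseConsts R C) w (ρ 0) ∧
          ReplacedBlocks A w (ρ 0) c) ((freshIn hA hH (finite_baseConsts hR hC) 1).and
            (replacedBlocks hA 1 0)))).and (modelOk hA hH hC)))))

end CDef

end Abduction

/-! ### Correctness of the conditions on certificates -/

namespace Abduction

variable {V : Vocabulary}

theorem StableOn.pred_mem [Nonempty V.Const] {A H : Set V.Pred} {R : Set (Rule V)}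
    (hH : ∀ r ∈ R, r.head.pred ∈ H) {S M : Set (GroundAtom V)} (hS : S ⊆ groundAtoms A)
    (h : StableOn Set.univ R S M) : M ⊆ groundAtoms (A ∪ H) :=
  h.2 ⟨fun _ ha => Or.inl (hS ha), fun r hr _ _ _ _ => Or.inr (hH r hr)⟩

variable [Denumerable V.Const] [Encodable V.Pred] {A H : Set V.Pred} {R : Set (Rule V)}
  {C : Set V.lang.Sentence} {w : List Sym}

/-- The derivation order rules out circular justifications: by induction on positions, the listed
atoms belong to every model of the reduct. -/
theorem ListsModel.stableOn (h : ListsModel A R w) :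
    StableOn (Dom V w) R (baseFacts A w) (block V 4 w) := by
  refine ⟨⟨fun a ha => ?_, fun r hr θ hθ => h.rules r hr θ hθ⟩, fun I hI => ?_⟩
  · refine h.facts a ?_ ha.1 ha
    rcases ha.2.1 with h' | h'
    · exact block_subset_overD _ _ h'
    · exact block_subset_overD _ _ h'
  · have key : ∀ s, ∀ a : GroundAtom V, InBlock w 4 s → Occ w s a → a ∈ I := by
      intro s
      induction s using Nat.strong_induction_on with
      | _ s ih =>
        intro a hs ha
        rcases h.justified s ha.lt.le hs ((occ_iff w s a).1 ha).1 with
          ⟨b, -, -, hb, hb'⟩ | ⟨r, hr, θ, hθ, h1, h2, h3⟩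
        · rw [ha.unique hb']; exact hI.1 hb
        · rw [ha.unique h1]
          refine hI.2 r hr θ hθ h3 fun b hb => ?_
          obtain ⟨i, hi, h4, h5⟩ := h2 b hb
          exact ih i hi _ h4 h5
    rintro a ⟨s, hs, ha⟩
    exact key s a hs ha

/-- The constants that witness `HasFresh`. -/
theorem HasFresh.exists_finset {K : ℕ} {base : Set V.Const} (h : HasFresh A base K w) :
    base ∪ constsOf (baseFacts A w) ⊆ Dom V w ∧ ∃ T : Finset V.Const, K ≤ T.card ∧
      ∀ c ∈ T, c ∈ Dom V w ∧ c ∉ base ∪ constsOf (baseFacts A w) := by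
  classical
  have hover : ∀ a ∈ baseFacts A w, a ∈ overD (Dom V w) := fun a ha => by
    rcases ha.2.1 with h' | h'
    · exact block_subset_overD _ _ h'
    · exact block_subset_overD _ _ h'
  obtain ⟨h1, θ, h2, h3, h4⟩ := h
  refine ⟨?_, (Finset.range K).image θ, ?_, fun c hc => ?_⟩
  · rintro c (hc | ⟨a, ha, k, rfl⟩)
    · exact h1 c hc
    · exact hover a ha k
  · rw [Finset.card_image_of_injOn, Finset.card_range]
    intro i hi j hj hij
    by_contra hne
    exact h3 i (by simpa using hi) j (by simpa using hj) hne hij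
  · obtain ⟨i, hi, rfl⟩ := Finset.mem_image.1 hc
    have h5 := h4 i (by simpa using hi)
    refine ⟨h2 i, ?_⟩
    rintro (hb | ⟨a, ha, k, hk⟩)
    · exact h5.1 hb
    · exact h5.2 a (hover a ha) ha.1 ha k hk

section

variable {K : ℕ} (hK0 : 0 < K) (hR : Stratified R) (hRK : ∀ r ∈ R, r.VarsLt K)
  (hCK : ∀ φ ∈ C, foDepth φ ≤ K) (hH : ∀ r ∈ R, r.head.pred ∈ H) (hHA : ∀ p ∈ H, p ∉ A)

include hK0 hR hRK in
theorem ListsModel.block_eq (h : ListsModel A R w) (hf : HasFresh A (baseConsts R C) K w)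
    {M : Set (GroundAtom V)} (hM : StableOn Set.univ R (baseFacts A w) M) :
    block V 4 w = M ∩ overD (Dom V w) := by
  obtain ⟨h1, T, h2, h3⟩ := hf.exists_finset
  exact stableOn_unique hR h.stableOn (hM.restrict hR hK0 hRK h1 T h3 h2
    (fun c hc => Or.inl (Or.inl hc)) fun c hc => Or.inr hc)

include hK0 hR hRK hCK in
/-- The listed model decides whether the facts support the observation. -/
theorem ListsModel.modelOk_iff (h : ListsModel A R w) (hf : HasFresh A (baseConsts R C) K w)
    (hO : block V 1 w ⊆ groundAtoms (A ∪ H)) :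
    ModelOk A H C w ↔ Supports R C (block V 1 w) (baseFacts A w) := by
  obtain ⟨M, hM⟩ := exists_stableOn Set.univ hR (baseFacts A w)
  have hb := h.block_eq hK0 hR hRK hf hM
  obtain ⟨h1, T, h2, h3⟩ := hf.exists_finset
  have hsat : (∀ φ ∈ C, TrueOn (Dom V w) (block V 4 w) φ Fin.elim0) ↔ Satisfies M C := by
    rw [satisfies_iff_trueOn, hb]
    refine forall₂_congr fun φ hφ => (trueOn_restrict h1 (fun g hg => ?_) T h3 φ ?_ ?_ _ ?_).symm
    · exact hM.comap_eq hR (fun c hc => hg c (Or.inl (Or.inl hc))) fun c hc => hg c (Or.inr hc)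
    · exact fun c hc => Or.inl (Or.inr ⟨φ, hφ, hc⟩)
    · have := hCK φ hφ; omega
    · exact fun i => i.elim0
  have hobs : (∀ a ∈ overD (Dom V w), a.pred ∈ A ∪ H → a ∈ block V 1 w → a ∈ block V 4 w) ↔
      block V 1 w ⊆ M := by
    rw [hb]
    constructor
    · exact fun h a ha => (h a (block_subset_overD _ _ ha) (hO ha) ha).1
    · exact fun h a h1 _ ha => ⟨h ha, h1⟩
  rw [ModelOk, hsat, hobs]
  exact ⟨fun h => ⟨M, hM, h⟩, fun ⟨M', hM', h⟩ => stableOn_unique hR hM' hM ▸ h⟩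

/-- The abducibles in block `5`. -/
def candidate (A : Set V.Pred) (w : List Sym) : Set (GroundAtom V) :=
  {a | a.pred ∈ A ∧ a ∈ block V 5 w}

theorem baseFacts_eq (hB : block V 0 w ⊆ groundAtoms A) :
    baseFacts A w = (block V 0 w ∪ candidate A w) \ block V 3 w := by
  ext a
  constructor
  · rintro ⟨h1, h2 | h2, h3⟩
    · exact ⟨Or.inl h2, h3⟩
    · exact ⟨Or.inr ⟨h1, h2⟩, h3⟩
  · rintro ⟨h2 | h2, h3⟩
    · exact ⟨hB h2, Or.inl h2, h3⟩
    · exact ⟨h2.1, Or.inr h2.2, h3⟩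

theorem sameBlocks_iff (hE : block V 2 w ⊆ groundAtoms A) :
    SameBlocks A w ↔ candidate A w = block V 2 w := by
  constructor
  · intro h
    ext a
    exact ⟨fun ha => (h a (block_subset_overD _ _ ha.2) ha.1).1 ha.2,
      fun ha => ⟨hE ha, (h a (block_subset_overD _ _ ha) (hE ha)).2 ha⟩⟩
  · intro h a _ ha
    rw [← h]
    exact ⟨fun h => ⟨ha, h⟩, fun h => h.2⟩

theorem replacedBlocks_iff (hE : block V 2 w ⊆ groundAtoms A) (ξ c : V.Const) :
    ReplacedBlocks A w ξ c ↔ IsReplaced (block V 2 w) (candidate A w) ξ c := by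
  have hc : ∀ a ∈ candidate A w, a ∈ overD (Dom V w) := fun a ha => block_subset_overD _ _ ha.2
  constructor
  · rintro ⟨⟨h1, h2⟩, h3, h4⟩
    refine ⟨fun a ha => ?_, fun b hb => ?_, fun d hd a ha b hb => ?_, ?_⟩
    · obtain ⟨b, -, -, hb, rfl⟩ := h1 a (hc a ha) ha.1 ha.2
      exact hb
    · obtain ⟨a, -, h, h', e⟩ := h2 b (block_subset_overD _ _ hb) (hE hb) hb
      exact ⟨a, ⟨h, h'⟩, e⟩
    · exact h3 d (block_subset_overD _ _ hd) (hE hd) hd a (hc a ha) ha.1 ha.2 b (hc b hb) hb.1 hb.2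
    · obtain ⟨a, -, h, h', e⟩ := h4
      exact ⟨a, ⟨h, h'⟩, e⟩
  · rintro ⟨h1, h2, h3, h4⟩
    refine ⟨⟨fun a _ h h' => ?_, fun b _ _ hb => ?_⟩,
      fun d _ _ hd a _ ha ha' b _ hb hb' => h3 d hd a ⟨ha, ha'⟩ b ⟨hb, hb'⟩, ?_⟩
    · have := h1 a ⟨h, h'⟩
      exact ⟨_, block_subset_overD _ _ this, hE this, this, rfl⟩
    · obtain ⟨a, ha, e⟩ := h2 b hb
      exact ⟨a, hc a ha, ha.1, ha.2, e⟩
    · obtain ⟨a, ha, e⟩ := h4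
      exact ⟨a, hc a ha, ha.1, ha.2, e⟩

theorem freshIn_iff (h0 : block V 0 w ⊆ groundAtoms (A ∪ H))
    (h1 : block V 1 w ⊆ groundAtoms (A ∪ H)) (h2 : block V 2 w ⊆ groundAtoms (A ∪ H))
    (ξ : V.Const) : FreshIn A H (baseConsts R C) w ξ ↔
      ξ ∉ usedConsts R C (block V 0 w) (block V 1 w) ∧ ξ ∉ constsOf (block V 2 w) := by
  constructor
  · rintro ⟨hb, h⟩
    have key : ∀ a, a ∈ groundAtoms (A ∪ H) →
        (a ∈ block V 0 w ∨ a ∈ block V 1 w) ∨ a ∈ block V 2 w → ∀ k, a.args k ≠ ξ := by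
      refine fun a ha h' => h a ?_ ha h'
      rcases h' with (h' | h') | h' <;> exact block_subset_overD _ _ h'
    refine ⟨?_, ?_⟩
    · rintro (h' | ⟨a, ha, k, hk⟩ | ⟨a, ha, k, hk⟩)
      · exact hb h'
      · exact key a (h0 ha) (Or.inl (Or.inl ha)) k hk
      · exact key a (h1 ha) (Or.inl (Or.inr ha)) k hk
    · rintro ⟨a, ha, k, hk⟩
      exact key a (h2 ha) (Or.inr ha) k hk
  · rintro ⟨h, h'⟩
    refine ⟨fun hb => h (Or.inl hb), fun a _ _ ha k hk => ?_⟩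
    rcases ha with (ha | ha) | ha
    · exact h (Or.inr (Or.inl ⟨a, ha, k, hk⟩))
    · exact h (Or.inr (Or.inr ⟨a, ha, k, hk⟩))
    · exact h' ⟨a, ha, k, hk⟩

include hHA in
theorem inputOk_iff (h0 : block V 0 w ⊆ groundAtoms (A ∪ H))
    (h2 : block V 2 w ⊆ groundAtoms (A ∪ H)) (h3 : block V 3 w ⊆ groundAtoms (A ∪ H)) :
    InputOk A H w ↔ block V 0 w ⊆ groundAtoms A ∧ block V 1 w ⊆ groundAtoms Aᶜ ∧
      block V 2 w ⊆ groundAtoms A ∧ block V 3 w ⊆ groundAtoms A ∧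
      Disjoint (block V 2 w) (block V 3 w) ∧ block V 3 w ⊆ block V 0 w := by
  constructor
  · rintro ⟨hH, hA⟩
    have key : ∀ k, block V k w ⊆ groundAtoms (A ∪ H) → (k = 0 ∨ k = 2 ∨ k = 3) →
        block V k w ⊆ groundAtoms A := by
      intro k hk hk' a ha
      refine (hk ha).resolve_right fun hp => ?_
      have := hH a (block_subset_overD _ _ ha) hp
      rcases hk' with rfl | rfl | rfl
      · exact this.1 ha
      · exact this.2.1 ha
      · exact this.2.2 ha
    refine ⟨key 0 h0 (by simp), fun a ha hp => ?_, key 2 h2 (by simp), key 3 h3 (by simp), ?_, ?_⟩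
    · exact (hA a (block_subset_overD _ _ ha) hp).1 ha
    · rw [Set.disjoint_left]
      intro a ha ha'
      exact ((hA a (block_subset_overD _ _ ha') (key 3 h3 (by simp) ha')).2 ha').2 ha
    · intro a ha
      exact ((hA a (block_subset_overD _ _ ha) (key 3 h3 (by simp) ha)).2 ha).1
  · rintro ⟨k0, k1, k2, k3, k4, k5⟩
    refine ⟨fun a _ hp => ⟨fun h => hHA _ hp (k0 h), fun h => hHA _ hp (k2 h),
      fun h => hHA _ hp (k3 h)⟩, fun a _ hp => ⟨fun h => k1 h hp, fun h => ⟨k5 h, fun h' => ?_⟩⟩⟩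
    exact Set.disjoint_left.1 k4 h' h

include hK0 hR hRK hCK hH hHA in
/-- Certificates are sound: there is none for a constrained explanation. -/
theorem Refutes.exists_replacement (h : Refutes A H R C K w)
    (h0 : block V 0 w ⊆ groundAtoms A) (h1 : block V 1 w ⊆ groundAtoms Aᶜ)
    (hE : Explains A R C (block V 0 w) (block V 1 w) (block V 2 w) (block V 3 w)) :
    ∃ ξ, ξ ∉ usedConsts R C (block V 0 w) (block V 1 w) ∧ ξ ∉ constsOf (block V 2 w) ∧
      ∃ f : Replacement (block V 2 w),
        Explains A R C (block V 0 w) (block V 1 w) (f.apply ξ) (block V 3 w) := by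
  have hsub : groundAtoms A ⊆ groundAtoms (V := V) (A ∪ H) := fun a ha => Or.inl ha
  have h1' : block V 1 w ⊆ groundAtoms (A ∪ H) := by
    obtain ⟨M, hM, -, hOM⟩ := hE.supports
    refine hOM.trans (hM.pred_mem hH ?_)
    rintro a ⟨ha | ha, -⟩
    · exact h0 ha
    · exact hE.subE ha
  obtain ⟨hf, h⟩ := h
  have hin : InputOk A H w := (inputOk_iff hHA (h0.trans hsub) (hE.subE.trans hsub)
    (hE.subF.trans hsub)).2 ⟨h0, h1, hE.subE, hE.subF, hE.disj, hE.subB⟩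
  obtain ⟨hl, h⟩ := h.resolve_left (not_not_intro hin)
  have hok := hl.modelOk_iff hK0 hR hRK hCK hf h1'
  rw [baseFacts_eq h0] at hok
  rcases h with ⟨hs, hn⟩ | ⟨⟨ξ, -, c, -, hξ, hr⟩, hm⟩
  · rw [(sameBlocks_iff hE.subE).1 hs] at hok
    exact absurd (hok.2 hE.supports) hn
  · rw [freshIn_iff (h0.trans hsub) h1' (hE.subE.trans hsub)] at hξ
    rw [replacedBlocks_iff hE.subE] at hr
    refine ⟨ξ, hξ.1, hξ.2, ?_⟩
    obtain ⟨f, hf'⟩ := hr.exists_replacement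
    refine ⟨f, ?_⟩
    have hfin : (f.apply ξ).Finite := hE.finE.image _
    rw [hf'] at hfin ⊢
    refine ⟨hfin, hE.finF, fun a ha => ha.1, hE.subF, ?_, hE.subB, hok.1 hm⟩
    -- An atom of `F` does not contain `ξ`, because `F` is a part of the input.
    rw [Set.disjoint_left]
    intro a ha haF
    have hmap : a.map (unreplace ξ c) = a := by
      refine congrArg (Atom.mk a.pred) (funext fun k => if_neg fun hk => ?_)
      exact hξ.1 (Or.inr (Or.inl ⟨a, hE.subB haF, k, hk⟩))
    have := hr.maps a ha
    rw [hmap] at this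
    exact Set.disjoint_left.1 hE.disj this haF

end

end Abduction

/-! ### Encodings of sequences of sets -/

namespace Abduction

variable {V : Vocabulary} [Encodable V.Pred] [Denumerable V.Const]

theorem encodeAtom_eq_cons (a : GroundAtom V) : ∃ t, encodeAtom a = Sym.atom :: t ∧
    ∀ x ∈ t, x ≠ Sym.atom ∧ x ≠ Sym.set := by
  refine ⟨_, rfl, fun x hx => ?_⟩
  rcases List.mem_append.1 hx with hx | hx
  · obtain ⟨b, -, rfl⟩ := List.mem_map.1 hx
    simp
  · obtain ⟨c, -, hx⟩ := List.mem_flatMap.1 hx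
    rcases List.mem_cons.1 hx with rfl | hx
    · simp
    · obtain ⟨b, -, rfl⟩ := List.mem_map.1 hx
      simp

theorem set_notMem_encodeAtom (a : GroundAtom V) : Sym.set ∉ encodeAtom a := by
  obtain ⟨t, ht, h⟩ := encodeAtom_eq_cons a
  rw [ht]
  simp only [List.mem_cons, reduceCtorEq, false_or]
  exact fun hx => (h _ hx).2 rfl

theorem countP_encodeAtoms (l : List (GroundAtom V)) :
    (l.flatMap encodeAtom).countP isSet = 0 := by
  rw [List.countP_eq_zero]
  intro x hx h
  obtain ⟨a, -, ha⟩ := List.mem_flatMap.1 hx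
  refine set_notMem_encodeAtom a ?_
  cases x <;> first | exact ha | simp [isSet] at h

theorem isAtomEnd_head?_encodeAtoms (l : List (GroundAtom V)) {post : List Sym}
    (h : IsAtomEnd post.head?) : IsAtomEnd (l.flatMap encodeAtom ++ post).head? := by
  cases l with
  | nil => exact h
  | cons a l => trivial

/-- The atom marks in the code of a list of atoms are where the code of an atom begins. -/
theorem exists_split_of_atom {l : List (GroundAtom V)} {post : List Sym} {s : ℕ}
    (hs : s < (l.flatMap encodeAtom).length)
    (h : (l.flatMap encodeAtom ++ post)[s]? = some Sym.atom) :
    ∃ l₁ a l₂, l = l₁ ++ a :: l₂ ∧ s = (l₁.flatMap encodeAtom).length := by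
  induction l generalizing s with
  | nil => simp at hs
  | cons a l ih =>
    obtain ⟨t, ht, htail⟩ := encodeAtom_eq_cons a
    rw [List.flatMap_cons, List.append_assoc] at h
    by_cases hlt : s < (encodeAtom a).length
    · rw [List.getElem?_append_left hlt] at h
      cases s with
      | zero => exact ⟨[], a, l, rfl, rfl⟩
      | succ s =>
        rw [ht, List.getElem?_cons_succ] at h
        exact absurd rfl (htail _ (List.mem_of_getElem? h)).1
    · rw [List.getElem?_append_right (by omega)] at h
      rw [List.flatMap_cons, List.length_append] at hs
      obtain ⟨l₁, b, l₂, rfl, hs'⟩ := ih (s := s - (encodeAtom a).length) (by omega) h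
      refine ⟨a :: l₁, b, l₂, rfl, ?_⟩
      rw [List.flatMap_cons, List.length_append]
      omega

theorem occ_append {pre post : List Sym} {i : ℕ} {a : GroundAtom V} :
    Occ (pre ++ post) (pre.length + i) a ↔ Occ post i a := by
  simp only [Occ, List.drop_append, List.drop_eq_nil_of_le (Nat.le_add_right pre.length i),
    List.nil_append, Nat.add_sub_cancel_left]

theorem occ_encodeAtoms {l₁ l₂ : List (GroundAtom V)} {a : GroundAtom V} {post : List Sym}
    (h : IsAtomEnd post.head?) :
    Occ ((l₁ ++ a :: l₂).flatMap encodeAtom ++ post) (l₁.flatMap encodeAtom).length a := by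
  rw [List.flatMap_append, List.append_assoc]
  refine occ_append (i := 0).2 ⟨l₂.flatMap encodeAtom ++ post, ?_, isAtomEnd_head?_encodeAtoms l₂ h⟩
  rw [List.flatMap_cons, List.append_assoc]
  rfl

section Block

variable {l : List (GroundAtom V)} {w pre post : List Sym} {k : ℕ}
  (hw : w = pre ++ Sym.set :: (l.flatMap encodeAtom ++ post)) (hk : pre.countP isSet = k)
  (hpost : post.head? = none ∨ post.head? = some Sym.set)

include hw hk hpost

theorem exists_split_of_inBlock {i : ℕ} (hi : InBlock w k i) (ha : w[i]? = some Sym.atom) :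
    ∃ l₁ a l₂, l = l₁ ++ a :: l₂ ∧ i = pre.length + (1 + (l₁.flatMap encodeAtom).length) := by
  subst hw
  have h1 : pre.length < i := by
    by_contra hlt
    rw [InBlock, List.take_append_of_le_length (by omega)] at hi
    have := (List.take_sublist i pre).countP_le (p := isSet)
    omega
  obtain ⟨s, rfl⟩ : ∃ s, i = pre.length + (1 + s) := ⟨i - pre.length - 1, by omega⟩
  have h2 : (l.flatMap encodeAtom ++ post)[s]? = some Sym.atom := by
    rw [List.getElem?_append_right (by omega), Nat.add_sub_cancel_left, Nat.add_comm,
      List.getElem?_cons_succ] at ha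
    exact ha
  by_cases hs : s < (l.flatMap encodeAtom).length
  · obtain ⟨l₁, a, l₂, h, h'⟩ := exists_split_of_atom hs h2
    exact ⟨l₁, a, l₂, h, by rw [h']⟩
  exfalso
  obtain ⟨m, rfl⟩ : ∃ m, s = (l.flatMap encodeAtom).length + m :=
    ⟨s - (l.flatMap encodeAtom).length, by omega⟩
  rw [List.getElem?_append_right (by omega), Nat.add_sub_cancel_left] at h2
  cases post with
  | nil => simp at h2
  | cons x post =>
    obtain rfl : x = Sym.set := by simpa using hpost
    cases m with
    | zero => simp at h2
    | succ m =>
      rw [InBlock, List.take_append, List.take_of_length_le (by omega), Nat.add_sub_cancel_left,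
        Nat.add_comm 1, List.take_succ_cons, List.take_append, List.take_of_length_le (by omega),
        Nat.add_sub_cancel_left, List.take_succ_cons] at hi
      simp only [List.countP_append, List.countP_cons, isSet, if_true] at hi
      omega

theorem occ_of_split {l₁ l₂ : List (GroundAtom V)} {a : GroundAtom V} (hl : l = l₁ ++ a :: l₂) :
    InBlock w k (pre.length + (1 + (l₁.flatMap encodeAtom).length)) ∧
      Occ w (pre.length + (1 + (l₁.flatMap encodeAtom).length)) a := by
  subst hw hl
  constructor
  · rw [InBlock, List.take_append, List.take_of_length_le (by omega), Nat.add_sub_cancel_left,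
      Nat.add_comm 1, List.take_succ_cons, List.flatMap_append, List.append_assoc,
      List.take_left, List.countP_append, List.countP_cons, countP_encodeAtoms, hk]
    rfl
  · rw [occ_append]
    refine (occ_append (pre := [Sym.set])).2 (occ_encodeAtoms ?_)
    rcases hpost with h | h <;> rw [h] <;> trivial

theorem block_eq_of_split : block V k w = {a | a ∈ l} := by
  ext a
  constructor
  · rintro ⟨i, hi, ha⟩
    obtain ⟨l₁, b, l₂, hl, rfl⟩ := exists_split_of_inBlock hw hk hpost hi ((occ_iff w i a).1 ha).1
    rw [ha.unique (occ_of_split hw hk hpost hl).2]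
    simp [hl]
  · intro ha
    obtain ⟨l₁, l₂, hl⟩ := List.append_of_mem ha
    exact ⟨_, occ_of_split hw hk hpost hl⟩

end Block

/-- In an encoding of sets, every mark of a set is followed by a mark, and every mark of an atom
begins one of the atoms. -/
theorem encodeSets_spec {ls : List (List (GroundAtom V))} {post : List Sym}
    (hpost : post.head? = some Sym.set) {i : ℕ} (hi : i < (ls.flatMap encodeSet).length) :
    ((ls.flatMap encodeSet ++ post)[i]? = some Sym.set →
      (ls.flatMap encodeSet ++ post)[i + 1]? = some Sym.set ∨
      (ls.flatMap encodeSet ++ post)[i + 1]? = some Sym.atom) ∧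
    ((ls.flatMap encodeSet ++ post)[i]? = some Sym.atom →
      ∃ l ∈ ls, ∃ a ∈ l, Occ (ls.flatMap encodeSet ++ post) i a) := by
  induction ls generalizing i with
  | nil => simp at hi
  | cons l ls ih =>
    rw [List.flatMap_cons, List.append_assoc]
    have hpost' : (ls.flatMap encodeSet ++ post).head? = some Sym.set := by
      cases ls with
      | nil => exact hpost
      | cons l ls => rfl
    generalize hv : ls.flatMap encodeSet ++ post = v at *
    by_cases hlt : i < (encodeSet l).length
    · cases i with
      | zero =>
        refine ⟨fun _ => ?_, fun h => by simp [encodeSet] at h⟩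
        rw [encodeSet, List.cons_append, List.getElem?_cons_succ, ← List.head?_eq_getElem?]
        cases l with
        | nil => exact Or.inl hpost'
        | cons a l => exact Or.inr rfl
      | succ i =>
        rw [encodeSet, List.cons_append, List.getElem?_cons_succ]
        simp only [encodeSet, List.length_cons, Nat.add_lt_add_iff_right] at hlt
        constructor
        · intro h
          rw [List.getElem?_append_left hlt] at h
          have := List.countP_eq_zero.1 (countP_encodeAtoms l) _ (List.mem_of_getElem? h)
          simp [isSet] at this
        · intro h
          obtain ⟨l₁, a, l₂, rfl, rfl⟩ := exists_split_of_atom hlt h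
          refine ⟨_, List.mem_cons_self, a, by simp, ?_⟩
          rw [Nat.add_comm]
          refine (occ_append (pre := [Sym.set])).2 (occ_encodeAtoms ?_)
          rw [hpost']; trivial
    · obtain ⟨j, rfl⟩ : ∃ j, i = (encodeSet l).length + j := ⟨i - (encodeSet l).length, by omega⟩
      rw [List.flatMap_cons, List.length_append] at hi
      obtain ⟨h1, h2⟩ := ih (i := j) (by omega)
      rw [Nat.add_assoc, List.getElem?_append_right (by omega),
        List.getElem?_append_right (by omega), Nat.add_sub_cancel_left, Nat.add_sub_cancel_left]
      refine ⟨h1, fun h => ?_⟩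
      obtain ⟨l', hl', a, ha, ho⟩ := h2 h
      exact ⟨l', List.mem_cons_of_mem _ hl', a, ha, occ_append.2 ho⟩

theorem countP_encodeSets (ls : List (List (GroundAtom V))) :
    (ls.flatMap encodeSet).countP isSet = ls.length := by
  induction ls with
  | nil => rfl
  | cons l ls ih =>
    rw [List.flatMap_cons, List.countP_append, ih, encodeSet, List.countP_cons, countP_encodeAtoms,
      List.length_cons]
    simp [isSet]; omega

/-- A word is an encoding of sets of atoms if every mark of a set is followed by a mark, and every
mark of an atom begins an atom. -/
theorem exists_encodeSets {Q : Set V.Pred} {x post : List Sym} (hpost : post.head? = some Sym.set)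
    (h0 : x[0]? = some Sym.set)
    (h1 : ∀ i < x.length, (x ++ post)[i]? = some Sym.set →
      (x ++ post)[i + 1]? = some Sym.set ∨ (x ++ post)[i + 1]? = some Sym.atom)
    (h2 : ∀ i < x.length, (x ++ post)[i]? = some Sym.atom →
      ∃ a : GroundAtom V, a.pred ∈ Q ∧ Occ (x ++ post) i a) :
    ∃ ls : List (List (GroundAtom V)), x = ls.flatMap encodeSet ∧ ∀ l ∈ ls, ∀ a ∈ l, a.pred ∈ Q := by
  have key : ∀ n i, i ≤ x.length → x.length - i ≤ n →
      ((x ++ post)[i]? = some Sym.set ∨ (x ++ post)[i]? = some Sym.atom) →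
      ∃ (l : List (GroundAtom V)) (ls : List (List (GroundAtom V))),
        x.drop i = l.flatMap encodeAtom ++ ls.flatMap encodeSet ∧
        (∀ a ∈ l, a.pred ∈ Q) ∧ ∀ l ∈ ls, ∀ a ∈ l, a.pred ∈ Q := by
    intro n
    induction n with
    | zero =>
      intro i hi hn _
      exact ⟨[], [], by simpa using (by omega : x.length ≤ i), by simp, by simp⟩
    | succ n ih =>
      intro i hi hn h
      by_cases hix : i = x.length
      · exact ⟨[], [], by simp [hix], by simp, by simp⟩
      rcases h with h | h
      · obtain ⟨l, ls, h3, h4, h5⟩ := ih (i + 1) (by omega) (by omega) (h1 i (by omega) h)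
        refine ⟨[], l :: ls, ?_, by simp, ?_⟩
        · rw [List.getElem?_append_left (by omega)] at h
          obtain ⟨hlt, h⟩ := List.getElem?_eq_some_iff.1 h
          rw [List.drop_eq_getElem_cons hlt, h, h3]
          rfl
        · intro l' hl'
          rcases List.mem_cons.1 hl' with rfl | hl'
          · exact h4
          · exact h5 l' hl'
      · obtain ⟨a, haQ, rest, ha, hrest⟩ := h2 i (by omega) h
        rw [List.drop_append_of_le_length hi] at ha
        -- The code of an atom does not contain the set mark that follows `x`.
        have hle : (encodeAtom a).length ≤ (x.drop i).length := by
          by_contra hlt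
          have h3 : (x.drop i ++ post)[(x.drop i).length]? = some Sym.set := by
            rw [List.getElem?_append_right le_rfl, Nat.sub_self, ← List.head?_eq_getElem?, hpost]
          rw [ha, List.getElem?_append_left (by omega)] at h3
          exact set_notMem_encodeAtom a (List.mem_of_getElem? h3)
        obtain ⟨r, hr⟩ : ∃ r, x.drop i = encodeAtom a ++ r := by
          obtain ⟨r, hr⟩ := List.prefix_of_prefix_length_le (ha ▸ List.prefix_append _ rest :
            encodeAtom a <+: x.drop i ++ post) (List.prefix_append _ _) hle
          exact ⟨r, hr.symm⟩
        have hpos : 0 < (encodeAtom a).length := by simp [encodeAtom]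
        have hdrop : x.drop (i + (encodeAtom a).length) = r := by
          rw [← List.drop_drop, hr, List.drop_left]
        rw [List.length_drop] at hle
        have hnext : (x ++ post)[i + (encodeAtom a).length]? = rest.head? := by
          rw [← List.head?_drop, List.drop_append_of_le_length (by omega), hdrop]
          rw [hr, List.append_assoc, List.append_cancel_left_eq] at ha
          rw [ha]
        have hne : (x ++ post)[i + (encodeAtom a).length]? ≠ none := by
          have : 0 < post.length := by
            cases post with
            | nil => simp at hpost
            | cons _ _ => simp
          rw [Ne, List.getElem?_eq_none_iff, List.length_append]
          omega
        obtain ⟨l, ls, h3, h4, h5⟩ := ih (i + (encodeAtom a).length) (by omega) (by omega) (by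
          rw [hnext] at hne ⊢
          match rest.head?, hrest, hne with
          | none, _, hne => exact absurd rfl hne
          | some .set, _, _ => exact Or.inl rfl
          | some .atom, _, _ => exact Or.inr rfl)
        refine ⟨a :: l, ls, ?_, ?_, h5⟩
        · rw [hr, ← hdrop, h3, List.flatMap_cons, List.append_assoc]
        · intro b hb
          rcases List.mem_cons.1 hb with rfl | hb
          · exact haQ
          · exact h4 b hb
  obtain ⟨hlt, h0'⟩ := List.getElem?_eq_some_iff.1 h0
  obtain ⟨l, ls, h3, h4, h5⟩ := key _ 1 (by omega) le_rfl
    (h1 0 hlt (by rw [List.getElem?_append_left hlt, h0]))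
  refine ⟨l :: ls, ?_, ?_⟩
  · have := List.drop_eq_getElem_cons hlt
    rw [List.drop_zero, h0', Nat.zero_add, h3] at this
    exact this
  · intro l' hl'
    rcases List.mem_cons.1 hl' with rfl | hl'
    · exact h4
    · exact h5 l' hl'

end Abduction

/-! ### The constants in an encoding -/

namespace Abduction

variable {V : Vocabulary} [Denumerable V.Const]

theorem exists_bits_append (l : List Sym) :
    ∃ s t, l = s ++ t ∧ (∀ x ∈ s, IsBit (some x)) ∧ ¬ IsBit t.head? := by
  induction l with
  | nil => exact ⟨[], [], rfl, by simp, fun h => h⟩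
  | cons a l ih =>
    by_cases ha : IsBit (some a)
    · obtain ⟨s, t, rfl, hs, ht⟩ := ih
      refine ⟨a :: s, t, rfl, fun x hx => ?_, ht⟩
      rcases List.mem_cons.1 hx with rfl | hx
      · exact ha
      · exact hs x hx
    · exact ⟨[], a :: l, rfl, by simp, ha⟩

/-- The constants of a concatenation, if it does not prolong a run of digits. -/
theorem dom_append {w₁ w₂ : List Sym} (h : ¬ IsBit w₂.head?) :
    Dom V (w₁ ++ w₂) = Dom V w₁ ∪ Dom V w₂ := by
  ext c
  constructor
  · rintro ⟨i, rest, hc, hrest⟩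
    by_cases hi : w₁.length ≤ i
    · rw [List.drop_append, List.drop_eq_nil_of_le hi, List.nil_append] at hc
      exact Or.inr ⟨_, rest, hc, hrest⟩
    · rw [List.drop_append_of_le_length (by omega), List.drop_eq_getElem_cons (by omega),
        List.cons_append, List.cons_append, List.cons.injEq] at hc
      obtain ⟨s, t, hst, hs, ht⟩ := exists_bits_append (w₁.drop (i + 1))
      rw [hst, List.append_assoc] at hc
      have ht' : ¬ IsBit (t ++ w₂).head? := by
        cases t with
        | nil => exact h
        | cons x t => exact ht
      obtain ⟨h1, -⟩ := bits_append_inj hs (fun _ => isBit_of_mem_encodeSymbol) ht' hrest hc.2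
      refine Or.inl ⟨i, t, ?_, ht⟩
      rw [List.drop_eq_getElem_cons (by omega), hc.1, hst, h1]
      rfl
  · rintro (⟨i, rest, hc, hrest⟩ | ⟨i, rest, hc, hrest⟩)
    · have hi : i < w₁.length := by
        by_contra hi
        rw [List.drop_eq_nil_of_le (by omega)] at hc
        simp at hc
      refine ⟨i, rest ++ w₂, ?_, ?_⟩
      · rw [List.drop_append_of_le_length (by omega), hc, List.append_assoc]
      · cases rest with
        | nil => exact h
        | cons x t => exact hrest
    · refine ⟨w₁.length + i, rest, ?_, hrest⟩
      rw [List.drop_append, List.drop_eq_nil_of_le (by omega), List.nil_append,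
        Nat.add_sub_cancel_left, hc]

theorem dom_eq_empty {w : List Sym} (h : Sym.arg ∉ w) : Dom V w = ∅ := by
  rw [Set.eq_empty_iff_forall_notMem]
  rintro c ⟨i, hc⟩
  exact h (List.mem_of_getElem? ((cAt_iff w i c).1 hc).1)

theorem dom_args (l : List V.Const) :
    Dom V (l.flatMap fun c => Sym.arg :: encodeSymbol c) = {c | c ∈ l} := by
  induction l with
  | nil => rw [List.flatMap_nil, dom_eq_empty (by simp)]; simp
  | cons c l ih =>
    have hhead : ¬ IsBit (l.flatMap fun c => Sym.arg :: encodeSymbol c).head? := by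
      cases l with
      | nil => exact fun h => h
      | cons d l => exact fun h => h
    have hone : Dom V (Sym.arg :: encodeSymbol c) = {c} := by
      ext d
      constructor
      · rintro ⟨i, hd⟩
        have h0 : CAt (Sym.arg :: encodeSymbol c) 0 c := ⟨[], by simp, fun h => h⟩
        cases i with
        | zero => exact hd.unique h0
        | succ i =>
          have h1 := ((cAt_iff _ _ _).1 hd).1
          rw [List.getElem?_cons_succ] at h1
          exact (isBit_of_mem_encodeSymbol (List.mem_of_getElem? h1)).elim
      · rintro rfl
        exact ⟨0, [], by simp, fun h => h⟩
    rw [List.flatMap_cons, dom_append hhead, hone, ih]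
    ext d; simp

variable [Encodable V.Pred]

theorem dom_encodeAtom (a : GroundAtom V) : Dom V (encodeAtom a) = Set.range a.args := by
  have hhead : ¬ IsBit ((List.ofFn a.args).flatMap fun c => Sym.arg :: encodeSymbol c).head? := by
    cases List.ofFn a.args with
    | nil => exact fun h => h
    | cons d l => exact fun h => h
  rw [encodeAtom, dom_append hhead, dom_args, dom_eq_empty, Set.empty_union]
  · ext c; simp [List.mem_ofFn]
  · intro h
    rcases List.mem_cons.1 h with h | h
    · cases h
    · exact isBit_of_mem_encodeSymbol h

theorem dom_encodeSet (l : List (GroundAtom V)) : Dom V (encodeSet l) = constsOf {a | a ∈ l} := by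
  have hone : ∀ l : List (GroundAtom V),
      Dom V (l.flatMap encodeAtom) = constsOf {a | a ∈ l} := by
    intro l
    induction l with
    | nil => rw [List.flatMap_nil, dom_eq_empty (by simp)]; ext c; simp [constsOf]
    | cons a l ih =>
      have hhead : ¬ IsBit (l.flatMap encodeAtom).head? := by
        cases l with
        | nil => exact fun h => h
        | cons d l => exact fun h => h
      rw [List.flatMap_cons, dom_append hhead, ih, dom_encodeAtom]
      ext c; simp [constsOf]
  have hhead : ¬ IsBit (l.flatMap encodeAtom).head? := by
    cases l with
    | nil => exact fun h => h
    | cons d l => exact fun h => h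
  have := dom_append (V := V) (w₁ := [Sym.set]) hhead
  rw [dom_eq_empty (w := [Sym.set]) (by simp), Set.empty_union, hone] at this
  exact this

theorem dom_encodeSets (ls : List (List (GroundAtom V))) :
    Dom V (ls.flatMap encodeSet) = {c | ∃ l ∈ ls, c ∈ constsOf {a | a ∈ l}} := by
  induction ls with
  | nil => rw [List.flatMap_nil, dom_eq_empty (by simp)]; simp
  | cons l ls ih =>
    have hhead : ¬ IsBit (ls.flatMap encodeSet).head? := by
      cases ls with
      | nil => exact fun h => h
      | cons d l => exact fun h => h
    rw [List.flatMap_cons, dom_append hhead, ih, dom_encodeSet]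
    ext c; simp

/-! ### Sizes -/

omit [Encodable V.Pred] in
theorem exists_finset_dom (w : List Sym) :
    ∃ D : Finset V.Const, (∀ c, c ∈ D ↔ c ∈ Dom V w) ∧ D.card ≤ w.length := by
  classical
  have hsub : Dom V w ⊆ ((Finset.range w.length).image fun i =>
      if h : ∃ c : V.Const, CAt w i c then h.choose else Denumerable.ofNat V.Const 0 :
      Finset V.Const) := by
    rintro c ⟨i, hc⟩
    refine Finset.mem_coe.2 (Finset.mem_image.2 ⟨i, Finset.mem_range.2 hc.lt, ?_⟩)
    have h : ∃ c : V.Const, CAt w i c := ⟨c, hc⟩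
    rw [dif_pos h]
    exact h.choose_spec.unique hc
  refine ⟨((Finset.finite_toSet _).subset hsub).toFinset, fun c => by simp, ?_⟩
  refine (Finset.card_le_card fun c hc => hsub (by simpa using hc)).trans ?_
  exact Finset.card_image_le.trans (by simp)

omit [Encodable V.Pred] in
theorem length_encodeSymbol_le_of_mem_dom {w : List Sym} {c : V.Const} (h : c ∈ Dom V w) :
    (encodeSymbol c).length ≤ w.length := by
  obtain ⟨i, hc⟩ := h
  have := hc.runAt.le
  omega

theorem length_encodePosNum_le (p : PosNum) : (Computability.encodePosNum p).length ≤ (p : ℕ) := by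
  induction p with
  | one => exact le_rfl
  | bit0 p ih =>
    have := PosNum.cast_pos (α := ℕ) p
    rw [Computability.encodePosNum, List.length_cons, PosNum.cast_bit0]
    omega
  | bit1 p ih =>
    rw [Computability.encodePosNum, List.length_cons, PosNum.cast_bit1]
    omega

theorem length_encodeNat_le (n : ℕ) : (Computability.encodeNat n).length ≤ n := by
  have h : ((n : Num) : ℕ) = n := Num.to_of_nat n
  rw [Computability.encodeNat]
  cases hn : (n : Num) with
  | zero => simp [Computability.encodeNum]
  | pos p =>
    rw [hn] at h
    rw [← h]
    exact length_encodePosNum_le p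

omit [Encodable V.Pred] in
/-- There are constants with short codes outside a finite set. -/
theorem exists_fresh_finset (X : Finset V.Const) {m : ℕ} (hX : X.card ≤ m) (K : ℕ) :
    ∃ T : Finset V.Const, T.card = K ∧
      ∀ c ∈ T, c ∉ X ∧ (encodeSymbol c).length ≤ m + K := by
  classical
  obtain ⟨T, hT, hTK⟩ := Finset.exists_subset_card_eq (n := K)
    (s := (Finset.range (m + K)).image (Denumerable.ofNat V.Const) \ X) (by
      refine le_trans ?_ (Finset.le_card_sdiff _ _)
      rw [Finset.card_image_of_injective _ fun a b h => ?_, Finset.card_range]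
      · omega
      · simpa using congrArg Encodable.encode h)
  refine ⟨T, hTK, fun c hc => ?_⟩
  have hc := hT hc
  rw [Finset.mem_sdiff, Finset.mem_image] at hc
  obtain ⟨⟨n, hn, rfl⟩, hc⟩ := hc
  refine ⟨hc, ?_⟩
  rw [encodeSymbol, List.length_map, Denumerable.encode_ofNat]
  exact (length_encodeNat_le n).trans (Finset.mem_range.1 hn).le

theorem length_flatMap_le {α β : Type} (l : List α) (f : α → List β) {m : ℕ}
    (h : ∀ a ∈ l, (f a).length ≤ m) : (l.flatMap f).length ≤ l.length * m := by
  induction l with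
  | nil => simp
  | cons a l ih =>
    rw [List.flatMap_cons, List.length_append, List.length_cons, Nat.succ_mul, Nat.add_comm]
    exact Nat.add_le_add (ih fun b hb => h b (List.mem_cons_of_mem _ hb)) (h a List.mem_cons_self)

omit [Denumerable V.Const] [Encodable V.Pred] in
theorem exists_finset_atoms {Q : Set V.Pred} (hQ : Q.Finite) (D : Finset V.Const) :
    ∃ S : Finset (GroundAtom V), (∀ a, a ∈ S ↔ a.pred ∈ Q ∧ ∀ k, a.args k ∈ D) ∧
      S.card ≤ ∑ p ∈ hQ.toFinset, D.card ^ V.arity p := by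
  classical
  refine ⟨hQ.toFinset.biUnion fun p =>
    (Fintype.piFinset fun _ : Fin (V.arity p) => D).image (Atom.mk p), fun ⟨p, x⟩ => ?_, ?_⟩
  · simp only [Finset.mem_biUnion, Set.Finite.mem_toFinset, Finset.mem_image, Fintype.mem_piFinset]
    constructor
    · rintro ⟨q, hq, y, hy, h⟩
      cases h
      exact ⟨hq, hy⟩
    · exact fun h => ⟨p, h.1, x, h.2, rfl⟩
  · refine Finset.card_biUnion_le.trans
      (Finset.sum_le_sum fun p _ => Finset.card_image_le.trans ?_)
    rw [Fintype.card_piFinset_const]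

/-- A bound for the length of the code of a list of different atoms. -/
theorem exists_length_bound {Q : Set V.Pred} (hQ : Q.Finite) : ∃ G : Polynomial ℕ,
    ∀ (N : ℕ) (D : Finset V.Const), D.card ≤ N → (∀ c ∈ D, (encodeSymbol c).length ≤ N) →
      ∀ l : List (GroundAtom V), l.Nodup → (∀ a ∈ l, a.pred ∈ Q ∧ ∀ k, a.args k ∈ D) →
        (l.flatMap encodeAtom).length ≤ G.eval N := by
  classical
  refine ⟨(∑ p ∈ hQ.toFinset, Polynomial.X ^ V.arity p) * ∑ p ∈ hQ.toFinset,
    (Polynomial.C (1 + (encodeSymbol p).length) +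
      Polynomial.C (V.arity p) * (Polynomial.X + 1)), ?_⟩
  intro N D hD hN l hl hlQ
  simp only [Polynomial.eval_mul, Polynomial.eval_finsetSum, Polynomial.eval_pow,
    Polynomial.eval_X, Polynomial.eval_add, Polynomial.eval_C, Polynomial.eval_one]
  refine (length_flatMap_le l encodeAtom fun a ha => ?_).trans (Nat.mul_le_mul_right _ ?_)
  · have hlen : (encodeAtom a).length ≤
        1 + (encodeSymbol a.pred).length + V.arity a.pred * (N + 1) := by
      rw [encodeAtom, List.length_append, List.length_cons]
      refine Nat.add_le_add (by omega) ((length_flatMap_le _ _ fun c hc => ?_).trans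
        (Nat.mul_le_mul_right _ (List.length_ofFn).le))
      obtain ⟨k, rfl⟩ := (List.mem_ofFn' _ _).1 hc
      exact Nat.succ_le_succ (hN _ ((hlQ a ha).2 k))
    exact hlen.trans (Finset.single_le_sum (f := fun p => 1 + (encodeSymbol p).length +
      V.arity p * (N + 1)) (fun _ _ => Nat.zero_le _) (by simpa using (hlQ a ha).1))
  · rw [← List.toFinset_card_of_nodup hl]
    obtain ⟨S, hS, hcard⟩ := exists_finset_atoms hQ D
    refine (Finset.card_le_card fun a ha => (hS a).2 (hlQ a (List.mem_toFinset.1 ha))).trans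
      (hcard.trans (Finset.sum_le_sum fun p _ => Nat.pow_le_pow_left hD _))

end Abduction

/-! ### Existence of short certificates -/

namespace Abduction

variable {V : Vocabulary}

/-- A finite stable model can be listed in the order of a derivation. -/
theorem StableOn.exists_list {D : Set V.Const} {R : Set (Rule V)} {S N : Set (GroundAtom V)}
    (h : StableOn D R S N) (hfin : N.Finite) :
    ∃ l : List (GroundAtom V), l.Nodup ∧ (∀ a, a ∈ l ↔ a ∈ N) ∧
      ∀ l₁ a l₂, l = l₁ ++ a :: l₂ → a ∈ S ∨ ∃ r ∈ R, ∃ θ : ℕ → V.Const, (∀ i, θ i ∈ D) ∧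
        a = r.head.map (Term.subst θ) ∧ (∀ b ∈ r.pos, b.map (Term.subst θ) ∈ l₁) ∧
        ∀ b ∈ r.neg, b.map (Term.subst θ) ∉ N := by
  classical
  let Just : List (GroundAtom V) → GroundAtom V → Prop := fun l₁ a =>
    a ∈ S ∨ ∃ r ∈ R, ∃ θ : ℕ → V.Const, (∀ i, θ i ∈ D) ∧
        a = r.head.map (Term.subst θ) ∧ (∀ b ∈ r.pos, b.map (Term.subst θ) ∈ l₁) ∧
        ∀ b ∈ r.neg, b.map (Term.subst θ) ∉ N
  let Good : List (GroundAtom V) → Prop := fun l =>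
    l.Nodup ∧ (∀ a ∈ l, a ∈ N) ∧ ∀ l₁ a l₂, l = l₁ ++ a :: l₂ → Just l₁ a
  -- A list that does not contain all of `N` can be extended.
  have step : ∀ l, Good l → (∃ a ∈ N, a ∉ l) → ∃ a, Good (l ++ [a]) := by
    rintro l ⟨h1, h2, h3⟩ ⟨b, hbN, hbl⟩
    have ext : ∀ a, Just l a → a ∉ l → a ∈ N → Good (l ++ [a]) := by
      intro a ha hal haN
      refine ⟨?_, fun c hc => ?_, fun l₁ c l₂ hc => ?_⟩
      · rw [List.nodup_append]
        refine ⟨h1, List.nodup_singleton a, fun c hc d hd => ?_⟩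
        rw [List.mem_singleton.1 hd]
        rintro rfl
        exact hal hc
      · rcases List.mem_append.1 hc with hc | hc
        · exact h2 c hc
        · rw [List.mem_singleton.1 hc]; exact haN
      · rcases List.eq_nil_or_concat l₂ with rfl | ⟨l₃, d, rfl⟩
        · obtain ⟨rfl, hac⟩ := List.append_inj' hc rfl
          obtain rfl : a = c := by simpa using hac
          exact ha
        · rw [List.concat_eq_append, ← List.cons_append, ← List.append_assoc] at hc
          exact h3 l₁ c l₃ (List.append_inj' hc rfl).1
    by_contra hno
    push Not at hno
    have hI : ReductOn D R S N {a | a ∈ l} := by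
      refine ⟨fun a ha => ?_, fun r hr θ hθ hneg hpos => ?_⟩
      · by_contra hal
        exact hno a (ext a (Or.inl ha) hal (h.1.1 ha))
      · by_contra hal
        exact hno _ (ext _ (Or.inr ⟨r, hr, θ, hθ, rfl, hpos, hneg⟩) hal
          (h.1.2 r hr θ hθ hneg fun b hb => h2 _ (hpos b hb)))
    exact hbl (h.2 hI hbN)
  have key : ∀ m, (∃ l, Good l ∧ ∀ a ∈ N, a ∈ l) ∨ ∃ l, Good l ∧ l.length = m := by
    intro m
    induction m with
    | zero => exact Or.inr ⟨[], ⟨List.nodup_nil, by simp, by simp⟩, rfl⟩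
    | succ m ih =>
      rcases ih with ih | ⟨l, hl, rfl⟩
      · exact Or.inl ih
      by_cases hall : ∀ a ∈ N, a ∈ l
      · exact Or.inl ⟨l, hl, hall⟩
      · push Not at hall
        obtain ⟨a, ha⟩ := step l hl hall
        exact Or.inr ⟨_, ha, by simp⟩
  rcases key (hfin.toFinset.card + 1) with ⟨l, hl, hall⟩ | ⟨l, hl, hlen⟩
  · exact ⟨l, hl.1, fun a => ⟨hl.2.1 a, hall a⟩, hl.2.2⟩
  · have : l.toFinset.card ≤ hfin.toFinset.card :=
      Finset.card_le_card fun a ha => by simpa using hl.2.1 a (by simpa using ha)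
    rw [List.toFinset_card_of_nodup hl.1] at this
    omega

variable [Encodable V.Pred] [Denumerable V.Const]

theorem head?_encodeSets (ls : List (List (GroundAtom V))) {tail : List Sym}
    (htail : tail.head? = some Sym.set) : (ls.flatMap encodeSet ++ tail).head? = some Sym.set := by
  cases ls with
  | nil => exact htail
  | cons l ls => rfl

theorem encodeSets_split (ls₁ ls₂ : List (List (GroundAtom V))) (l : List (GroundAtom V))
    (tail : List Sym) : (ls₁ ++ l :: ls₂).flatMap encodeSet ++ tail =
      ls₁.flatMap encodeSet ++
        Sym.set :: (l.flatMap encodeAtom ++ (ls₂.flatMap encodeSet ++ tail)) := by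
  simp [encodeSet]

theorem block_encodeSets (ls₁ ls₂ : List (List (GroundAtom V))) (l : List (GroundAtom V))
    {tail : List Sym} (htail : tail.head? = some Sym.set) :
    block V ls₁.length ((ls₁ ++ l :: ls₂).flatMap encodeSet ++ tail) = {a | a ∈ l} :=
  block_eq_of_split (encodeSets_split ls₁ ls₂ l tail) (countP_encodeSets ls₁)
    (Or.inr (head?_encodeSets ls₂ htail))

/-- The code of a list of constants. -/
def encodeConsts (l : List V.Const) : List Sym :=
  Sym.set :: l.flatMap fun c => Sym.arg :: encodeSymbol c

omit [Encodable V.Pred] in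
theorem dom_encodeConsts (l : List V.Const) : Dom V (encodeConsts l) = {c | c ∈ l} := by
  have hhead : ¬ IsBit (l.flatMap fun c => Sym.arg :: encodeSymbol c).head? := by
    cases l with
    | nil => exact fun h => h
    | cons d l => exact fun h => h
  have := dom_append (V := V) (w₁ := [Sym.set]) hhead
  rw [dom_eq_empty (w := [Sym.set]) (by simp), Set.empty_union, dom_args] at this
  exact this

variable {A H : Set V.Pred} {R : Set (Rule V)} {C : Set V.lang.Sentence}

/-- If a stable model is written into block `4` in the order of a derivation, then the word
satisfies `ListsModel`. -/
theorem listsModel_of_list {w pre post : List Sym} {l : List (GroundAtom V)}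
    (hw : w = pre ++ Sym.set :: (l.flatMap encodeAtom ++ post)) (hk : pre.countP isSet = 4)
    (hpost : post.head? = none ∨ post.head? = some Sym.set) {N : Set (GroundAtom V)}
    (hN : StableOn (Dom V w) R (baseFacts A w) N) (hl : ∀ a, a ∈ l ↔ a ∈ N)
    (hder : ∀ l₁ a l₂, l = l₁ ++ a :: l₂ → a ∈ baseFacts A w ∨
      ∃ r ∈ R, ∃ θ : ℕ → V.Const, (∀ i, θ i ∈ Dom V w) ∧ a = r.head.map (Term.subst θ) ∧
        (∀ b ∈ r.pos, b.map (Term.subst θ) ∈ l₁) ∧ ∀ b ∈ r.neg, b.map (Term.subst θ) ∉ N) :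
    ListsModel A R w := by
  have hb : block V 4 w = N := by
    rw [block_eq_of_split hw hk hpost]
    exact Set.ext hl
  refine ⟨fun a _ _ ha => ?_, fun r hr θ hθ => ?_, fun s _ hs ha => ?_⟩
  · rw [hb]; exact hN.1.1 ha
  · rw [hb]; exact hN.1.2 r hr θ hθ
  · obtain ⟨l₁, a, l₂, hl', rfl⟩ := exists_split_of_inBlock hw hk hpost hs ha
    have hocc := (occ_of_split hw hk hpost hl').2
    rcases hder l₁ a l₂ hl' with h | ⟨r, hr, θ, hθ, rfl, hpos, hneg⟩
    · exact Or.inl ⟨a, fun k => hocc.args_mem_dom k, h.1, h, hocc⟩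
    · refine Or.inr ⟨r, hr, θ, hθ, hocc, fun b hb' => ?_, by rwa [hb]⟩
      obtain ⟨m₁, m₂, hm⟩ := List.append_of_mem (hpos b hb')
      refine ⟨_, ?_, occ_of_split hw hk hpost (l₁ := m₁)
        (l₂ := m₂ ++ r.head.map (Term.subst θ) :: l₂) (by rw [hl', hm]; simp)⟩
      rw [hm, List.flatMap_append, List.length_append, List.flatMap_cons, List.length_append]
      have : 0 < (encodeAtom (b.map (Term.subst θ))).length := by simp [encodeAtom]
      omega

/-- There is a certificate of polynomial length that lists the stable model for any candidate `E'`
with at most one constant `ξ` beyond those of the input. -/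
theorem exists_certificate (hA : A.Finite) (hR : R.Finite) (hstrat : Stratified R)
    (hC : C.Finite) {K : ℕ} (hK0 : 0 < K) (hRK : ∀ r ∈ R, r.VarsLt K) (κ : ℕ) :
    ∃ p : Polynomial ℕ, ∀ (lB lO lE lF : List (GroundAtom V)) (x : List Sym),
      x = [lB, lO, lE, lF].flatMap encodeSet →
      ∀ (E' : Set (GroundAtom V)) (ξ : V.Const), E'.Finite → E' ⊆ groundAtoms A →
        constsOf E' ⊆ insert ξ (Dom V x) → (encodeSymbol ξ).length ≤ x.length + κ →
      ∃ y : List Sym, y.length ≤ p.eval x.length ∧ y.head? = some Sym.set ∧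
        block V 0 (x ++ y) = {a | a ∈ lB} ∧ block V 1 (x ++ y) = {a | a ∈ lO} ∧
        block V 2 (x ++ y) = {a | a ∈ lE} ∧ block V 3 (x ++ y) = {a | a ∈ lF} ∧
        block V 5 (x ++ y) = E' ∧ insert ξ (Dom V x) ⊆ Dom V (x ++ y) ∧
        HasFresh A (baseConsts R C) K (x ++ y) ∧ ListsModel A R (x ++ y) := by
  classical
  obtain ⟨base, hbase⟩ : ∃ base : Finset V.Const, ∀ c, c ∈ base ↔ c ∈ baseConsts R C :=
    ⟨(finite_baseConsts hR hC).toFinset, by simp⟩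
  have hH := hR.image fun r => r.head.pred
  set H := (fun r : Rule V => r.head.pred) '' R with hHdef
  obtain ⟨G, hG⟩ := exists_length_bound (hA.union hH)
  obtain ⟨γ, hγ⟩ : ∃ γ, ∀ c ∈ base, (encodeSymbol c).length ≤ γ :=
    ⟨base.sup fun c => (encodeSymbol c).length, fun c hc =>
      Finset.le_sup (f := fun c => (encodeSymbol c).length) hc⟩
  -- All constants in use have codes of length at most `N`, and there are at most `N` of them.
  let N : Polynomial ℕ := Polynomial.X + Polynomial.C (base.card + γ + κ + K + 1)
  refine ⟨(G.comp N + G.comp N) + (N * (N + 1) + 3), ?_⟩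
  intro lB lO lE lF x hx E' ξ hE'fin hE'A hE' hξ
  obtain ⟨Dx, hDx, hDx'⟩ := exists_finset_dom (V := V) x
  obtain ⟨T, hTK, hT⟩ := exists_fresh_finset (insert ξ (Dx ∪ base)) (m := x.length + base.card + 1)
    ((Finset.card_insert_le _ _).trans (by have := Finset.card_union_le Dx base; omega)) K
  let D : Finset V.Const := insert ξ (Dx ∪ base) ∪ T
  have hNeval : N.eval x.length = x.length + (base.card + γ + κ + K + 1) := by simp [N]
  have hDcard : D.card ≤ N.eval x.length := by
    have h1 := Finset.card_union_le (insert ξ (Dx ∪ base)) T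
    have h2 := Finset.card_insert_le ξ (Dx ∪ base)
    have h3 := Finset.card_union_le Dx base
    change (insert ξ (Dx ∪ base) ∪ T).card ≤ _
    omega
  have hDlen : ∀ c ∈ D, (encodeSymbol c).length ≤ N.eval x.length := by
    intro c hc
    rw [hNeval]
    rcases Finset.mem_union.1 hc with hc | hc
    · rcases Finset.mem_insert.1 hc with rfl | hc
      · omega
      rcases Finset.mem_union.1 hc with hc | hc
      · have := length_encodeSymbol_le_of_mem_dom ((hDx c).1 hc)
        omega
      · have := hγ c hc
        omega
    · have := (hT c hc).2
      omega
  have hxD : ∀ c ∈ insert ξ (Dom V x), c ∈ D := by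
    rintro c (rfl | hc)
    · exact Finset.mem_union_left _ (Finset.mem_insert_self _ _)
    · exact Finset.mem_union_left _ (Finset.mem_insert_of_mem
        (Finset.mem_union_left _ ((hDx c).2 hc)))
  have hbD : ∀ c ∈ baseConsts R C, c ∈ D := fun c hc => Finset.mem_union_left _
    (Finset.mem_insert_of_mem (Finset.mem_union_right _ ((hbase c).2 hc)))
  -- The facts and the model.
  let S : Set (GroundAtom V) := {a | a.pred ∈ A ∧ (a ∈ lB ∨ a ∈ E') ∧ a ∉ lF}
  have hdomx : ∀ l ∈ [lB, lO, lE, lF], constsOf {a | a ∈ l} ⊆ Dom V x := by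
    intro l hl c hc
    rw [hx, dom_encodeSets]
    exact ⟨l, hl, hc⟩
  have hSx : constsOf S ⊆ insert ξ (Dom V x) := by
    rintro c ⟨a, ⟨-, ha | ha, -⟩, k, hk⟩
    · exact Or.inr (hdomx lB (by simp) ⟨a, ha, k, hk⟩)
    · exact hE' ⟨a, ha, k, hk⟩
  have hTD : ∀ c ∈ T, c ∈ (D : Set V.Const) ∧ c ∉ baseConsts R C ∪ constsOf S := by
    refine fun c hc => ⟨Finset.mem_union_right _ hc, ?_⟩
    have h1 := (hT c hc).1
    rintro (hc' | hc')
    · exact h1 (Finset.mem_insert_of_mem (Finset.mem_union_right _ ((hbase c).2 hc')))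
    · rcases hSx hc' with rfl | hc'
      · exact h1 (Finset.mem_insert_self _ _)
      · exact h1 (Finset.mem_insert_of_mem (Finset.mem_union_left _ ((hDx c).2 hc')))
  obtain ⟨M, hM⟩ := exists_stableOn Set.univ hstrat S
  have hMD : StableOn D R S (M ∩ overD D) := by
    refine hM.restrict hstrat hK0 hRK (Act := baseConsts R C ∪ constsOf S) ?_ T hTD hTK.ge
      (fun c hc => Or.inl (Or.inl hc)) fun c hc => Or.inr hc
    rintro c (hc | hc)
    · exact hbD c hc
    · exact hxD c (hSx hc)
  have hMQ : ∀ a ∈ M ∩ overD D, a.pred ∈ A ∪ H ∧ ∀ k, a.args k ∈ D := fun a ha =>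
    ⟨hM.pred_mem (A := A) (H := H) (fun r hr => ⟨r, hr, rfl⟩) (fun a ha => ha.1) ha.1, ha.2⟩
  obtain ⟨Q, hQ, -⟩ := exists_finset_atoms (hA.union hH) D
  have hfin : (M ∩ overD (D : Set V.Const)).Finite :=
    (Finset.finite_toSet Q).subset fun a ha => (hQ a).2 (hMQ a ha)
  obtain ⟨lM, hlM1, hlM2, hlM3⟩ := hMD.exists_list hfin
  let l5 := hE'fin.toFinset.toList
  have hl5 : ∀ a, a ∈ l5 ↔ a ∈ E' := by simp [l5]
  -- The certificate.
  let tail := encodeConsts D.toList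
  have htail : tail.head? = some Sym.set := rfl
  have htailD : Dom V tail = D := by
    rw [dom_encodeConsts]; ext c; simp
  have hxy : x ++ ([lM, l5].flatMap encodeSet ++ tail) =
      [lB, lO, lE, lF, lM, l5].flatMap encodeSet ++ tail := by
    rw [hx]; simp
  have hdom : Dom V (x ++ ([lM, l5].flatMap encodeSet ++ tail)) = D := by
    rw [hxy, dom_append (by rw [htail]; exact fun h => h), dom_encodeSets, htailD]
    refine Set.union_eq_self_of_subset_left ?_
    rintro c ⟨l, hl, hc⟩
    by_cases hl' : l ∈ [lB, lO, lE, lF]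
    · exact hxD c (Or.inr (hdomx l hl' hc))
    obtain ⟨a, ha, k, rfl⟩ := hc
    obtain rfl | rfl : l = lM ∨ l = l5 := by
      simp only [List.mem_cons, List.not_mem_nil, or_false] at hl hl'
      tauto
    · exact ((hlM2 a).1 ha).2 k
    · exact hxD _ (hE' ⟨a, (hl5 a).1 ha, k, rfl⟩)
  refine ⟨[lM, l5].flatMap encodeSet ++ tail, ?_, head?_encodeSets _ htail, ?_⟩
  · have h1 : (lM.flatMap encodeAtom).length ≤ G.eval (N.eval x.length) :=
      hG _ D hDcard hDlen lM hlM1 fun a ha => hMQ a ((hlM2 a).1 ha)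
    have h2 : (l5.flatMap encodeAtom).length ≤ G.eval (N.eval x.length) :=
      hG _ D hDcard hDlen l5 (Finset.nodup_toList _) fun a ha =>
        ⟨Or.inl (hE'A ((hl5 a).1 ha)), fun k => hxD _ (hE' ⟨a, (hl5 a).1 ha, k, rfl⟩)⟩
    have h3 : (D.toList.flatMap fun c => Sym.arg :: encodeSymbol c).length ≤
        N.eval x.length * (N.eval x.length + 1) :=
      (length_flatMap_le _ (fun c => Sym.arg :: encodeSymbol c) (m := N.eval x.length + 1) fun c hc =>
        Nat.succ_le_succ (hDlen c (Finset.mem_toList.1 hc))).trans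
        (Nat.mul_le_mul_right _ (by rw [Finset.length_toList]; exact hDcard))
    simp only [List.flatMap_cons, List.flatMap_nil, List.append_nil, encodeSet, tail, encodeConsts,
      List.length_append, List.length_cons, Polynomial.eval_add, Polynomial.eval_mul,
      Polynomial.eval_comp, Polynomial.eval_one, Polynomial.eval_ofNat]
    omega
  rw [hdom, hxy]
  have hb0 := block_encodeSets [] [lO, lE, lF, lM, l5] lB htail
  have hb1 := block_encodeSets [lB] [lE, lF, lM, l5] lO htail
  have hb2 := block_encodeSets [lB, lO] [lF, lM, l5] lE htail
  have hb3 := block_encodeSets [lB, lO, lE] [lM, l5] lF htail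
  have hb5 := block_encodeSets [lB, lO, lE, lF, lM] [] l5 htail
  have hb5' : {a | a ∈ l5} = E' := Set.ext hl5
  rw [hb5'] at hb5
  rw [hxy] at hdom
  simp only [List.nil_append, List.cons_append, List.length_cons, List.length_nil] at hb0 hb1 hb2 hb3 hb5
  generalize hw : [lB, lO, lE, lF, lM, l5].flatMap encodeSet ++ tail = w at *
  have hbase' : baseFacts A w = S := by
    ext a
    simp only [baseFacts, hb0, hb3, hb5, S, Set.mem_ofPred_eq]
  refine ⟨hb0, hb1, hb2, hb3, hb5, hxD, ?_, ?_⟩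
  · refine ⟨fun c hc => by rw [hdom]; exact hbD c hc, ?_⟩
    let e := Finset.equivFinOfCardEq hTK
    refine ⟨fun i => if hi : i < K then e.symm ⟨i, hi⟩ else e.symm ⟨0, hK0⟩, fun i => ?_,
      fun i hi j hj hij h => ?_, fun i hi => ?_⟩
    · rw [hdom]
      dsimp only
      split_ifs
      · exact (hTD _ (e.symm _).2).1
      · exact (hTD _ (e.symm _).2).1
    · simp only [hi, hj, dif_pos] at h
      have := e.symm.injective (Subtype.ext h)
      simp only [Fin.mk.injEq] at this
      exact hij this
    · simp only [hi, dif_pos]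
      have := (hTD _ (e.symm ⟨i, hi⟩).2).2
      refine ⟨fun h => this (Or.inl h), fun a _ _ ha k hk => this (Or.inr ?_)⟩
      rw [hbase'] at ha
      exact ⟨a, ha, k, hk⟩
  · refine listsModel_of_list (l := lM) (N := M ∩ overD D) (pre := [lB, lO, lE, lF].flatMap encodeSet)
      (post := [l5].flatMap encodeSet ++ tail) ?_ (countP_encodeSets _)
      (Or.inr (head?_encodeSets _ htail)) ?_ hlM2 ?_
    · rw [← hw]
      exact encodeSets_split [lB, lO, lE, lF] [l5] lM tail
    · rw [hdom, hbase']; exact hMD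
    · rw [hdom, hbase']; exact hlM3

end Abduction

/-! ### Completeness of certificates -/

namespace Abduction

variable {V : Vocabulary} {A H : Set V.Pred} {R : Set (Rule V)} {C : Set V.lang.Sentence}

/-- `(E, F)` is a constrained explanation for `O`, in terms of the sets `B`, `O`, `E` and `F`. -/
structure ConstrainedExplains (A : Set V.Pred) (R : Set (Rule V)) (C : Set V.lang.Sentence)
    (B O E F : Set (GroundAtom V)) : Prop where
  subB : B ⊆ groundAtoms A
  subO : O ⊆ groundAtoms Aᶜ
  explains : Explains A R C B O E F
  constrained : ∀ ξ, ξ ∉ usedConsts R C B O → ξ ∉ constsOf E →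
    ∀ f : Replacement E, ¬ Explains A R C B O (f.apply ξ) F

theorem exists_isTheory (hA : A.Finite) (hR : R.Finite) (hC : C.Finite)
    (hheads : ∀ r ∈ R, r.head.pred ∉ A) {B : Set (GroundAtom V)} (hB : B.Finite)
    (hBA : B ⊆ groundAtoms A) : ∃ T : AbductiveTheory V, IsTheory T A R C B := by
  refine ⟨⟨R ∪ facts B, A, C, hR.union (hB.image _), hA, hC, ?_⟩, hBA, rfl, rfl, rfl⟩
  rintro r (hr | ⟨a, -, rfl⟩) h
  · exact absurd h (hheads r hr)
  · exact ⟨a, rfl⟩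

theorem ConstrainedExplains.pred_mem [Nonempty V.Const] {B O E F : Set (GroundAtom V)}
    (h : ConstrainedExplains A R C B O E F) (hH : ∀ r ∈ R, r.head.pred ∈ H) :
    O ⊆ groundAtoms (A ∪ H) := by
  obtain ⟨M, hM, -, hOM⟩ := h.explains.supports
  refine hOM.trans (hM.pred_mem hH ?_)
  rintro a ⟨ha | ha, -⟩
  · exact h.subB ha
  · exact h.explains.subE ha

section

variable [Encodable V.Pred] [Denumerable V.Const]

theorem mem_constrainedCheck_iff (hA : A.Finite) (hR : R.Finite) (hC : C.Finite)
    (hstrat : Stratified R) (hheads : ∀ r ∈ R, r.head.pred ∉ A) (τ : AgreementKind)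
    (w : List Sym) : w ∈ ConstrainedCheck τ A R C ↔ ∃ lB lO lE lF : List (GroundAtom V),
      w = [lB, lO, lE, lF].flatMap encodeSet ∧
      ConstrainedExplains A R C {a | a ∈ lB} {a | a ∈ lO} {a | a ∈ lE} {a | a ∈ lF} := by
  constructor
  · rintro ⟨B, O, E, F, ⟨ls, hls, rfl⟩, hO, T, hT, hE⟩
    match ls, hls with
    | [lB, lO, lE, lF], hls =>
      simp only [List.map_cons, List.map_nil, List.cons.injEq, and_true] at hls
      obtain ⟨rfl, rfl, rfl, rfl⟩ := hls
      have := (isConstrainedExplanation_iff hstrat hheads hT τ _ _).1 hE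
      exact ⟨lB, lO, lE, lF, rfl, hT.1, hO.2, this.1, this.2⟩
  · rintro ⟨lB, lO, lE, lF, rfl, hB, hO, h1, h2⟩
    obtain ⟨T, hT⟩ := exists_isTheory hA hR hC hheads (List.finite_toSet lB) hB
    exact ⟨_, _, _, _, ⟨[lB, lO, lE, lF], rfl, rfl⟩, ⟨List.finite_toSet lO, hO⟩, T, hT,
      (isConstrainedExplanation_iff hstrat hheads hT τ _ _).2 ⟨h1, h2⟩⟩

theorem mem_constrainedExistence_iff (hA : A.Finite) (hR : R.Finite) (hC : C.Finite)
    (hstrat : Stratified R) (hheads : ∀ r ∈ R, r.head.pred ∉ A) (τ : AgreementKind)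
    (w : List Sym) : w ∈ ConstrainedExistence τ A R C ↔ ∃ lB lO : List (GroundAtom V),
      w = [lB, lO].flatMap encodeSet ∧
      ∃ E F, ConstrainedExplains A R C {a | a ∈ lB} {a | a ∈ lO} E F := by
  constructor
  · rintro ⟨B, O, ⟨ls, hls, rfl⟩, hO, T, hT, E, F, hE⟩
    match ls, hls with
    | [lB, lO], hls =>
      simp only [List.map_cons, List.map_nil, List.cons.injEq, and_true] at hls
      obtain ⟨rfl, rfl⟩ := hls
      have := (isConstrainedExplanation_iff hstrat hheads hT τ _ _).1 hE
      exact ⟨lB, lO, rfl, _, _, hT.1, hO.2, this.1, this.2⟩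
  · rintro ⟨lB, lO, rfl, E, F, hB, hO, h1, h2⟩
    obtain ⟨T, hT⟩ := exists_isTheory hA hR hC hheads (List.finite_toSet lB) hB
    exact ⟨_, _, ⟨[lB, lO], rfl, rfl⟩, ⟨List.finite_toSet lO, hO⟩, T, hT, _, _,
      (isConstrainedExplanation_iff hstrat hheads hT τ _ _).2 ⟨h1, h2⟩⟩

/-- Certificates are complete: if the sets that are encoded by `x` are no positive instance, then
there is a certificate of polynomial length. -/
theorem exists_refutation (hA : A.Finite) (hR : R.Finite) (hC : C.Finite)
    (hstrat : Stratified R) {K : ℕ} (hK0 : 0 < K) (hRK : ∀ r ∈ R, r.VarsLt K)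
    (hCK : ∀ φ ∈ C, foDepth φ ≤ K) (hHA : ∀ p ∈ H, p ∉ A) :
    ∃ p : Polynomial ℕ, ∀ (lB lO lE lF : List (GroundAtom V)) (x : List Sym),
      x = [lB, lO, lE, lF].flatMap encodeSet →
      (∀ l ∈ [lB, lO, lE, lF], ∀ a ∈ l, a.pred ∈ A ∪ H) →
      ¬ ConstrainedExplains A R C {a | a ∈ lB} {a | a ∈ lO} {a | a ∈ lE} {a | a ∈ lF} →
      ∃ y : List Sym, y.length ≤ p.eval x.length ∧ y.head? = some Sym.set ∧
        Refutes A H R C K (x ++ y) := by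
  classical
  obtain ⟨base, hbase⟩ : ∃ base : Finset V.Const, ∀ c, c ∈ base ↔ c ∈ baseConsts R C :=
    ⟨(finite_baseConsts hR hC).toFinset, by simp⟩
  obtain ⟨p, hp⟩ := exists_certificate (A := A) hA hR hstrat hC hK0 hRK (base.card + 1)
  refine ⟨p, fun lB lO lE lF x hx hpred hcon => ?_⟩
  have hdomx : ∀ l ∈ [lB, lO, lE, lF], constsOf {a | a ∈ l} ⊆ Dom V x := by
    intro l hl c hc
    rw [hx, dom_encodeSets]
    exact ⟨l, hl, hc⟩
  obtain ⟨Dx, hDx, hDx'⟩ := exists_finset_dom (V := V) x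
  obtain ⟨T, hTK, hT⟩ := exists_fresh_finset (Dx ∪ base) (m := x.length + base.card)
    ((Finset.card_union_le _ _).trans (by omega)) 1
  obtain ⟨ξ, hξT⟩ := Finset.card_pos.1 (hTK ▸ Nat.one_pos : 0 < T.card)
  obtain ⟨hξ, hξlen⟩ := hT ξ hξT
  rw [Finset.mem_union, hDx, hbase, not_or] at hξ
  have hused : ξ ∉ usedConsts R C {a | a ∈ lB} {a | a ∈ lO} := by
    rintro (h | h | h)
    · exact hξ.2 h
    · exact hξ.1 (hdomx lB (by simp) h)
    · exact hξ.1 (hdomx lO (by simp) h)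
  have hξE : ξ ∉ constsOf {a | a ∈ lE} := fun h => hξ.1 (hdomx lE (by simp) h)
  have hsub : ∀ l ∈ [lB, lO, lE, lF], {a | a ∈ l} ⊆ groundAtoms (A ∪ H) := fun l hl a ha =>
    hpred l hl a ha
  by_cases hcase : ({a | a ∈ lB} ⊆ groundAtoms A ∧ {a | a ∈ lO} ⊆ groundAtoms Aᶜ ∧
      Explains A R C {a | a ∈ lB} {a | a ∈ lO} {a | a ∈ lE} {a | a ∈ lF}) ∧
      ∃ f : Replacement {a | a ∈ lE},
        Explains A R C {a | a ∈ lB} {a | a ∈ lO} (f.apply ξ) {a | a ∈ lF}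
  · obtain ⟨⟨hB, -, hE⟩, f, hf⟩ := hcase
    have hrep := f.isReplaced hξE
    have hconsts : constsOf (f.apply ξ) ⊆ insert ξ (Dom V x) := by
      rintro c ⟨a, ha, k, rfl⟩
      by_cases hk : a.args k = ξ
      · exact Or.inl hk
      · refine Or.inr (hdomx lE (by simp) ⟨_, hrep.maps a ha, k, if_neg hk⟩)
    obtain ⟨y, hy, hy0, b0, b1, b2, b3, b5, hdom, hfresh, hlist⟩ := hp lB lO lE lF x hx (f.apply ξ)
      ξ hf.finE hf.subE hconsts (by omega)
    refine ⟨y, hy, hy0, hfresh, Or.inr ⟨hlist, Or.inr ⟨⟨ξ, hdom (Or.inl rfl), f.c, hdom (Or.inr ?_),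
      ?_, ?_⟩, ?_⟩⟩⟩
    · obtain ⟨a, ha, k, hk⟩ := hrep.mem
      exact hdomx lE (by simp) ⟨_, hrep.maps a ha, k, if_pos hk⟩
    · rw [freshIn_iff, b0, b1, b2]
      · exact ⟨hused, hξE⟩
      · rw [b0]; exact hsub lB (by simp)
      · rw [b1]; exact hsub lO (by simp)
      · rw [b2]; exact hsub lE (by simp)
    · have hcand : candidate A (x ++ y) = f.apply ξ := by
        rw [candidate, b5]
        exact Set.ext fun a => ⟨fun h => h.2, fun h => ⟨hf.subE h, h⟩⟩
      rw [replacedBlocks_iff, hcand, b2]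
      · exact hrep
      · rw [b2]; exact hE.subE
    · have hcand : candidate A (x ++ y) = f.apply ξ := by
        rw [candidate, b5]
        exact Set.ext fun a => ⟨fun h => h.2, fun h => ⟨hf.subE h, h⟩⟩
      rw [hlist.modelOk_iff hK0 hstrat hRK hCK hfresh, baseFacts_eq, b0, b1, b3, hcand]
      · exact hf.supports
      · rw [b0]; exact hB
      · rw [b1]; exact hsub lO (by simp)
  · obtain ⟨y, hy, hy0, b0, b1, b2, b3, b5, hdom, hfresh, hlist⟩ := hp lB lO lE lF x hx
      {a | a ∈ lE ∧ a.pred ∈ A} ξ ((List.finite_toSet lE).subset fun a ha => ha.1)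
      (fun a ha => ha.2)
      (fun c ⟨a, ha, hc⟩ => Or.inr (hdomx lE (by simp) ⟨a, ha.1, hc⟩)) (by omega)
    refine ⟨y, hy, hy0, hfresh, ?_⟩
    by_cases hin : InputOk A H (x ++ y)
    · refine Or.inr ⟨hlist, Or.inl ⟨fun a _ ha => ?_, fun hok => ?_⟩⟩
      · rw [b5, b2]
        exact ⟨fun h => h.1, fun h => ⟨h, ha⟩⟩
      rw [inputOk_iff hHA, b0, b1, b2, b3] at hin
      · obtain ⟨hB, hO, hE, hF, hEF, hFB⟩ := hin
        have hcand : candidate A (x ++ y) = {a | a ∈ lE} := by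
          rw [candidate, b5]
          exact Set.ext fun a => ⟨fun h => h.2.1, fun h => ⟨hE h, h, hE h⟩⟩
        rw [hlist.modelOk_iff hK0 hstrat hRK hCK hfresh, baseFacts_eq, b0, b1, b3, hcand] at hok
        · have hexp : Explains A R C {a | a ∈ lB} {a | a ∈ lO} {a | a ∈ lE} {a | a ∈ lF} :=
            ⟨List.finite_toSet _, List.finite_toSet _, hE, hF, hEF, hFB, hok⟩
          refine hcon ⟨hB, hO, hexp, fun ξ' h1 h2 f hf => hcase ⟨⟨hB, hO, hexp⟩, ?_⟩⟩
          -- The fresh constant of the replacement may be swapped with `ξ`.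
          obtain ⟨f', hf'⟩ := (f.isReplaced h2).comap h2 hξE
          refine ⟨f', ?_⟩
          rw [hf']
          refine hf.comap fun c hc => Equiv.swap_apply_of_ne_of_ne ?_ ?_
          · rintro rfl; exact h1 hc
          · rintro rfl; exact hused hc
        · rw [b0]; exact hB
        · rw [b1]; exact hsub lO (by simp)
      · rw [b0]; exact hsub lB (by simp)
      · rw [b2]; exact hsub lE (by simp)
      · rw [b3]; exact hsub lF (by simp)
    · exact Or.inl hin

end

end Abduction

/-! ### The verifier -/

namespace Abduction

open WordLogic

instance : Inhabited Sym := ⟨.set⟩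

open Classical in
noncomputable instance : Fintype Sym where
  elems := {.bit true, .bit false, .set, .atom, .arg}
  complete s := by
    rcases s with (_ | _) | _ | _ | _ <;> simp

/-- The word that results from a pair of words by concatenation. -/
def erase : Sym ⊕ Sym → Sym := Sum.elim id id

/-- The letter belongs to the first word of a pair. -/
def IsLeft {Γ Δ : Type} : Option (Γ ⊕ Δ) → Prop
  | some (.inl _) => True
  | _ => False

theorem map_erase_pairWord (x y : List Sym) : (pairWord x y).map erase = x ++ y := by
  simp [pairWord, erase, Function.comp_def]

theorem length_pairWord {Γ Δ : Type} (x : List Γ) (y : List Δ) :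
    (pairWord x y).length = x.length + y.length := by simp [pairWord]

theorem getElem?_pairWord_inl {Γ Δ : Type} (x : List Γ) (y : List Δ) (i : ℕ) (a : Γ) :
    (pairWord x y)[i]? = some (.inl a) ↔ x[i]? = some a := by
  by_cases h : i < x.length
  · simp [pairWord, List.getElem?_append_left, h]
  · rw [List.getElem?_eq_none (l := x) (by omega), pairWord,
      List.getElem?_append_right (by simpa using h), List.getElem?_map]
    rcases y[i - (x.map Sum.inl).length]? with _ | b <;> simp

theorem isLeft_pairWord {Γ Δ : Type} (x : List Γ) (y : List Δ) (i : ℕ) :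
    IsLeft (pairWord x y)[i]? ↔ i < x.length := by
  by_cases h : i < x.length
  · simp [pairWord, List.getElem?_append_left, h, IsLeft]
  · rw [pairWord, List.getElem?_append_right (by simpa using h), List.getElem?_map]
    simp only [h, iff_false]
    rcases y[i - (x.map Sum.inl).length]? with _ | b <;> exact fun h => h

/-- At position `i`, the second word of a pair begins, and it begins with a mark of a set. -/
def SecondAt (w : List (Sym ⊕ Sym)) (i : ℕ) : Prop :=
  w[i]? = some (.inr .set) ∧ ∀ j ≤ w.length, j < i → IsLeft w[j]?

theorem secondAt_pairWord (x y : List Sym) (i : ℕ) :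
    SecondAt (pairWord x y) i ↔ i = x.length ∧ y.head? = some Sym.set := by
  simp only [SecondAt, isLeft_pairWord]
  constructor
  · rintro ⟨h1, h2⟩
    have hi : ¬ i < x.length := by
      rw [← isLeft_pairWord x y i, h1]; exact fun h => h
    have hlt : i < (pairWord x y).length := (List.getElem?_eq_some_iff.1 h1).1
    obtain rfl : i = x.length := by
      rcases Nat.lt_or_ge x.length i with h | h
      · exact absurd (h2 x.length (by omega) h) (by omega)
      · omega
    refine ⟨rfl, ?_⟩
    rw [pairWord, List.getElem?_append_right (by simp), List.getElem?_map] at h1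
    simp only [List.length_map, Nat.sub_self] at h1
    rw [List.head?_eq_getElem?]
    rcases hy : y[0]? with _ | b
    · rw [hy] at h1; simp at h1
    · rw [hy] at h1; simpa using h1
  · rintro ⟨rfl, h⟩
    refine ⟨?_, fun j _ hj => hj⟩
    rw [pairWord, List.getElem?_append_right (by simp), List.getElem?_map]
    rw [List.head?_eq_getElem?] at h
    simp [h]

theorem fo_secondAt (i : ℕ) : FO fun (w : List (Sym ⊕ Sym)) v => SecondAt w (v i) :=
  (FO.letter (· = some (Sum.inr Sym.set)) (Tm.var i)).and
    (FO.all (P := fun w v j => j < v i → IsLeft w[j]?)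
      ((FO.lt 0 (i + 1)).imp (FO.letter IsLeft (Tm.var 0))))

variable {V : Vocabulary} [Encodable V.Pred] [Denumerable V.Const]

/-- The first word of the pair is an encoding of four sets of atoms with predicates in `Q`. -/
structure WellFormed (Q : Set V.Pred) (w : List (Sym ⊕ Sym)) : Prop where
  first : (w.map erase)[0]? = some Sym.set
  sets : ∀ i ≤ w.length, IsLeft w[i]? → (w.map erase)[i]? = some Sym.set →
    (w.map erase)[i + 1]? = some Sym.set ∨ (w.map erase)[i + 1]? = some Sym.atom
  atoms : ∀ i ≤ w.length, IsLeft w[i]? → (w.map erase)[i]? = some Sym.atom →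
    ∃ p ∈ Q, ∃ a : GroundAtom V, a.pred = p ∧ Occ (w.map erase) i a
  count : ∃ i ≤ w.length, SecondAt w i ∧ ((w.map erase).take i).countP isSet = 4

/-- Whether a pair is well-formed does not depend on its second word, as long as that begins with a
mark of a set. -/
theorem wellFormed_iff {Q : Set V.Pred} {x y : List Sym} (hy : y.head? = some Sym.set) : WellFormed Q (pairWord x y) ↔
      ∃ l₀ l₁ l₂ l₃ : List (GroundAtom V), x = [l₀, l₁, l₂, l₃].flatMap encodeSet ∧
        ∀ l ∈ [l₀, l₁, l₂, l₃], ∀ a ∈ l, a.pred ∈ Q := by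
  have hlen := length_pairWord x y
  constructor
  · rintro ⟨h1, h2, h3, i, -, h4, h5⟩
    simp only [map_erase_pairWord, isLeft_pairWord, secondAt_pairWord] at h1 h2 h3 h4 h5
    obtain ⟨rfl, -⟩ := h4
    rw [List.take_left] at h5
    have hxpos : 0 < x.length := by
      rw [List.length_pos_iff]
      rintro rfl
      simp at h5
    rw [List.getElem?_append_left hxpos] at h1
    obtain ⟨ls, hls, hQ⟩ := exists_encodeSets (V := V) (Q := Q) hy h1
      (fun i hi => h2 i (by omega) hi) fun i hi ha => by
        obtain ⟨p, hp, a, rfl, ha⟩ := h3 i (by omega) hi ha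
        exact ⟨a, hp, ha⟩
    rw [hls, countP_encodeSets] at h5
    match ls, h5 with
    | [l₀, l₁, l₂, l₃], _ => exact ⟨l₀, l₁, l₂, l₃, hls, hQ⟩
  · rintro ⟨l₀, l₁, l₂, l₃, hls, hQ⟩
    have hspec := fun {i} hi => encodeSets_spec (ls := [l₀, l₁, l₂, l₃]) hy (i := i) hi
    rw [← hls] at hspec
    have hxpos : 0 < x.length := by rw [hls]; simp [encodeSet]
    refine ⟨?_, fun i _ hi => ?_, fun i _ hi ha => ?_, x.length, by omega, ?_, ?_⟩
    · rw [map_erase_pairWord, List.getElem?_append_left hxpos, hls]; rfl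
    · rw [map_erase_pairWord]
      exact (hspec ((isLeft_pairWord _ _ _).1 hi)).1
    · rw [map_erase_pairWord] at ha ⊢
      obtain ⟨l, hl, a, ha, hocc⟩ := (hspec ((isLeft_pairWord _ _ _).1 hi)).2 ha
      exact ⟨_, hQ l hl a ha, a, rfl, hocc⟩
    · exact (secondAt_pairWord _ _ _).2 ⟨rfl, hy⟩
    · rw [map_erase_pairWord, List.take_left, hls, countP_encodeSets]; rfl

/-- The pairs of a word that is no positive instance and a certificate for that. -/
def Verified (A H : Set V.Pred) (R : Set (Rule V)) (C : Set V.lang.Sentence) (K : ℕ)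
    (w : List (Sym ⊕ Sym)) : Prop :=
  (∃ i ≤ w.length, SecondAt w i) ∧ (¬ WellFormed (A ∪ H) w ∨ Refutes A H R C K (w.map erase))

omit [Encodable V.Pred] in
/-- Unlike `CDef`, this does not presuppose that the word contains constants. -/
theorem fo_exists_argsAt (n : ℕ) {t : (ℕ → ℕ) → ℕ} (ht : Tm t) :
    FO fun w v => ∃ l : List V.Const, l.length = n ∧ ArgsAt w (t v) l := by
  induction n generalizing t with
  | zero =>
    refine (FO.letter IsAtomEnd ht).congr fun w v _ => ?_
    simp [List.length_eq_zero_iff, argsAt_nil]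
  | succ n ih =>
    refine (FO.ex (P := fun w v m => RunAt w (t v) m ∧ (∃ c : V.Const, CAt w (t v) c) ∧
      ∃ l : List V.Const, l.length = n ∧ ArgsAt w (t v + 1 + m) l)
      ((fo_runAt ht.shift 0).and ((fo_exists_cAt (V := V) ht.shift).and
        (ih ((ht.shift.add (Tm.const 1)).add (Tm.var 0)))))).congr fun w v _ => ?_
    constructor
    · rintro ⟨l, hl, h⟩
      match l, hl with
      | c :: l, hl =>
        rw [argsAt_cons] at h
        exact ⟨_, by have := h.1.runAt.le; omega, h.1.runAt, ⟨c, h.1⟩, l, by simpa using hl, h.2⟩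
    · rintro ⟨m, -, hm, ⟨c, hc⟩, l, rfl, hl⟩
      rw [hm.unique hc.runAt] at hl
      exact ⟨c :: l, rfl, (argsAt_cons _ _ _ _).2 ⟨hc, hl⟩⟩

theorem fo_exists_occ (p : V.Pred) {t : (ℕ → ℕ) → ℕ} (ht : Tm t) :
    FO fun w v => ∃ a : GroundAtom V, a.pred = p ∧ Occ w (t v) a := by
  refine ((FO.letter (· = some Sym.atom) ht).and
    ((fo_startsWith (encodeSymbol p) (ht.add (Tm.const 1))).and
      (fo_exists_argsAt (V := V) (V.arity p) ((ht.add (Tm.const 1)).add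
        (Tm.const (encodeSymbol p).length))))).congr fun w v _ => ?_
  constructor
  · rintro ⟨⟨q, x⟩, rfl, h⟩
    rw [occ_iff] at h
    exact ⟨h.1, h.2.1, _, List.length_ofFn, h.2.2⟩
  · rintro ⟨h1, h2, l, hl, h3⟩
    refine ⟨⟨p, fun k => l[k.1]⟩, rfl, (occ_iff _ _ _).2 ⟨h1, h2, ?_⟩⟩
    have : List.ofFn (fun k : Fin (V.arity p) => l[k.1]) = l :=
      List.ext_getElem (by simp [hl]) fun i _ _ => by simp
    rw [this]
    exact h3

theorem fo_wellFormed {Q : Set V.Pred} (hQ : Q.Finite) :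
    FO fun (w : List (Sym ⊕ Sym)) _ => WellFormed Q w := by
  have letter : ∀ (a : Sym) {t : (ℕ → ℕ) → ℕ}, Tm t →
      FO fun (w : List (Sym ⊕ Sym)) v => (w.map erase)[t v]? = some a := fun a _ ht =>
    (FO.letter (· = some a) ht).comap erase
  have left : FO fun (w : List (Sym ⊕ Sym)) v => IsLeft w[v 0]? := FO.letter IsLeft (Tm.var 0)
  have h1 : FO fun (w : List (Sym ⊕ Sym)) _ => (w.map erase)[0]? = some Sym.set :=
    letter _ (Tm.const 0)
  have h2 : FO fun (w : List (Sym ⊕ Sym)) _ => ∀ i ≤ w.length, IsLeft w[i]? →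
      (w.map erase)[i]? = some Sym.set →
      (w.map erase)[i + 1]? = some Sym.set ∨ (w.map erase)[i + 1]? = some Sym.atom :=
    FO.all (left.imp ((letter _ (Tm.var 0)).imp ((letter _ ((Tm.var 0).add (Tm.const 1))).or
      (letter _ ((Tm.var 0).add (Tm.const 1))))))
  have h3 : FO fun (w : List (Sym ⊕ Sym)) _ => ∀ i ≤ w.length, IsLeft w[i]? →
      (w.map erase)[i]? = some Sym.atom →
      ∃ p ∈ Q, ∃ a : GroundAtom V, a.pred = p ∧ Occ (w.map erase) i a := by
    refine FO.all (left.imp ((letter _ (Tm.var 0)).imp ?_))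
    exact (FO.exists_mem_list hQ.toFinset.toList fun p _ =>
      (fo_exists_occ p (Tm.var 0)).comap erase).congr fun w v _ => by simp
  have h4 : FO fun (w : List (Sym ⊕ Sym)) _ => ∃ i ≤ w.length, SecondAt w i ∧
      ((w.map erase).take i).countP isSet = 4 :=
    FO.ex ((fo_secondAt 0).and ((fo_countP 4 0).comap erase))
  exact (h1.and (h2.and (h3.and h4))).congr fun _ _ _ =>
    ⟨fun h => ⟨h.1, h.2, h.3, h.4⟩, fun h => ⟨h.1, h.2.1, h.2.2.1, h.2.2.2⟩⟩

theorem fo_verified {A H : Set V.Pred} {R : Set (Rule V)} {C : Set V.lang.Sentence} {K : ℕ}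
    (hA : A.Finite) (hH : H.Finite) (hR : R.Finite) (hC : C.Finite) :
    FO fun (w : List (Sym ⊕ Sym)) _ => Verified A H R C K w := by
  have h : FO fun (w : List Sym) _ => Refutes A H R C K w :=
    (CDef.refutes hA hH hR hC K).fo.congr fun w _ _ =>
      ⟨fun h => ⟨by obtain ⟨-, θ, hθ, -⟩ := h.1; exact ⟨θ 0, hθ 0⟩, h⟩, fun h => h.2⟩
  exact (FO.ex (fo_secondAt 0)).and ((fo_wellFormed (hA.union hH)).not.or (h.comap erase))

section

variable {A : Set V.Pred} {R : Set (Rule V)} {C : Set V.lang.Sentence}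

/-- Exactly the words that are no positive instance have a certificate, of polynomial length. -/
theorem isPolyProjection_verified (hA : A.Finite) (hR : R.Finite) (hC : C.Finite)
    (hstrat : Stratified R) (hheads : ∀ r ∈ R, r.head.pred ∉ A) (τ : AgreementKind) {H : Set V.Pred}
    (hH : ∀ r ∈ R, r.head.pred ∈ H) (hHA : ∀ p ∈ H, p ∉ A)
    {K : ℕ} (hK0 : 0 < K) (hRK : ∀ r ∈ R, r.VarsLt K) (hCK : ∀ φ ∈ C, foDepth φ ≤ K) :
    IsPolyProjection (ConstrainedCheck τ A R C)ᶜ {w | Verified A H R C K w} := by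
  obtain ⟨p, hp⟩ := exists_refutation (H := H) hA hR hC hstrat hK0 hRK hCK hHA
  refine ⟨p + 1, fun x => ?_⟩
  simp only [Set.mem_compl_iff, mem_constrainedCheck_iff hA hR hC hstrat hheads, Set.mem_ofPred_eq]
  constructor
  · intro hx
    by_cases hwf : WellFormed (A ∪ H) (pairWord x [Sym.set])
    · obtain ⟨l₀, l₁, l₂, l₃, hls, hQ⟩ := (wellFormed_iff rfl).1 hwf
      obtain ⟨y, hy, hy0, hr⟩ := hp l₀ l₁ l₂ l₃ x hls hQ
        fun h => hx ⟨l₀, l₁, l₂, l₃, hls, h⟩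
      refine ⟨y, by simp; omega, ⟨x.length, by rw [length_pairWord]; omega,
        (secondAt_pairWord _ _ _).2 ⟨rfl, hy0⟩⟩, Or.inr ?_⟩
      rwa [map_erase_pairWord]
    · refine ⟨[Sym.set], by simp, ⟨x.length, by rw [length_pairWord]; omega,
        (secondAt_pairWord _ _ _).2 ⟨rfl, rfl⟩⟩, Or.inl hwf⟩
  · rintro ⟨y, -, ⟨i, -, hi⟩, h⟩ ⟨lB, lO, lE, lF, hls, hcon⟩
    obtain ⟨rfl, hy⟩ := (secondAt_pairWord _ _ _).1 hi
    have hpred : ∀ l ∈ [lB, lO, lE, lF], ∀ a ∈ l, a.pred ∈ A ∪ H := by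
      intro l hl a ha
      simp only [List.mem_cons, List.not_mem_nil, or_false] at hl
      rcases hl with rfl | rfl | rfl | rfl
      · exact Or.inl (hcon.subB ha)
      · exact hcon.pred_mem hH ha
      · exact Or.inl (hcon.explains.subE ha)
      · exact Or.inl (hcon.explains.subF ha)
    have hr := h.resolve_left (not_not_intro ((wellFormed_iff hy).2 ⟨_, _, _, _, hls, hpred⟩))
    rw [map_erase_pairWord] at hr
    have b : x ++ y = [lB, lO, lE, lF].flatMap encodeSet ++ y := by rw [hls]
    have b0 : block V 0 (x ++ y) = _ := b ▸ block_encodeSets [] [lO, lE, lF] lB hy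
    have b1 : block V 1 (x ++ y) = _ := b ▸ block_encodeSets [lB] [lE, lF] lO hy
    have b2 : block V 2 (x ++ y) = _ := b ▸ block_encodeSets [lB, lO] [lF] lE hy
    have b3 : block V 3 (x ++ y) = _ := b ▸ block_encodeSets [lB, lO, lE] [] lF hy
    have key := hr.exists_replacement hK0 hstrat hRK hCK hH hHA
    rw [b0, b1, b2, b3] at key
    obtain ⟨ξ, h1, h2, f, hf⟩ := key hcon.subB hcon.subO hcon.explains
    exact hcon.constrained ξ h1 h2 f hf

/-! ### The complexity classes -/

/-- The pairs of an input for the existence problem and a constrained explanation: together they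
are a positive instance of the verification problem, and the first word has two sets. -/
def ExplanationPairs (τ : AgreementKind) (A : Set V.Pred) (R : Set (Rule V))
    (C : Set V.lang.Sentence) : Set (List (Sym ⊕ Sym)) :=
  {w | (∃ i ≤ w.length, SecondAt w i ∧ ((w.map erase).take i).countP isSet = 2) ∧
    w.map erase ∈ ConstrainedCheck τ A R C}

/-- Constrained explanations have polynomial length, since their constants are among those of the
input and of the fixed program and constraints. -/
theorem isPolyProjection_explanationPairs (hA : A.Finite) (hR : R.Finite) (hC : C.Finite)
    (hstrat : Stratified R) (hheads : ∀ r ∈ R, r.head.pred ∉ A) (τ : AgreementKind) :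
    IsPolyProjection (ConstrainedExistence τ A R C) (ExplanationPairs τ A R C) := by
  classical
  obtain ⟨base, hbase⟩ : ∃ base : Finset V.Const, ∀ c, c ∈ base ↔ c ∈ baseConsts R C :=
    ⟨(finite_baseConsts hR hC).toFinset, by simp⟩
  obtain ⟨G, hG⟩ := exists_length_bound hA
  obtain ⟨γ, hγ⟩ : ∃ γ, ∀ c ∈ base, (encodeSymbol c).length ≤ γ :=
    ⟨base.sup fun c => (encodeSymbol c).length, fun c hc =>
      Finset.le_sup (f := fun c => (encodeSymbol c).length) hc⟩
  let N : Polynomial ℕ := Polynomial.X + Polynomial.C (base.card + γ)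
  refine ⟨G.comp N + G.comp N + 2, fun x => ?_⟩
  rw [mem_constrainedExistence_iff hA hR hC hstrat hheads]
  constructor
  · rintro ⟨lB, lO, hx, E, F, h⟩
    obtain ⟨Dx, hDx, hDx'⟩ := exists_finset_dom (V := V) x
    have hNeval : N.eval x.length = x.length + (base.card + γ) := by simp [N]
    have hBx : constsOf {a | a ∈ lB} ⊆ Dom V x := fun c hc => by
      rw [hx, dom_encodeSets]
      exact ⟨lB, by simp, hc⟩
    have hOx : constsOf {a | a ∈ lO} ⊆ Dom V x := fun c hc => by
      rw [hx, dom_encodeSets]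
      exact ⟨lO, by simp, hc⟩
    have hused : usedConsts R C {a | a ∈ lB} {a | a ∈ lO} ⊆ (Dx ∪ base : Finset V.Const) := by
      rintro c (hc | hc | hc)
      · exact Finset.mem_union_right _ ((hbase c).2 hc)
      · exact Finset.mem_union_left _ ((hDx c).2 (hBx hc))
      · exact Finset.mem_union_left _ ((hDx c).2 (hOx hc))
    have hlen : ∀ S : Set (GroundAtom V), ∀ hS : S.Finite, S ⊆ groundAtoms A →
        constsOf S ⊆ usedConsts R C {a | a ∈ lB} {a | a ∈ lO} →
        (hS.toFinset.toList.flatMap encodeAtom).length ≤ G.eval (N.eval x.length) := by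
      intro S hS hSA hSu
      refine hG _ (Dx ∪ base) ?_ (fun c hc => ?_) _ (Finset.nodup_toList _) fun a ha => ?_
      · have := Finset.card_union_le Dx base
        omega
      · rw [hNeval]
        rcases Finset.mem_union.1 hc with hc | hc
        · have := length_encodeSymbol_le_of_mem_dom ((hDx c).1 hc)
          omega
        · have := hγ c hc
          omega
      · have ha : a ∈ S := by simpa using ha
        exact ⟨hSA ha, fun k => hused (hSu ⟨a, ha, k, rfl⟩)⟩
    have hE := h.explains.finE
    have hF := h.explains.finF
    have h1 := hlen E hE h.explains.subE (constsOf_subset_usedConsts hR hC (List.finite_toSet lB)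
      (List.finite_toSet lO) h.explains h.constrained)
    have h2 := hlen F hF h.explains.subF fun c ⟨a, ha, hc⟩ =>
      Or.inr (Or.inl ⟨a, h.explains.subB ha, hc⟩)
    refine ⟨[hE.toFinset.toList, hF.toFinset.toList].flatMap encodeSet, ?_,
      ⟨x.length, by rw [length_pairWord]; omega, (secondAt_pairWord _ _ _).2 ⟨rfl, rfl⟩, ?_⟩, ?_⟩
    · simp only [List.flatMap_cons, List.flatMap_nil, List.append_nil, encodeSet,
        List.length_append, List.length_cons, Polynomial.eval_add,
        Polynomial.eval_comp, Polynomial.eval_ofNat]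
      omega
    · rw [map_erase_pairWord, List.take_left, hx, countP_encodeSets]; rfl
    · rw [map_erase_pairWord, mem_constrainedCheck_iff hA hR hC hstrat hheads]
      refine ⟨lB, lO, hE.toFinset.toList, hF.toFinset.toList, by rw [hx]; simp, ?_⟩
      have e1 : {a | a ∈ hE.toFinset.toList} = E := by ext; simp
      have e2 : {a | a ∈ hF.toFinset.toList} = F := by ext; simp
      rwa [e1, e2]
  · rintro ⟨y, -, ⟨i, -, hi, hcount⟩, hcheck⟩
    rw [map_erase_pairWord] at hcount hcheck
    obtain ⟨rfl, hy⟩ := (secondAt_pairWord _ _ _).1 hi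
    rw [mem_constrainedCheck_iff hA hR hC hstrat hheads] at hcheck
    obtain ⟨lB, lO, lE, lF, hxy, hcon⟩ := hcheck
    refine ⟨lB, lO, ?_, _, _, hcon⟩
    rw [List.take_left] at hcount
    -- The third mark of a set is at the end of both `x` and the code of the first two sets.
    have hsplit : x ++ y = [lB, lO].flatMap encodeSet ++ [lE, lF].flatMap encodeSet := by
      rw [hxy]; simp
    have hc2 := countP_encodeSets [lB, lO]
    have hset : ∀ {u v : List Sym}, v.head? = some Sym.set →
        ∀ {s t : List Sym}, u ++ v = s ++ t → u.countP isSet = s.countP isSet →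
          s.length ≤ u.length := by
      intro u v hv s t h hcard
      by_contra hlt
      obtain ⟨r, rfl⟩ : ∃ r, s = u ++ r := by
        obtain ⟨r, hr⟩ := List.prefix_of_prefix_length_le (List.prefix_append u v)
          (h ▸ List.prefix_append s t) (by omega)
        exact ⟨r, hr.symm⟩
      rw [List.append_assoc, List.append_cancel_left_eq] at h
      cases r with
      | nil => simp at hlt
      | cons b r =>
        rw [h] at hv
        obtain rfl : b = Sym.set := by simpa using hv
        simp [isSet] at hcard
    have hle1 := hset hy hsplit (by rw [hcount, hc2]; rfl)
    have hle2 := hset rfl hsplit.symm (by rw [hcount, hc2]; rfl)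
    exact (List.append_inj hsplit (le_antisymm hle2 hle1)).1

/-- In a triple of words, the first word has two sets, and the second one begins with a mark of a
set. -/
def HasTwoSets (w : List ((Sym ⊕ Sym) ⊕ Sym)) : Prop :=
  ∃ i ≤ w.length, (w[i]? = some (.inl (.inr .set)) ∧
      ∀ j ≤ w.length, j < i → ∃ s, w[j]? = some (.inl (.inl s))) ∧
    ((w.map (Sum.elim erase id)).take i).countP isSet = 2

theorem fo_hasTwoSets : FO fun (w : List ((Sym ⊕ Sym) ⊕ Sym)) _ => HasTwoSets w :=
  FO.ex (((FO.letter (· = some (Sum.inl (Sum.inr Sym.set))) (Tm.var 0)).and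
    (FO.all ((FO.lt 0 1).imp (FO.letter (fun o => ∃ s, o = some (Sum.inl (Sum.inl s)))
      (Tm.var 0))))).and ((fo_countP 2 0).comap (Sum.elim erase id)))

theorem hasTwoSets_pairWord_iff (x : List (Sym ⊕ Sym)) (y : List Sym) :
    HasTwoSets (pairWord x y) ↔
    ∃ i ≤ x.length, SecondAt x i ∧ ((x.map erase).take i).countP isSet = 2 := by
  have hleft : ∀ o : Option (Sym ⊕ Sym), (∃ s, o = some (.inl s)) ↔ IsLeft o := by
    rintro (_ | s | s) <;> simp [IsLeft]
  have htake : ∀ i ≤ x.length, ((pairWord x y).map (Sum.elim erase id)).take i =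
      (x.map erase).take i := by
    intro i hi
    rw [pairWord, List.map_append, List.take_append_of_le_length (by simpa using hi),
      List.map_map]
    rfl
  simp only [HasTwoSets, getElem?_pairWord_inl, SecondAt, hleft]
  have hlen := length_pairWord x y
  constructor
  · rintro ⟨i, -, ⟨h1, h2⟩, h3⟩
    have hi := (List.getElem?_eq_some_iff.1 h1).1
    rw [htake i hi.le] at h3
    exact ⟨i, hi.le, ⟨h1, fun j _ => h2 j (by omega)⟩, h3⟩
  · rintro ⟨i, hi, ⟨h1, h2⟩, h3⟩
    rw [← htake i hi] at h3
    exact ⟨i, by omega, ⟨h1, fun j _ hj => h2 j (by omega) hj⟩, h3⟩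

/-- For fixed parameters, the verification problem is in `coNP`, and so is the set of pairs of an
input and a constrained explanation. -/
theorem inCoNP_explanationPairs (hA : A.Finite) (hR : R.Finite) (hC : C.Finite)
    (hstrat : Stratified R) (hheads : ∀ r ∈ R, r.head.pred ∉ A) (τ : AgreementKind) :
    InCoNP (ConstrainedCheck τ A R C) ∧ InCoNP (ExplanationPairs τ A R C) := by
  obtain ⟨K₁, hK₁⟩ := exists_varsLt hR
  obtain ⟨K₂, hK₂⟩ := (hC.image foDepth).bddAbove
  have hH := hR.image fun r => r.head.pred
  have hHA : ∀ p ∈ (fun r : Rule V => r.head.pred) '' R, p ∉ A := by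
    rintro _ ⟨r, hr, rfl⟩
    exact hheads r hr
  have hfo := fo_verified hA hH hR hC (K := K₁ + K₂ + 1)
  have hproj := isPolyProjection_verified (H := (fun r : Rule V => r.head.pred) '' R)
    (K := K₁ + K₂ + 1) hA hR hC hstrat hheads τ
    (fun r hr => ⟨r, hr, rfl⟩) hHA (by omega) (fun r hr => (hK₁ r hr).mono (by omega))
    fun φ hφ => by have : foDepth φ ≤ K₂ := hK₂ ⟨φ, hφ, rfl⟩; omega
  generalize hW : Verified A ((fun r : Rule V => r.head.pred) '' R) R C (K₁ + K₂ + 1) = W at *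
  refine ⟨⟨Sym, inferInstance, _, inP_of_FO hfo, hproj⟩, ?_⟩
  -- A word fails to be such a pair if its first part does not have two sets, or if the word without
  -- the separation of its parts is no positive instance of the verification problem.
  refine ⟨Sym, inferInstance, _, inP_of_FO (P := fun w => ¬ HasTwoSets w ∨
    W (w.map (Sum.map erase id))) (fo_hasTwoSets.not.or (hfo.comap (Sum.map erase id))), ?_⟩
  obtain ⟨p, hp⟩ := hproj
  refine ⟨p, fun x => ?_⟩
  have hmap : ∀ y : List Sym,
      (pairWord x y).map (Sum.map erase id) = pairWord (x.map erase) y := fun y => by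
    simp [pairWord, Function.comp_def]
  have hx := hp (x.map erase)
  rw [List.length_map] at hx
  simp only [ExplanationPairs, Set.mem_compl_iff, Set.mem_ofPred_eq, hasTwoSets_pairWord_iff, hmap]
    at hx ⊢
  by_cases hcond : ∃ i ≤ x.length, SecondAt x i ∧ ((x.map erase).take i).countP isSet = 2
  · simp only [hcond, true_and, not_true_eq_false, false_or]
    exact hx
  · simp only [hcond, false_and, not_false_eq_true, true_or, and_true, true_iff]
    exact ⟨[], Nat.zero_le _⟩

end

end Abduction

theorem theorem3 (V : Abduction.Vocabulary) [Encodable V.Pred] [Denumerable V.Const]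
    (τ : Abduction.AgreementKind)
    (A : Set V.Pred) (hA : A.Finite)
    (R : Set (Abduction.Rule V)) (hR : R.Finite)
    (hstrat : Abduction.Stratified R)
    (hheads : ∀ r ∈ R, r.head.pred ∉ A)
    (C : Set V.lang.Sentence) (hC : C.Finite) :
    Abduction.InCoNP (Abduction.ConstrainedCheck τ A R C) ∧
      Abduction.InSigma2P (Abduction.ConstrainedExistence τ A R C) := by
  obtain ⟨h₁, h₂⟩ := Abduction.inCoNP_explanationPairs hA hR hC hstrat hheads τ
  exact ⟨h₁, Abduction.Sym, inferInstance, _, h₂,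
    Abduction.isPolyProjection_explanationPairs hA hR hC hstrat hheads τ⟩
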